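/- Fix a wavenumber $\kappa>0$ with wavelength $\lambda=2\pi/\kappa$, an incidence angle $\theta\in(-\pi/2,\pi/2)$, and a cavity $D_\epsilon=(0,\epsilon)\times(-d,0)$ of width $\epsilon>0$ and depth $d>0$, with aperture $\Gamma_\epsilon^+=(0,\epsilon)\times\{0\}$ and bottom $\Gamma_\epsilon^-=(0,\epsilon)\times\{-d\}$, below the plane $\Gamma_0=\{x_2=0\}$. Let $\phi_0=1/\sqrt\epsilon$, $u^{\rm inc}(x)=e^{i\kappa(x_1\sin\theta-x_2\cos\theta)}$, $u^{\rm ref}(x)=e^{i\kappa(x_1\sin\theta+x_2\cos\theta)}$, and for a function $v$ put $v_0^+=\int_0^\epsilon v(x_1,0)\phi_0\,dx_1$ (values taken from above) and $v_0^-=\int_0^\epsilon v(x_1,-d)\phi_0\,dx_1$. A function $v_\epsilon$ is a solution of the approximate PEC-PMC cavity problem if it is $C^2$ in $\mathbb R^2_+=\{x_2>0\}$, continuous up to $\Gamma_0$, has square-integrable gradient on bounded parts of $\mathbb R^2_+$, and satisfies $$\Delta v_\epsilon+\kappa^2v_\epsilon=0\ \text{ in }\mathbb R^2_+,\qquad \partial_{x_2}v_\epsilon=0\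 \text{ on }\Gamma_0\setminus\overline{\Gamma_\epsilon^+},\qquad \partial_{x_2}v_\epsilon=i\kappa\,\frac{e^{2i\kappa d}+1}{e^{2i\kappa d}-1}\,v_{\epsilon,0}^+\,\phi_0\ \text{ on }\Gamma_\epsilon^+$$ (boundary values of $\partial_{x_2}v_\epsilon$ being limits from $\mathbb R^2_+$), together with the Sommerfeld condition $\sqrt r(\partial_r v^{\rm sc}-i\kappa v^{\rm sc})\to0$ as $r=|x|\to\infty$, uniformly in direction in $\mathbb R^2_+$, for $v^{\rm sc}=v_\epsilon-u^{\rm inc}-u^{\rm ref}$; moreover $v_\epsilon=0$ on $\Gamma_\epsilon^-$, and in $D_\epsilon$ $$v_\epsilon(x)=\bigl(\tilde\alpha_0^+e^{-i\kappa x_2}+\tilde\alpha_0^-e^{i\kappa(x_2+d)}\bigr)\phi_0,\qquad \tilde\alpha_0^+=\frac{e^{i\kappa d}v_{\epsilon,0}^{-}-v_{\epsilon,0}^{+}}{e^{2i\kappa d}-1},\qquad \tilde\alpha_0^-=\frac{e^{i\kappa d}v_{\epsilon,0}^{+}-v_{\epsilon,0}^{-}}{e^{2i\kappa d}-1}.$$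 Theorem. There are constants $\delta,C_3,C_4>0$, independent of $\lambda,\epsilon,d$ (and of $\theta$), such that whenever $\epsilon\le\delta d$ and $d\le\delta\lambda$, every solution $v_\epsilon$ of the approximate problem satisfies $$\|v_\epsilon\|_{L^2(D_\epsilon)}\le C_4\sqrt{\epsilon d},$$ and, if in addition $\epsilon\ln(\lambda/d)\le d$, also $$C_3\sqrt{\epsilon d}\le\|v_\epsilon\|_{L^2(D_\epsilon)}.$$ -/

import Mathlib

open Real MeasureTheory Filter Topology
open scoped Laplacian

noncomputable section

namespace Cavity

/-- The plane `ℝ²` with its Euclidean norm; `x 0` and `x 1` are the coordinates `x₁` and `x₂`. -/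
abbrev Plane : Type := EuclideanSpace ℝ (Fin 2)

/-- The open upper half-plane `x₂ > 0`. -/
def upperHalf : Set Plane := {x | 0 < x 1}

/-- The closed upper half-plane `x₂ ≥ 0`. -/
def closedUpperHalf : Set Plane := {x | 0 ≤ x 1}

/-- The rectangular cavity `(0, ε) × (-d, 0)`. -/
def cavity (ε d : ℝ) : Set Plane := {x | 0 < x 0 ∧ x 0 < ε ∧ -d < x 1 ∧ x 1 < 0}

/-- The bottom side `(0, ε) × {-d}` of the cavity. -/
def bottom (ε d : ℝ) : Set Plane := {x | 0 < x 0 ∧ x 0 < ε ∧ x 1 = -d}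

/-- The wavelength `λ = 2π / κ`. -/
def wavelength (κ : ℝ) : ℝ := 2 * π / κ

/-- The incident plane wave `exp (i κ x · (sin θ, -cos θ))`. -/
def uInc (κ θ : ℝ) (x : Plane) : ℂ :=
  Complex.exp (Complex.I * (κ * (x 0 * sin θ - x 1 * cos θ) : ℝ))

/-- The reflected plane wave `exp (i κ x · (sin θ, cos θ))`. -/
def uRef (κ θ : ℝ) (x : Plane) : ℂ :=
  Complex.exp (Complex.I * (κ * (x 0 * sin θ + x 1 * cos θ) : ℝ))

/-- The lowest waveguide mode `φ₀ = 1 / √ε` on `(0, ε)`. -/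
def phi0 (ε : ℝ) (_x₁ : ℝ) : ℂ := ((1 / √ε : ℝ) : ℂ)

/-- The coefficient `∫₀^ε v(x₁, h) φ₀(x₁) dx₁` of the lowest mode at height `h`
(`h = 0` is the aperture, `h = -d` the bottom). The mode is real-valued. -/
def modeCoeff (ε : ℝ) (v : Plane → ℂ) (h : ℝ) : ℂ :=
  ∫ x₁ in (0 : ℝ)..ε, v !₂[x₁, h] * phi0 ε x₁

/-- The one-mode Dirichlet-to-Neumann map
`B₀[v] = i κ (e^{2iκd} + 1) / (e^{2iκd} - 1) v₀⁺ φ₀` on the aperture. -/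
def dtn0 (κ ε d : ℝ) (v : Plane → ℂ) (x₁ : ℝ) : ℂ :=
  Complex.I * κ * ((Complex.exp (2 * Complex.I * κ * d) + 1) /
    (Complex.exp (2 * Complex.I * κ * d) - 1)) * modeCoeff ε v 0 * phi0 ε x₁

/-- The amplitude `(e^{iκd} v₀⁻ - v₀⁺) / (e^{2iκd} - 1)`, where `vp = v₀⁺` and `vm = v₀⁻`. -/
def alphaPlus (κ d : ℝ) (vp vm : ℂ) : ℂ :=
  (Complex.exp (Complex.I * κ * d) * vm - vp) / (Complex.exp (2 * Complex.I * κ * d) - 1)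

/-- The amplitude `(e^{iκd} v₀⁺ - v₀⁻) / (e^{2iκd} - 1)`, where `vp = v₀⁺` and `vm = v₀⁻`. -/
def alphaMinus (κ d : ℝ) (vp vm : ℂ) : ℂ :=
  (Complex.exp (Complex.I * κ * d) * vp - vm) / (Complex.exp (2 * Complex.I * κ * d) - 1)

/-- The scattered field `v - (uInc + uRef)`. -/
def scattered (κ θ : ℝ) (v : Plane → ℂ) (x : Plane) : ℂ :=
  v x - (uInc κ θ x + uRef κ θ x)

/-- The Sommerfeld radiation condition `√r (∂ᵣ u - i κ u) → 0` as `r = |x| → ∞`,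
uniformly over the directions of the upper half-plane. -/
def Radiating (κ : ℝ) (u : Plane → ℂ) : Prop :=
  Tendsto
    (fun x : Plane => (√‖x‖ : ℂ) * (fderiv ℝ u x (‖x‖⁻¹ • x) - Complex.I * κ * u x))
    (Bornology.cobounded Plane ⊓ 𝓟 upperHalf) (𝓝 0)

/-- `v` is a solution of the approximate PEC-PMC cavity problem with wavenumber `κ`, angle of
incidence `θ`, cavity width `ε` and cavity depth `d`. On `x₂ = 0` the values of `v` are the traces
from above. -/
structure IsApproxSolution (κ θ ε d : ℝ) (v : Plane → ℂ) : Prop where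
  contDiffOn : ContDiffOn ℝ 2 v upperHalf
  continuousOn : ContinuousOn v closedUpperHalf
  /-- Finite energy in bounded parts of the half-plane, including near the aperture's ends. -/
  finiteEnergy : ∀ R : ℝ, MemLp (fderiv ℝ v) 2 (volume.restrict (upperHalf ∩ Metric.ball 0 R))
  helmholtz : ∀ x ∈ upperHalf, Δ v x + (κ : ℂ) ^ 2 * v x = 0
  /-- `∂₂ v = 0` on the conducting plane outside the aperture. -/
  neumann : ∀ a : ℝ, (a < 0 ∨ ε < a) →
    Tendsto (fun x : Plane => fderiv ℝ v x !₂[0, 1]) (𝓝[upperHalf] !₂[a, 0]) (𝓝 0)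
  /-- `∂₂ v = B₀[v]` on the aperture. -/
  aperture : ∀ a : ℝ, 0 < a → a < ε →
    Tendsto (fun x : Plane => fderiv ℝ v x !₂[0, 1]) (𝓝[upperHalf] !₂[a, 0])
      (𝓝 (dtn0 κ ε d v a))
  radiating : Radiating κ (scattered κ θ v)
  bottom_eq_zero : ∀ x ∈ bottom ε d, v x = 0
  cavity_eq : ∀ x ∈ cavity ε d,
    v x = (alphaPlus κ d (modeCoeff ε v 0) (modeCoeff ε v (-d)) *
          Complex.exp (-Complex.I * κ * x 1)
        + alphaMinus κ d (modeCoeff ε v 0) (modeCoeff ε v (-d)) *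
          Complex.exp (Complex.I * κ * (x 1 + d))) * phi0 ε (x 0)

end Cavity

end

/-!
Green's identity in the half-plane for the scattered field `v - (uInc + uRef)` and the outgoing
fundamental solution, doubled by the Neumann condition, represents the trace of `v` on the aperture
`Γ`: there `v = 2 e^{iκ x₁ sin θ} - (c / π) ∫_Γ h(κ |t - x₁|) dt`, where `h = (π i / 2) H₀⁽¹⁾` and
`c = κ cot(κ d) m` is the datum the one-mode condition prescribes, with `m` the mean of `v` over
`Γ`. Averaging over `Γ` leaves a scalar equation `m (1 + κ cot(κ d) V / π) = w`, where `w` is the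
mean of the incident and reflected waves, close to `2`, and `V` is the mean potential of the unit
density on `Γ`. For small arguments `Re h ≥ 0`, so `Re V ≥ 0` and `|m| ≤ |w|`; and `h` is at most
logarithmic at `0`, so `|V| ≤ ε (C + ln (1 / κ ε))`, which together with `κ cot(κ d) ≤ 1 / d` bounds
`|m|` from below as soon as `ε ln (λ / d) ≤ d`. In the cavity
`v = m sin(κ (x₂ + d)) / sin(κ d)`, so the norm of `v` is comparable to `|m| √(ε d)`.

The half-discs of Green's identity meet the ends of the aperture, where the gradient of `v` is not
controlled. It is compared there with radial derivatives, which integration by parts along rays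
turns into values of `v`.
-/

noncomputable section

namespace Cavity

open Complex (I)

/-! ### The outgoing Hankel function -/

/-- The density `(t (t - 2i))^(-1/2)` in the Laplace representation of the Hankel function. -/
def hankelDensity (t : ℝ) : ℂ := ((t : ℂ) * (t - 2 * I)) ^ (-(1 / 2) : ℂ)

/-- The integrand of `hankel n`. -/
def hankelIntegrand (n : ℕ) (r t : ℝ) : ℂ :=
  (I - t) ^ n * Complex.exp (r * (I - t)) * hankelDensity t

/-- The `n`-th derivative of `(π i / 2) H₀⁽¹⁾(r)`, as a Laplace integral that converges for
`r > 0`. -/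
def hankel (n : ℕ) (r : ℝ) : ℂ := ∫ t in Set.Ioi (0 : ℝ), hankelIntegrand n r t

lemma mul_sub_two_I_mem_slitPlane {t : ℝ} (ht : 0 < t) :
    ((t : ℂ) * (t - 2 * I)) ∈ Complex.slitPlane := by
  left
  simpa using ht.ne'

lemma hankelDensity_sq (t : ℝ) :
    hankelDensity t ^ 2 = ((t : ℂ) * (t - 2 * I))⁻¹ := by
  rw [hankelDensity, ← Complex.cpow_nat_mul, ← Complex.cpow_neg_one]
  norm_num

lemma norm_sub_two_I_sq (t : ℝ) : ‖(t : ℂ) - 2 * I‖ ^ 2 = t ^ 2 + 4 := by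
  rw [← Complex.normSq_eq_norm_sq, Complex.normSq_apply]
  simp only [Complex.sub_re, Complex.sub_im, Complex.ofReal_re, Complex.ofReal_im, Complex.mul_re,
    Complex.mul_im, Complex.I_re, Complex.I_im, Complex.re_ofNat, Complex.im_ofNat]
  ring

lemma norm_cexp_mul_I_sub (r t : ℝ) : ‖Complex.exp (r * (I - t))‖ = exp (-(r * t)) := by
  simp [Complex.norm_exp]

lemma rpow_neg_half_sq {t : ℝ} (ht : 0 < t) : (t ^ (-(1 / 2) : ℝ)) ^ 2 = t⁻¹ := by
  rw [← rpow_natCast, ← rpow_mul ht.le, ← rpow_neg_one]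
  norm_num

lemma mul_rpow_neg_half {t : ℝ} (ht : 0 < t) : t * t ^ (-(1 / 2) : ℝ) = t ^ (1 / 2 : ℝ) := by
  nth_rw 1 [← rpow_one t]
  rw [← rpow_add ht]
  norm_num

lemma norm_hankelDensity_le {t : ℝ} (ht : 0 < t) : ‖hankelDensity t‖ ≤ t ^ (-(1 / 2) : ℝ) := by
  refine le_of_sq_le_sq ?_ (by positivity)
  have h : 1 ≤ ‖(t : ℂ) - 2 * I‖ := by
    nlinarith [norm_sub_two_I_sq t, norm_nonneg ((t : ℂ) - 2 * I), sq_nonneg t]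
  rw [rpow_neg_half_sq ht, ← norm_pow, hankelDensity_sq, norm_inv, norm_mul,
    Complex.norm_of_nonneg ht.le]
  exact inv_anti₀ ht (le_mul_of_one_le_right ht.le h)

lemma hankelDensity_re_nonneg (t : ℝ) : 0 ≤ (hankelDensity t).re := by
  set z : ℂ := (t : ℂ) * (t - 2 * I) with hz
  by_cases h0 : z = 0
  · rw [hankelDensity, ← hz, h0, Complex.zero_cpow (by norm_num), Complex.zero_re]
  have him : (Complex.log z * (-(1 / 2))).im = -(1 / 2) * Complex.arg z := by
    rw [show (-(1 / 2) : ℂ) = ((-(1 / 2) : ℝ) : ℂ) by push_cast; ring, Complex.im_mul_ofReal,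
      Complex.log_im, mul_comm]
  rw [hankelDensity, ← hz, Complex.cpow_def_of_ne_zero h0, Complex.exp_re, him]
  refine mul_nonneg (Real.exp_pos _).le (Real.cos_nonneg_of_neg_pi_div_two_le_of_le ?_ ?_) <;>
    linarith [Complex.arg_le_pi z, Complex.neg_pi_lt_arg z]

lemma abs_hankelDensity_im_le {t : ℝ} (ht : 0 < t) :
    |(hankelDensity t).im| ≤ (hankelDensity t).re := by
  refine abs_le_of_sq_le_sq ?_ (hankelDensity_re_nonneg t)
  have hre : 0 ≤ (hankelDensity t ^ 2).re := by
    rw [hankelDensity_sq, Complex.inv_re]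
    refine div_nonneg ?_ (Complex.normSq_nonneg _)
    simpa using (mul_pos ht ht).le
  rw [sq, Complex.mul_re] at hre
  linarith

lemma continuousAt_hankelDensity {t : ℝ} (ht : 0 < t) : ContinuousAt hankelDensity t :=
  ContinuousAt.cpow (by fun_prop) (by fun_prop) (mul_sub_two_I_mem_slitPlane ht)

lemma norm_mul_hankelDensity_sub_one_le {t : ℝ} (ht : 0 < t) :
    ‖t * hankelDensity t - 1‖ ≤ t ^ (-(1 / 2) : ℝ) := by
  have h0 := Complex.slitPlane_ne_zero (mul_sub_two_I_mem_slitPlane ht)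
  have h1 : (t : ℂ) - 2 * I ≠ 0 := (mul_ne_zero_iff.1 h0).2
  have hprod : (t * hankelDensity t - 1) * (t * hankelDensity t + 1) = 2 * I / (t - 2 * I) := by
    have : (t * hankelDensity t - 1) * (t * hankelDensity t + 1) =
        t ^ 2 * hankelDensity t ^ 2 - 1 := by ring
    rw [this, hankelDensity_sq]
    field_simp
    ring
  have hone : 1 ≤ ‖t * hankelDensity t + 1‖ := by
    refine le_trans ?_ (Complex.re_le_norm _)
    simpa using mul_nonneg ht.le (hankelDensity_re_nonneg t)
  have hle : ‖t * hankelDensity t - 1‖ ≤ 2 / ‖(t : ℂ) - 2 * I‖ := by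
    calc ‖t * hankelDensity t - 1‖
        ≤ ‖t * hankelDensity t - 1‖ * ‖t * hankelDensity t + 1‖ :=
          le_mul_of_one_le_right (norm_nonneg _) hone
      _ = 2 / ‖(t : ℂ) - 2 * I‖ := by rw [← norm_mul, hprod, norm_div]; simp
  refine hle.trans (le_of_sq_le_sq ?_ (by positivity))
  rw [rpow_neg_half_sq ht, div_pow, norm_sub_two_I_sq, ← one_div,
    div_le_div_iff₀ (by positivity) ht]
  nlinarith [sq_nonneg (t - 2)]

lemma integrableOn_rpow_mul_exp {s r : ℝ} (hs : -1 < s) (hr : 0 < r) :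
    IntegrableOn (fun t : ℝ => t ^ s * exp (-(r * t))) (Set.Ioi 0) := by
  simpa using integrableOn_rpow_mul_exp_neg_mul_rpow (p := 1) hs one_pos hr

lemma exists_one_add_pow_mul_exp_le (n : ℕ) {r : ℝ} (hr : 0 < r) :
    ∃ C : ℝ, ∀ t : ℝ, 0 < t → (1 + t) ^ n * exp (-(r * t)) ≤ C * exp (-(r / 2 * t)) := by
  set s : ℝ := min 1 (r / (2 * (n + 1)))
  have hs : 0 < s := lt_min one_pos (by positivity)
  refine ⟨s⁻¹ ^ n, fun t ht => ?_⟩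
  have hlin : 1 + t ≤ s⁻¹ * exp (s * t) := by
    rw [← div_eq_inv_mul, le_div_iff₀ hs]
    nlinarith [Real.add_one_le_exp (s * t), min_le_left 1 (r / (2 * (n + 1)))]
  have hns : n * s ≤ r / 2 := by
    have : s ≤ r / (2 * (n + 1)) := min_le_right _ _
    rw [le_div_iff₀ (by positivity)] at this
    nlinarith
  calc (1 + t) ^ n * exp (-(r * t)) ≤ (s⁻¹ * exp (s * t)) ^ n * exp (-(r * t)) := by gcongr
    _ = s⁻¹ ^ n * exp (n * s * t + -(r * t)) := by
      rw [mul_pow, ← Real.exp_nat_mul, mul_assoc, ← Real.exp_add, mul_assoc (n : ℝ)]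
    _ ≤ s⁻¹ ^ n * exp (-(r / 2 * t)) := by
      gcongr
      nlinarith

lemma norm_hankelIntegrand_le (n : ℕ) (r : ℝ) {t : ℝ} (ht : 0 < t) :
    ‖hankelIntegrand n r t‖ ≤ (1 + t) ^ n * exp (-(r * t)) * t ^ (-(1 / 2) : ℝ) := by
  have h : ‖I - t‖ ≤ 1 + t := (norm_sub_le _ _).trans_eq (by simp [abs_of_pos ht])
  rw [hankelIntegrand, norm_mul, norm_mul, norm_pow, norm_cexp_mul_I_sub]
  gcongr
  exact norm_hankelDensity_le ht

lemma exists_norm_hankelIntegrand_le (n : ℕ) {r₀ : ℝ} (hr₀ : 0 < r₀) :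
    ∃ C : ℝ, ∀ r, r₀ ≤ r → ∀ t, 0 < t →
      ‖hankelIntegrand n r t‖ ≤ C * (t ^ (-(1 / 2) : ℝ) * exp (-(r₀ / 2 * t))) := by
  obtain ⟨C, hC⟩ := exists_one_add_pow_mul_exp_le n hr₀
  refine ⟨C, fun r hr t ht => ?_⟩
  calc ‖hankelIntegrand n r t‖
      ≤ (1 + t) ^ n * exp (-(r * t)) * t ^ (-(1 / 2) : ℝ) := norm_hankelIntegrand_le n r ht
    _ ≤ (1 + t) ^ n * exp (-(r₀ * t)) * t ^ (-(1 / 2) : ℝ) := by gcongr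
    _ ≤ C * exp (-(r₀ / 2 * t)) * t ^ (-(1 / 2) : ℝ) :=
      mul_le_mul_of_nonneg_right (hC t ht) (by positivity)
    _ = _ := by ring

lemma aestronglyMeasurable_hankelIntegrand (n : ℕ) (r : ℝ) :
    AEStronglyMeasurable (hankelIntegrand n r) (volume.restrict (Set.Ioi 0)) := by
  refine ContinuousOn.aestronglyMeasurable (fun t ht => ?_) measurableSet_Ioi
  exact (ContinuousAt.mul (by fun_prop) (continuousAt_hankelDensity ht)).continuousWithinAt

lemma integrableOn_hankelIntegrand (n : ℕ) {r : ℝ} (hr : 0 < r) :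
    IntegrableOn (hankelIntegrand n r) (Set.Ioi 0) := by
  obtain ⟨C, hC⟩ := exists_norm_hankelIntegrand_le n hr
  refine Integrable.mono'
    ((integrableOn_rpow_mul_exp (s := -(1 / 2)) (by norm_num) (half_pos hr)).const_mul C)
    (aestronglyMeasurable_hankelIntegrand n r) ?_
  exact (ae_restrict_iff' measurableSet_Ioi).2 (Eventually.of_forall fun t ht => hC r le_rfl t ht)

lemma hasDerivAt_hankelIntegrand (n : ℕ) (r t : ℝ) :
    HasDerivAt (fun s => hankelIntegrand n s t) (hankelIntegrand (n + 1) r t) r := by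
  have hexp := ((Complex.ofRealCLM.hasDerivAt (x := r)).mul_const (I - (t : ℂ))).cexp
  refine ((hexp.const_mul ((I - (t : ℂ)) ^ n)).mul_const (hankelDensity t)).congr_deriv ?_
  simp only [Complex.ofRealCLM_apply, Complex.ofReal_one, one_mul, hankelIntegrand]
  ring

lemma hasDerivAt_hankel (n : ℕ) {r : ℝ} (hr : 0 < r) :
    HasDerivAt (hankel n) (hankel (n + 1) r) r := by
  obtain ⟨C, hC⟩ := exists_norm_hankelIntegrand_le (n + 1) (half_pos hr)
  refine (hasDerivAt_integral_of_dominated_loc_of_deriv_le (Ioi_mem_nhds (half_lt_self hr))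
    (Eventually.of_forall fun s => aestronglyMeasurable_hankelIntegrand n s)
    (integrableOn_hankelIntegrand n hr) (aestronglyMeasurable_hankelIntegrand (n + 1) r)
    ?_ ((integrableOn_rpow_mul_exp (s := -(1 / 2)) (by norm_num)
      (half_pos (half_pos hr))).const_mul C)
    (Eventually.of_forall fun t s _ => hasDerivAt_hankelIntegrand n s t)).2
  exact (ae_restrict_iff' measurableSet_Ioi).2 (Eventually.of_forall fun t ht s hs =>
    hC s (le_of_lt hs) t ht)

lemma continuousAt_hankel (n : ℕ) {r : ℝ} (hr : 0 < r) : ContinuousAt (hankel n) r :=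
  (hasDerivAt_hankel n hr).continuousAt

lemma contDiffOn_hankel (m n : ℕ) : ContDiffOn ℝ m (hankel n) (Set.Ioi 0) := by
  induction m generalizing n with
  | zero => exact contDiffOn_zero.2 fun r hr => (continuousAt_hankel n hr).continuousWithinAt
  | succ m ih =>
    rw [Nat.cast_succ, contDiffOn_succ_iff_deriv_of_isOpen isOpen_Ioi]
    refine ⟨fun r hr => (hasDerivAt_hankel n hr).differentiableAt.differentiableWithinAt,
      by simp, ?_⟩
    exact (ih (n + 1)).congr fun r hr => (hasDerivAt_hankel n hr).deriv

/-- The square root `(t (t - 2i))^(1/2)`, whose product with `exp (r (i - t))` is an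
antiderivative of the integrand of Bessel's equation. -/
def hankelRoot (t : ℝ) : ℂ := ((t : ℂ) * (t - 2 * I)) ^ (1 / 2 : ℂ)

lemma hankelRoot_zero : hankelRoot 0 = 0 := by simp [hankelRoot]

lemma hankelRoot_eq {t : ℝ} (ht : 0 < t) :
    hankelRoot t = (t : ℂ) * (t - 2 * I) * hankelDensity t := by
  have h := Complex.cpow_add (-(1 / 2)) 1
    (Complex.slitPlane_ne_zero (mul_sub_two_I_mem_slitPlane ht))
  rw [Complex.cpow_one] at h
  rw [mul_comm, hankelDensity, ← h, hankelRoot]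
  norm_num

lemma hasDerivAt_hankelRoot {t : ℝ} (ht : 0 < t) :
    HasDerivAt hankelRoot ((t - I) * hankelDensity t) t := by
  have hq : HasDerivAt (fun z : ℂ => z * (z - 2 * I)) (2 * t - 2 * I) (t : ℂ) :=
    ((hasDerivAt_id (t : ℂ)).mul ((hasDerivAt_id (t : ℂ)).sub_const (2 * I))).congr_deriv
      (by simp only [id, one_mul, mul_one]; ring)
  refine (hq.cpow_const (c := (1 / 2 : ℂ))
    (mul_sub_two_I_mem_slitPlane ht)).comp_ofReal.congr_deriv ?_
  rw [hankelDensity]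
  norm_num
  ring

lemma norm_hankelRoot_le {t : ℝ} (ht : 0 < t) :
    ‖hankelRoot t‖ ≤ 2 * ((1 + t) * t ^ (1 / 2 : ℝ)) := by
  have h : ‖(t : ℂ) - 2 * I‖ ≤ 2 * (1 + t) := by
    refine (norm_sub_le _ _).trans ?_
    simp only [Complex.norm_real, norm_mul, Complex.norm_I, Real.norm_of_nonneg ht.le,
      Complex.norm_ofNat]
    linarith
  calc ‖hankelRoot t‖ = t * ‖(t : ℂ) - 2 * I‖ * ‖hankelDensity t‖ := by
        rw [hankelRoot_eq ht, norm_mul, norm_mul, Complex.norm_of_nonneg ht.le]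
    _ ≤ t * (2 * (1 + t)) * t ^ (-(1 / 2) : ℝ) := by gcongr; exact norm_hankelDensity_le ht
    _ = 2 * ((1 + t) * t ^ (1 / 2 : ℝ)) := by rw [← mul_rpow_neg_half ht]; ring

lemma continuousWithinAt_hankelRoot_zero : ContinuousWithinAt hankelRoot (Set.Ici 0) 0 := by
  rw [ContinuousWithinAt, hankelRoot_zero, tendsto_zero_iff_norm_tendsto_zero]
  have hcont : ContinuousAt (fun t : ℝ => 2 * ((1 + t) * t ^ (1 / 2 : ℝ))) 0 :=
    continuousAt_const.mul (ContinuousAt.mul (by fun_prop)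
      (Real.continuousAt_rpow_const _ _ (Or.inr (by norm_num))))
  have hlim : Tendsto (fun t : ℝ => 2 * ((1 + t) * t ^ (1 / 2 : ℝ))) (𝓝[≥] 0) (𝓝 0) := by
    simpa [Real.zero_rpow] using hcont.tendsto.mono_left nhdsWithin_le_nhds
  refine tendsto_of_tendsto_of_tendsto_of_le_of_le' tendsto_const_nhds hlim
    (Eventually.of_forall fun _ => norm_nonneg _) ?_
  filter_upwards [self_mem_nhdsWithin] with t ht
  rcases eq_or_lt_of_le (show 0 ≤ t from ht) with rfl | ht
  · simp [hankelRoot_zero]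
  · exact norm_hankelRoot_le ht

lemma hasDerivAt_cexp_mul_hankelRoot (r : ℝ) {t : ℝ} (ht : 0 < t) :
    HasDerivAt (fun t : ℝ => Complex.exp (r * (I - t)) * hankelRoot t)
      (-(r * (hankelIntegrand 2 r t + hankelIntegrand 0 r t) + hankelIntegrand 1 r t)) t := by
  have hexp := (((Complex.ofRealCLM.hasDerivAt (x := t)).const_sub I).const_mul (r : ℂ)).cexp
  refine (hexp.mul (hasDerivAt_hankelRoot ht)).congr_deriv ?_
  simp only [Complex.ofRealCLM_apply, Complex.ofReal_one, hankelRoot_eq ht, hankelIntegrand]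
  linear_combination (r * Complex.exp (r * (I - t)) * hankelDensity t) * Complex.I_sq

lemma tendsto_cexp_mul_hankelRoot_atTop {r : ℝ} (hr : 0 < r) :
    Tendsto (fun t : ℝ => Complex.exp (r * (I - t)) * hankelRoot t) atTop (𝓝 0) := by
  obtain ⟨C, hC⟩ := exists_one_add_pow_mul_exp_le 1 hr
  have hlim := (tendsto_rpow_mul_exp_neg_mul_atTop_nhds_zero (1 / 2) (r / 2)
    (half_pos hr)).const_mul (2 * C)
  rw [mul_zero] at hlim
  refine squeeze_zero_norm' ?_ hlim
  filter_upwards [eventually_gt_atTop 0] with t ht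
  rw [norm_mul, norm_cexp_mul_I_sub]
  calc exp (-(r * t)) * ‖hankelRoot t‖
      ≤ exp (-(r * t)) * (2 * ((1 + t) * t ^ (1 / 2 : ℝ))) := by
        gcongr
        exact norm_hankelRoot_le ht
    _ = 2 * t ^ (1 / 2 : ℝ) * ((1 + t) ^ 1 * exp (-(r * t))) := by ring
    _ ≤ 2 * t ^ (1 / 2 : ℝ) * (C * exp (-(r / 2 * t))) :=
      mul_le_mul_of_nonneg_left (hC t ht) (by positivity)
    _ = 2 * C * (t ^ (1 / 2 : ℝ) * exp (-(r / 2) * t)) := by rw [neg_mul]; ring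

lemma hankel_bessel {r : ℝ} (hr : 0 < r) : r * (hankel 2 r + hankel 0 r) + hankel 1 r = 0 := by
  have hi := fun n => integrableOn_hankelIntegrand n hr
  have hint : ∫ t in Set.Ioi (0 : ℝ),
      -(r * (hankelIntegrand 2 r t + hankelIntegrand 0 r t) + hankelIntegrand 1 r t) = 0 := by
    have h := integral_Ioi_of_hasDerivAt_of_tendsto (m := 0)
      (ContinuousWithinAt.mul (by fun_prop) continuousWithinAt_hankelRoot_zero)
      (fun t ht => hasDerivAt_cexp_mul_hankelRoot r ht)
      ((((hi 2).add (hi 0)).const_mul (r : ℂ)).add (hi 1)).neg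
      (tendsto_cexp_mul_hankelRoot_atTop hr)
    simpa only [Pi.mul_apply, hankelRoot_zero, mul_zero, sub_zero] using h
  have hi' : IntegrableOn (fun t => r * (hankelIntegrand 2 r t + hankelIntegrand 0 r t))
      (Set.Ioi 0) := ((hi 2).add (hi 0)).const_mul (r : ℂ)
  rwa [integral_neg, integral_add hi' (hi 1),
    integral_const_mul, integral_add (hi 2) (hi 0), neg_eq_zero] at hint

lemma norm_hankel_zero_le {r : ℝ} (hr : 0 < r) :
    ‖hankel 0 r‖ ≤ (1 / r) ^ (1 / 2 : ℝ) * Real.Gamma (1 / 2) := by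
  rw [← Real.integral_rpow_mul_exp_neg_mul_Ioi (by norm_num) hr,
    show (1 / 2 - 1 : ℝ) = -(1 / 2) by norm_num]
  refine norm_integral_le_of_norm_le (integrableOn_rpow_mul_exp (by norm_num) hr) ?_
  refine (ae_restrict_iff' measurableSet_Ioi).2 (Eventually.of_forall fun t ht => ?_)
  exact (norm_hankelIntegrand_le 0 r ht).trans_eq (by rw [pow_zero, one_mul, mul_comm])

lemma hankelIntegrand_one_sub (r t : ℝ) :
    hankelIntegrand 1 r t - I * hankelIntegrand 0 r t =
      -(Complex.exp (r * (I - t)) * (t * hankelDensity t)) := by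
  simp only [hankelIntegrand]
  ring

lemma integrableOn_cexp_mul_hankelDensity {r : ℝ} (hr : 0 < r) :
    IntegrableOn (fun t : ℝ => Complex.exp (r * (I - t)) * (t * hankelDensity t)) (Set.Ioi 0) := by
  refine ((integrableOn_hankelIntegrand 1 hr).sub
    ((integrableOn_hankelIntegrand 0 hr).const_mul I)).neg.congr (Eventually.of_forall fun t => ?_)
  simp only [Pi.neg_apply, Pi.sub_apply, hankelIntegrand_one_sub, neg_neg]

lemma hankel_one_sub {r : ℝ} (hr : 0 < r) :
    hankel 1 r - I * hankel 0 r =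
      -∫ t in Set.Ioi (0 : ℝ), Complex.exp (r * (I - t)) * (t * hankelDensity t) := by
  rw [hankel, hankel, ← integral_const_mul, ← integral_sub (integrableOn_hankelIntegrand 1 hr)
    ((integrableOn_hankelIntegrand 0 hr).const_mul _), ← integral_neg]
  simp only [hankelIntegrand_one_sub]

lemma norm_hankel_one_sub_le {r : ℝ} (hr : 0 < r) :
    ‖hankel 1 r - I * hankel 0 r‖ ≤ (1 / r) ^ (3 / 2 : ℝ) * Real.Gamma (3 / 2) := by
  rw [← Real.integral_rpow_mul_exp_neg_mul_Ioi (by norm_num) hr,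
    show (3 / 2 - 1 : ℝ) = 1 / 2 by norm_num, hankel_one_sub hr, norm_neg]
  refine norm_integral_le_of_norm_le (integrableOn_rpow_mul_exp (by norm_num) hr) ?_
  refine (ae_restrict_iff' measurableSet_Ioi).2 (Eventually.of_forall fun t ht => ?_)
  have ht : 0 < t := ht
  rw [norm_mul, norm_mul, norm_cexp_mul_I_sub, mul_comm, Complex.norm_of_nonneg ht.le,
    ← mul_rpow_neg_half ht]
  gcongr
  exact norm_hankelDensity_le ht

lemma cexp_mul_I_sub (r t : ℝ) :
    Complex.exp (r * (I - t)) = Complex.exp (r * I) * Complex.exp ((-r : ℂ) * t) := by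
  rw [← Complex.exp_add]
  congr 1
  ring

lemma integrableOn_cexp_mul_I_sub {r : ℝ} (hr : 0 < r) :
    IntegrableOn (fun t : ℝ => Complex.exp (r * (I - t))) (Set.Ioi 0) := by
  simp only [cexp_mul_I_sub]
  exact (integrableOn_exp_mul_complex_Ioi (by simpa using hr) 0).const_mul _

lemma integral_cexp_mul_I_sub {r : ℝ} (hr : 0 < r) :
    ∫ t in Set.Ioi (0 : ℝ), Complex.exp (r * (I - t)) = Complex.exp (r * I) / r := by
  simp only [cexp_mul_I_sub]
  rw [integral_const_mul, integral_exp_mul_complex_Ioi (by simpa using hr)]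
  simp [div_eq_mul_inv]

lemma norm_integral_cexp_mul_sub_one_le {r : ℝ} (hr : 0 < r) :
    ‖∫ t in Set.Ioi (0 : ℝ), Complex.exp (r * (I - t)) * (t * hankelDensity t - 1)‖ ≤
      (1 / r) ^ (1 / 2 : ℝ) * Real.Gamma (1 / 2) := by
  rw [← Real.integral_rpow_mul_exp_neg_mul_Ioi (by norm_num) hr,
    show (1 / 2 - 1 : ℝ) = -(1 / 2) by norm_num]
  refine norm_integral_le_of_norm_le (integrableOn_rpow_mul_exp (by norm_num) hr) ?_
  refine (ae_restrict_iff' measurableSet_Ioi).2 (Eventually.of_forall fun t ht => ?_)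
  rw [norm_mul, norm_cexp_mul_I_sub, mul_comm]
  gcongr
  exact norm_mul_hankelDensity_sub_one_le ht

lemma mul_hankel_one_add_one {r : ℝ} (hr : 0 < r) :
    r * hankel 1 r + 1 = I * (r * hankel 0 r) -
      r * (∫ t in Set.Ioi (0 : ℝ), Complex.exp (r * (I - t)) * (t * hankelDensity t - 1)) -
      (Complex.exp (r * I) - 1) := by
  have hr' : (r : ℂ) ≠ 0 := by exact_mod_cast hr.ne'
  simp only [mul_sub_one]
  rw [integral_sub (integrableOn_cexp_mul_hankelDensity hr) (integrableOn_cexp_mul_I_sub hr),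
    integral_cexp_mul_I_sub hr, mul_sub, mul_div_cancel₀ _ hr']
  linear_combination r * hankel_one_sub hr

lemma mul_one_div_rpow_half (r : ℝ) : r * (1 / r) ^ (1 / 2 : ℝ) = √r := by
  rw [← sqrt_eq_rpow, sqrt_div zero_le_one, sqrt_one, mul_one_div, Real.div_sqrt]

lemma norm_mul_hankel_one_add_one_le {r : ℝ} (hr : 0 < r) :
    ‖r * hankel 1 r + 1‖ ≤ 2 * Real.Gamma (1 / 2) * √r + r := by
  have hexp : ‖Complex.exp (r * I) - 1‖ ≤ r := by
    simpa [mul_comm, abs_of_pos hr] using Real.norm_exp_I_mul_ofReal_sub_one_le (x := r)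
  have hzero := mul_le_mul_of_nonneg_left (norm_hankel_zero_le hr) hr.le
  have hrest := mul_le_mul_of_nonneg_left (norm_integral_cexp_mul_sub_one_le hr) hr.le
  rw [← mul_assoc, mul_one_div_rpow_half] at hzero hrest
  rw [mul_hankel_one_add_one hr]
  refine (norm_sub_le _ _).trans (add_le_add ((norm_sub_le _ _).trans ?_) hexp)
  rw [norm_mul, norm_mul, norm_mul, Complex.norm_I, one_mul, Complex.norm_of_nonneg hr.le]
  linarith

-- Both factors of the integrand have argument in an interval around zero that keeps the product in
-- the right half-plane: `exp (i r)` in `[0, π / 4]`, the density in `[-π / 4, π / 4]`.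
lemma hankel_zero_re_nonneg {r : ℝ} (hr : 0 < r) (hr' : r ≤ π / 4) : 0 ≤ (hankel 0 r).re := by
  have hre : (hankel 0 r).re = ∫ t in Set.Ioi (0 : ℝ), (hankelIntegrand 0 r t).re :=
    (integral_re (integrableOn_hankelIntegrand 0 hr)).symm
  rw [hre]
  refine setIntegral_nonneg measurableSet_Ioi fun t ht => ?_
  have hexp : (r : ℂ) * (I - t) = ((-(r * t) : ℝ) : ℂ) + (r : ℝ) * I := by
    push_cast
    ring
  rw [hankelIntegrand, pow_zero, one_mul, hexp, Complex.exp_add, ← Complex.ofReal_exp, mul_assoc,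
    Complex.re_ofReal_mul, Complex.mul_re, Complex.exp_ofReal_mul_I_re,
    Complex.exp_ofReal_mul_I_im]
  refine mul_nonneg (Real.exp_pos _).le ?_
  have hsin : 0 ≤ sin r := sin_nonneg_of_nonneg_of_le_pi hr.le (by linarith [pi_pos])
  have hsin_le_cos : sin r ≤ cos r := by
    rw [← cos_pi_div_two_sub]
    apply cos_le_cos_of_nonneg_of_le_pi <;> linarith [pi_pos]
  have him := (abs_le.1 (abs_hankelDensity_im_le ht)).2
  nlinarith [mul_le_mul_of_nonneg_left him hsin,
    mul_le_mul_of_nonneg_right hsin_le_cos (hankelDensity_re_nonneg t)]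

lemma norm_hankel_one_le {r : ℝ} (hr : 0 < r) :
    ‖hankel 1 r‖ ≤ 1 / r + 2 * Real.Gamma (1 / 2) / √r + 1 := by
  have hmul : r * ‖hankel 1 r‖ ≤ 1 + 2 * Real.Gamma (1 / 2) * √r + r := by
    have h := norm_sub_le (r * hankel 1 r + 1) 1
    rw [add_sub_cancel_right, norm_one, norm_mul, Complex.norm_of_nonneg hr.le] at h
    linarith [norm_mul_hankel_one_add_one_le hr]
  have hsqrt : r / √r = √r := Real.div_sqrt
  refine le_of_mul_le_mul_left (hmul.trans_eq ?_) hr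
  calc 1 + 2 * Real.Gamma (1 / 2) * √r + r
      = r * (1 / r) + 2 * Real.Gamma (1 / 2) * (r / √r) + r := by
        rw [hsqrt, mul_one_div_cancel hr.ne']
    _ = r * (1 / r + 2 * Real.Gamma (1 / 2) / √r + 1) := by ring

lemma integral_one_div_add_div_sqrt {r : ℝ} (hr : 0 < r) (A : ℝ) :
    IntervalIntegrable (fun s => 1 / s + A / √s + 1) volume r 1 ∧
      ∫ s in r..1, (1 / s + A / √s + 1) = -Real.log r + 2 * A * (1 - √r) + (1 - r) := by
  have hpos : ∀ s ∈ Set.uIcc r 1, 0 < s := fun s hs => (lt_min hr one_pos).trans_le hs.1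
  have hcont : ContinuousOn (fun s : ℝ => 1 / s + A / √s + 1) (Set.uIcc r 1) := by
    intro s hs
    have hs' : √s ≠ 0 := (Real.sqrt_pos.2 (hpos s hs)).ne'
    have hs₀ : s ≠ 0 := (hpos s hs).ne'
    exact ContinuousAt.continuousWithinAt (by fun_prop (disch := assumption))
  have hderiv : ∀ s ∈ Set.uIcc r 1, HasDerivAt (fun s => Real.log s + 2 * A * √s + s)
      (1 / s + A / √s + 1) s := by
    intro s hs
    have hs₀ := (hpos s hs).ne'
    refine (((Real.hasDerivAt_log hs₀).add
      ((Real.hasDerivAt_sqrt hs₀).const_mul (2 * A))).add (hasDerivAt_id s)).congr_deriv ?_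
    field_simp
  refine ⟨hcont.intervalIntegrable, ?_⟩
  rw [intervalIntegral.integral_eq_sub_of_hasDerivAt hderiv hcont.intervalIntegrable,
    Real.log_one, Real.sqrt_one]
  ring

lemma exists_norm_hankel_zero_le_log :
    ∃ C : ℝ, 0 ≤ C ∧ ∀ r : ℝ, 0 < r → r ≤ 1 → ‖hankel 0 r‖ ≤ C + Real.log (1 / r) := by
  set A : ℝ := 2 * Real.Gamma (1 / 2)
  refine ⟨‖hankel 0 1‖ + 2 * A + 1, by positivity, fun r hr hr1 => ?_⟩
  have hpos : ∀ s ∈ Set.uIcc r 1, 0 < s := fun s hs => (lt_min hr one_pos).trans_le hs.1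
  have hFTC : ∫ s in r..1, hankel 1 s = hankel 0 1 - hankel 0 r :=
    intervalIntegral.integral_eq_sub_of_hasDerivAt (fun s hs => hasDerivAt_hankel 0 (hpos s hs))
      (ContinuousOn.intervalIntegrable fun s hs =>
        (continuousAt_hankel 1 (hpos s hs)).continuousWithinAt)
  obtain ⟨hint, heq⟩ := integral_one_div_add_div_sqrt hr A
  have hle : ‖hankel 0 1 - hankel 0 r‖ ≤ -Real.log r + 2 * A * (1 - √r) + (1 - r) := by
    rw [← hFTC, ← heq]
    exact intervalIntegral.norm_integral_le_of_norm_le hr1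
      (Eventually.of_forall fun s hs => norm_hankel_one_le (hr.trans hs.1)) hint
  have htri : ‖hankel 0 r‖ ≤ ‖hankel 0 1‖ + ‖hankel 0 1 - hankel 0 r‖ := by
    simpa using norm_sub_le (hankel 0 1) (hankel 0 1 - hankel 0 r)
  have hsqrt : 0 ≤ 2 * A * √r := by positivity
  rw [one_div, Real.log_inv]
  linarith

/-! ### Plane geometry and the stream function -/

lemma plane_eta (x : Plane) : !₂[x 0, x 1] = x := by
  ext i; fin_cases i <;> rfl

lemma plane_eq_smul (a b : ℝ) :
    (!₂[a, b] : Plane) = a • (!₂[1, 0] : Plane) + b • (!₂[0, 1] : Plane) := by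
  ext i; fin_cases i <;> simp

lemma norm_plane (a b : ℝ) : ‖(!₂[a, b] : Plane)‖ = √(a ^ 2 + b ^ 2) := by
  simp [EuclideanSpace.norm_eq]

lemma hasDerivAt_plane {f g : ℝ → ℝ} {f' g' t : ℝ} (hf : HasDerivAt f f' t)
    (hg : HasDerivAt g g' t) : HasDerivAt (fun t => (!₂[f t, g t] : Plane)) !₂[f', g'] t := by
  have h := (hf.smul_const (!₂[1, 0] : Plane)).add (hg.smul_const (!₂[0, 1] : Plane))
  rw [← plane_eq_smul] at h
  exact h.congr_of_eventuallyEq (Eventually.of_forall fun _ => plane_eq_smul _ _)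

lemma isOpen_upperHalf : IsOpen upperHalf :=
  isOpen_lt continuous_const (by fun_prop)

lemma isClosed_closedUpperHalf : IsClosed closedUpperHalf :=
  isClosed_le continuous_const (by fun_prop)

lemma upperHalf_subset_closedUpperHalf : upperHalf ⊆ closedUpperHalf :=
  fun x (hx : 0 < x 1) => hx.le

lemma mem_upperHalf {a b : ℝ} : (!₂[a, b] : Plane) ∈ upperHalf ↔ 0 < b := Iff.rfl

lemma mem_closedUpperHalf {a b : ℝ} : (!₂[a, b] : Plane) ∈ closedUpperHalf ↔ 0 ≤ b := Iff.rfl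

lemma convex_upperHalf : Convex ℝ upperHalf :=
  convex_halfSpace_gt (f := fun x : Plane => x 1) ⟨fun _ _ => rfl, fun _ _ => rfl⟩ 0

/-- The unit vector of polar angle `φ`, so that `p + ρ • unitVec φ` is the point with polar
coordinates `(ρ, φ)` around `p`. -/
def unitVec (φ : ℝ) : Plane := !₂[cos φ, sin φ]

lemma norm_unitVec (φ : ℝ) : ‖unitVec φ‖ = 1 := by
  rw [unitVec, norm_plane, cos_sq_add_sin_sq, sqrt_one]

lemma norm_smul_unitVec {ρ : ℝ} (hρ : 0 ≤ ρ) (φ : ℝ) : ‖ρ • unitVec φ‖ = ρ := by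
  rw [norm_smul, norm_unitVec, mul_one, Real.norm_of_nonneg hρ]

lemma hasDerivAt_unitVec (φ : ℝ) : HasDerivAt unitVec !₂[-sin φ, cos φ] φ :=
  hasDerivAt_plane (hasDerivAt_cos φ) (hasDerivAt_sin φ)

@[fun_prop]
lemma continuous_unitVec : Continuous unitVec :=
  continuous_iff_continuousAt.2 fun φ => (hasDerivAt_unitVec φ).continuousAt

lemma smul_unitVec_mem_upperHalf {ρ φ : ℝ} (hρ : 0 < ρ) (hφ : φ ∈ Set.Ioo 0 π) :
    ρ • unitVec φ ∈ upperHalf :=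
  mul_pos hρ (sin_pos_of_mem_Ioo hφ)

lemma add_smul_unitVec_mem_upperHalf {p : Plane} {ρ φ : ℝ} (hp : p ∈ upperHalf) (hρ : 0 ≤ ρ)
    (hφ : φ ∈ Set.Icc 0 π) : p + ρ • unitVec φ ∈ upperHalf :=
  add_pos_of_pos_of_nonneg hp (mul_nonneg hρ (sin_nonneg_of_mem_Icc hφ))

lemma laplacian_plane (f : Plane → ℂ) (x : Plane) :
    Δ f x = fderiv ℝ (fderiv ℝ f) x !₂[1, 0] !₂[1, 0] +
      fderiv ℝ (fderiv ℝ f) x !₂[0, 1] !₂[0, 1] := by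
  have hfst : EuclideanSpace.single (0 : Fin 2) (1 : ℝ) = !₂[1, 0] := by
    ext i; fin_cases i <;> simp
  have hsnd : EuclideanSpace.single (1 : Fin 2) (1 : ℝ) = !₂[0, 1] := by
    ext i; fin_cases i <;> simp
  rw [InnerProductSpace.laplacian_eq_iteratedFDeriv_orthonormalBasis f
    (EuclideanSpace.basisFun (Fin 2) ℝ)]
  simp [iteratedFDeriv_two_apply, Fin.sum_univ_two, hfst, hsnd]

/-- The clockwise rotation by a right angle. -/
def rotation : Plane →L[ℝ] Plane :=
  LinearMap.toContinuousLinearMap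
    { toFun := fun x => !₂[x 1, -x 0]
      map_add' := fun x y => by ext i; fin_cases i <;> simp; ring
      map_smul' := fun a x => by ext i; fin_cases i <;> simp }

lemma rotation_apply (x : Plane) : rotation x = !₂[x 1, -x 0] := rfl

/-- The Green vector field `g ∇u - u ∇g`, as a linear form. -/
def greenForm (u g : Plane → ℂ) (x : Plane) : Plane →L[ℝ] ℂ :=
  g x • fderiv ℝ u x - u x • fderiv ℝ g x

/-- `Ψ` is a stream function of the Green field of `u` and `g` in the upper half-plane: the flux of
the field through a curve, counted to the right of the curve, is the increment of `Ψ`. -/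
def IsStreamFunction (u g Ψ : Plane → ℂ) : Prop :=
  ∀ x ∈ upperHalf, HasFDerivAt Ψ ((greenForm u g x).comp rotation) x

section StreamFunction

variable {u g Ψ : Plane → ℂ} {x : Plane}

lemma greenForm_apply (u g : Plane → ℂ) (x e : Plane) :
    greenForm u g x e = g x * fderiv ℝ u x e - u x * fderiv ℝ g x e := rfl

lemma contDiffAt_fderiv (hu : ContDiffAt ℝ 2 u x) : ContDiffAt ℝ 1 (fderiv ℝ u) x :=
  hu.fderiv_right (m := 1) (by norm_num)

lemma hasFDerivAt_greenForm (hu : ContDiffAt ℝ 2 u x) (hg : ContDiffAt ℝ 2 g x) :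
    HasFDerivAt (greenForm u g)
      (g x • fderiv ℝ (fderiv ℝ u) x + (fderiv ℝ g x).smulRight (fderiv ℝ u x) -
        (u x • fderiv ℝ (fderiv ℝ g) x + (fderiv ℝ u x).smulRight (fderiv ℝ g x))) x :=
  ((hg.differentiableAt (by norm_num)).hasFDerivAt.smul
    ((contDiffAt_fderiv hu).differentiableAt (by norm_num)).hasFDerivAt).sub
  ((hu.differentiableAt (by norm_num)).hasFDerivAt.smul
    ((contDiffAt_fderiv hg).differentiableAt (by norm_num)).hasFDerivAt)

/-- The Green field of two solutions of the Helmholtz equation is divergence free; rotated, it is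
therefore a closed form. -/
lemma fderiv_greenForm_rotation_comm {k : ℂ} (hu : ContDiffAt ℝ 2 u x) (hg : ContDiffAt ℝ 2 g x)
    (hu' : Δ u x + k * u x = 0) (hg' : Δ g x + k * g x = 0) (v w : Plane) :
    fderiv ℝ (greenForm u g) x v (rotation w) = fderiv ℝ (greenForm u g) x w (rotation v) := by
  rw [laplacian_plane] at hu' hg'
  rw [(hasFDerivAt_greenForm hu hg).fderiv, rotation_apply, rotation_apply,
    plane_eq_smul (w 1), plane_eq_smul (v 1)]
  have hv := (plane_eta v).symm.trans (plane_eq_smul _ _)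
  have hw := (plane_eta w).symm.trans (plane_eq_smul _ _)
  generalize v 0 = v₀, v 1 = v₁, w 0 = w₀, w 1 = w₁ at hv hw ⊢
  rw [hv, hw]
  simp only [sub_apply, add_apply, smul_apply, smul_eq_mul, ContinuousLinearMap.smulRight_apply,
    map_add, map_smul, Complex.real_smul]
  push_cast
  linear_combination (v₀ * w₁ - w₀ * v₁ : ℂ) * (g x * hu' - u x * hg')

lemma exists_isStreamFunction {k : ℂ}
    (hu : ∀ x ∈ upperHalf, ContDiffAt ℝ 2 u x) (hg : ∀ x ∈ upperHalf, ContDiffAt ℝ 2 g x)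
    (hu' : ∀ x ∈ upperHalf, Δ u x + k * u x = 0) (hg' : ∀ x ∈ upperHalf, Δ g x + k * g x = 0) :
    ∃ Ψ, IsStreamFunction u g Ψ := by
  have hderiv : ∀ x ∈ upperHalf, HasFDerivAt (fun x => (greenForm u g x).comp rotation)
      (((ContinuousLinearMap.compL ℝ Plane Plane ℂ).flip rotation).comp
        (fderiv ℝ (greenForm u g) x)) x := fun x hx =>
    ((ContinuousLinearMap.compL ℝ Plane Plane ℂ).flip rotation).hasFDerivAt.comp x
      (hasFDerivAt_greenForm (hu x hx) (hg x hx)).differentiableAt.hasFDerivAt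
  refine convex_upperHalf.exists_forall_hasFDerivAt_of_fderiv_symmetric isOpen_upperHalf
    (fun x hx => (hderiv x hx).differentiableAt.differentiableWithinAt) fun x hx v w => ?_
  rw [(hderiv x hx).fderiv]
  exact fderiv_greenForm_rotation_comm (hu x hx) (hg x hx) (hu' x hx) (hg' x hx) v w

lemma IsStreamFunction.hasDerivAt_comp (hΨ : IsStreamFunction u g Ψ) {γ : ℝ → Plane} {γ' : Plane}
    {t : ℝ} (hγ : HasDerivAt γ γ' t) (ht : γ t ∈ upperHalf) :
    HasDerivAt (fun t => Ψ (γ t)) (greenForm u g (γ t) (rotation γ')) t :=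
  (hΨ _ ht).comp_hasDerivAt t hγ

lemma continuousAt_greenForm_comp {α : Type*} [TopologicalSpace α] {γ e : α → Plane} {a : α}
    (hu : ContDiffAt ℝ 2 u (γ a)) (hg : ContDiffAt ℝ 2 g (γ a)) (hγ : ContinuousAt γ a)
    (he : ContinuousAt e a) : ContinuousAt (fun t => greenForm u g (γ t) (e t)) a :=
  (ContinuousAt.comp (f := γ) (hasFDerivAt_greenForm hu hg).continuousAt hγ).clm_apply he

lemma IsStreamFunction.sub_horizontal (hΨ : IsStreamFunction u g Ψ)
    (hu : ∀ x ∈ upperHalf, ContDiffAt ℝ 2 u x) (hg : ∀ x ∈ upperHalf, ContDiffAt ℝ 2 g x)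
    {η : ℝ} (hη : 0 < η) (s s' : ℝ) :
    Ψ !₂[s', η] - Ψ !₂[s, η] = -∫ t in s..s', greenForm u g !₂[t, η] !₂[0, 1] := by
  have hderiv (t : ℝ) : HasDerivAt (fun t => Ψ !₂[t, η]) (-greenForm u g !₂[t, η] !₂[0, 1]) t := by
    refine (hΨ.hasDerivAt_comp (hasDerivAt_plane (hasDerivAt_id t) (hasDerivAt_const t η))
      hη).congr_deriv ?_
    rw [← map_neg, rotation_apply]
    congr 1
    ext i; fin_cases i <;> simp
  have hcont : Continuous (fun t : ℝ => greenForm u g !₂[t, η] !₂[0, 1]) :=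
    continuous_iff_continuousAt.2 fun t => continuousAt_greenForm_comp (hu !₂[t, η] hη)
      (hg !₂[t, η] hη) (by fun_prop) continuousAt_const
  rw [← intervalIntegral.integral_neg]
  exact (intervalIntegral.integral_eq_sub_of_hasDerivAt (fun t _ => hderiv t)
    (hcont.neg.intervalIntegrable _ _)).symm

lemma continuousAt_flux_density {p : Plane} {z : ℝ × ℝ}
    (hu : ContDiffAt ℝ 2 u (p + z.1 • unitVec z.2))
    (hg : ContDiffAt ℝ 2 g (p + z.1 • unitVec z.2)) :
    ContinuousAt
      (fun z : ℝ × ℝ => z.1 * greenForm u g (p + z.1 • unitVec z.2) (unitVec z.2)) z :=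
  ContinuousAt.mul (by fun_prop) (continuousAt_greenForm_comp hu hg (by fun_prop) (by fun_prop))

lemma IsStreamFunction.sub_arc (hΨ : IsStreamFunction u g Ψ)
    (hu : ∀ x ∈ upperHalf, ContDiffAt ℝ 2 u x) (hg : ∀ x ∈ upperHalf, ContDiffAt ℝ 2 g x)
    {p : Plane} {ρ α β : ℝ} (hmem : ∀ φ ∈ Set.uIcc α β, p + ρ • unitVec φ ∈ upperHalf) :
    Ψ (p + ρ • unitVec β) - Ψ (p + ρ • unitVec α) =
      ∫ φ in α..β, ρ * greenForm u g (p + ρ • unitVec φ) (unitVec φ) := by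
  have hderiv : ∀ φ ∈ Set.uIcc α β, HasDerivAt (fun φ => Ψ (p + ρ • unitVec φ))
      (ρ * greenForm u g (p + ρ • unitVec φ) (unitVec φ)) φ := by
    intro φ hφ
    refine (hΨ.hasDerivAt_comp (((hasDerivAt_unitVec φ).const_smul ρ).const_add p)
      (hmem φ hφ)).congr_deriv ?_
    rw [← Complex.real_smul, ← map_smul, rotation_apply]
    congr 1
    ext i; fin_cases i <;> simp [unitVec]
  have hcont : ContinuousOn (fun φ : ℝ => ρ * greenForm u g (p + ρ • unitVec φ) (unitVec φ))
      (Set.uIcc α β) := fun φ hφ =>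
    (ContinuousAt.comp (f := fun φ : ℝ => (ρ, φ)) (continuousAt_flux_density
      (hu _ (hmem φ hφ)) (hg _ (hmem φ hφ))) (by fun_prop)).continuousWithinAt
  exact (intervalIntegral.integral_eq_sub_of_hasDerivAt hderiv hcont.intervalIntegrable).symm

end StreamFunction

/-! ### Green's identity on a half-disc -/

/-- The Neumann datum equal to `c` on the aperture `(0, ε)` and to `0` elsewhere. -/
def apertureData (ε : ℝ) (c : ℂ) (a : ℝ) : ℂ := if 0 < a ∧ a < ε then c else 0

/-- A solution of the Helmholtz equation in the upper half-plane, continuous up to the boundary,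
with Neumann datum `c` on the aperture and `0` elsewhere, except at the ends of the aperture. -/
structure NeumannField (κ ε : ℝ) (c : ℂ) (u : Plane → ℂ) : Prop where
  contDiffAt : ∀ x ∈ upperHalf, ContDiffAt ℝ 2 u x
  continuousOn : ContinuousOn u closedUpperHalf
  helmholtz : ∀ x ∈ upperHalf, Δ u x + (κ : ℂ) ^ 2 * u x = 0
  neumann : ∀ a : ℝ, a ≠ 0 → a ≠ ε →
    Tendsto (fun x : Plane => fderiv ℝ u x !₂[0, 1]) (𝓝[upperHalf] !₂[a, 0])
      (𝓝 (apertureData ε c a))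

/-- A solution of the Helmholtz equation that is smooth up to the boundary. -/
structure TestField (κ : ℝ) (g : Plane → ℂ) : Prop where
  contDiffAt : ∀ x ∈ closedUpperHalf, ContDiffAt ℝ 2 g x
  helmholtz : ∀ x ∈ upperHalf, Δ g x + (κ : ℂ) ^ 2 * g x = 0

/-- The normal derivative `∂₂ u`, extended to the boundary by the Neumann datum. -/
def normalDeriv (ε : ℝ) (c : ℂ) (u : Plane → ℂ) (x : Plane) : ℂ :=
  if 0 < x 1 then fderiv ℝ u x !₂[0, 1] else apertureData ε c (x 0)

/-- The normal component of the Green field `g ∇u - u ∇g`, extended to the boundary. -/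
def greenNormal (ε : ℝ) (c : ℂ) (u g : Plane → ℂ) (x : Plane) : ℂ :=
  g x * normalDeriv ε c u x - u x * fderiv ℝ g x !₂[0, 1]

/-- What integration by parts along the ray `z + ρ • e` leaves over when the flux density
`ρ * greenForm u g (z + ρ • e) e` is compared with the derivative of
`ρ * (g (z + ρ • e) * (u (z + ρ • e) - u₀))`. -/
def rayRemainder (u g : Plane → ℂ) (u₀ : ℂ) (z e : Plane) (ρ : ℝ) : ℂ :=
  g (z + ρ • e) * (u (z + ρ • e) - u₀) +
    ρ * ((u (z + ρ • e) - u₀ + u (z + ρ • e)) * fderiv ℝ g (z + ρ • e) e)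

section BoundaryValues

variable {κ ε : ℝ} {c : ℂ} {u g : Plane → ℂ}

lemma apertureData_eventuallyEq {a : ℝ} (c : ℂ) (h0 : a ≠ 0) (hε : a ≠ ε) :
    ∀ᶠ b in 𝓝 a, apertureData ε c b = apertureData ε c a := by
  have hleft : ∀ᶠ b in 𝓝 a, (0 < b ↔ 0 < a) := by
    rcases h0.lt_or_gt with h | h
    · filter_upwards [gt_mem_nhds h] with b hb using by simp [hb.not_gt, h.not_gt]
    · filter_upwards [lt_mem_nhds h] with b hb using by simp [hb, h]
  have hright : ∀ᶠ b in 𝓝 a, (b < ε ↔ a < ε) := by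
    rcases hε.lt_or_gt with h | h
    · filter_upwards [gt_mem_nhds h] with b hb using by simp [hb, h]
    · filter_upwards [lt_mem_nhds h] with b hb using by simp [hb.not_gt, h.not_gt]
  filter_upwards [hleft, hright] with b hb hb'
  simp only [apertureData, hb, hb']

lemma norm_apertureData_le (ε : ℝ) (c : ℂ) (a : ℝ) : ‖apertureData ε c a‖ ≤ ‖c‖ := by
  unfold apertureData; split_ifs <;> simp

lemma intervalIntegrable_apertureData (ε : ℝ) (c : ℂ) (a b : ℝ) :
    IntervalIntegrable (apertureData ε c) volume a b := by
  have hind : apertureData ε c = Set.indicator (Set.Ioo 0 ε) fun _ => c := by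
    ext t
    simp [apertureData, Set.indicator_apply]
  rw [hind]
  exact ((integrable_indicator_iff measurableSet_Ioo).2
    (integrableOn_const (by simp))).intervalIntegrable

lemma continuous_trace {E : Type*} [TopologicalSpace E] {f : Plane → E}
    (hf : ContinuousOn f closedUpperHalf) : Continuous fun t : ℝ => f !₂[t, 0] :=
  hf.comp_continuous (by fun_prop) fun _ => mem_closedUpperHalf.2 le_rfl

lemma exists_bound_of_continuousOn {E : Type*} [NormedAddCommGroup E] {f : Plane → E}
    (hf : ContinuousOn f closedUpperHalf) (z : Plane) (r : ℝ) :
    ∃ M, 0 ≤ M ∧ ∀ x ∈ closedUpperHalf, ‖x - z‖ ≤ r → ‖f x‖ ≤ M := by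
  obtain ⟨M, hM⟩ := ((isCompact_closedBall z r).inter_right
    isClosed_closedUpperHalf).exists_bound_of_continuousOn (hf.mono Set.inter_subset_right)
  exact ⟨max M 0, le_max_right _ _, fun x hx hxr =>
    (hM x ⟨mem_closedBall_iff_norm.2 hxr, hx⟩).trans (le_max_left _ _)⟩

namespace TestField

lemma contDiffAt_upperHalf (hg : TestField κ g) : ∀ x ∈ upperHalf, ContDiffAt ℝ 2 g x :=
  fun x hx => hg.contDiffAt x (upperHalf_subset_closedUpperHalf hx)

lemma continuousOn (hg : TestField κ g) : ContinuousOn g closedUpperHalf :=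
  fun x hx => (hg.contDiffAt x hx).continuousAt.continuousWithinAt

lemma continuousOn_fderiv (hg : TestField κ g) : ContinuousOn (fderiv ℝ g) closedUpperHalf :=
  fun x hx => (contDiffAt_fderiv (hg.contDiffAt x hx)).continuousAt.continuousWithinAt

lemma exists_bound (hg : TestField κ g) (z : Plane) (r : ℝ) :
    ∃ C, 0 ≤ C ∧ ∀ x ∈ closedUpperHalf, ‖x - z‖ ≤ r → ‖g x‖ ≤ C ∧ ‖fderiv ℝ g x‖ ≤ C := by
  obtain ⟨A, hA0, hA⟩ := exists_bound_of_continuousOn hg.continuousOn z r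
  obtain ⟨B, -, hB⟩ := exists_bound_of_continuousOn hg.continuousOn_fderiv z r
  exact ⟨max A B, le_max_of_le_left hA0, fun x hx hxr =>
    ⟨le_max_of_le_left (hA x hx hxr), le_max_of_le_right (hB x hx hxr)⟩⟩

end TestField

lemma norm_apply_le_of_norm_eq_one {L : Plane →L[ℝ] ℂ} {e : Plane} {C : ℝ} (hL : ‖L‖ ≤ C)
    (he : ‖e‖ = 1) : ‖L e‖ ≤ C := by
  simpa [he] using L.le_of_opNorm_le hL e

lemma norm_vertical : ‖(!₂[0, 1] : Plane)‖ = 1 := by simp [norm_plane]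

lemma norm_horizontal_sub (a b : ℝ) : ‖(!₂[a, 0] : Plane) - !₂[b, 0]‖ = |a - b| := by
  have hsub : (!₂[a, 0] : Plane) - !₂[b, 0] = !₂[a - b, 0] := by
    ext i; fin_cases i <;> simp
  simp [hsub, norm_plane, Real.sqrt_sq_eq_abs]

lemma greenNormal_eq_greenForm {x : Plane} (hx : 0 < x 1) :
    greenNormal ε c u g x = greenForm u g x !₂[0, 1] := by
  rw [greenNormal, normalDeriv, if_pos hx, greenForm_apply]

lemma greenNormal_boundary (t : ℝ) : greenNormal ε c u g !₂[t, 0] =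
    g !₂[t, 0] * apertureData ε c t - u !₂[t, 0] * fderiv ℝ g !₂[t, 0] !₂[0, 1] := by
  have hneg : ¬ 0 < (!₂[t, 0] : Plane) 1 := lt_irrefl (0 : ℝ)
  rw [greenNormal, normalDeriv, if_neg hneg]
  rfl

lemma norm_greenNormal_boundary_le {C M t : ℝ} (hg : ‖g !₂[t, 0]‖ ≤ C)
    (hg' : ‖fderiv ℝ g !₂[t, 0]‖ ≤ C) (hu : ‖u !₂[t, 0]‖ ≤ M) :
    ‖greenNormal ε c u g !₂[t, 0]‖ ≤ C * ‖c‖ + M * C := by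
  rw [greenNormal_boundary]
  refine (norm_sub_le _ _).trans ?_
  rw [norm_mul, norm_mul]
  exact add_le_add
    (mul_le_mul hg (norm_apertureData_le ε c t) (norm_nonneg _) ((norm_nonneg _).trans hg))
    (mul_le_mul hu (norm_apply_le_of_norm_eq_one hg' norm_vertical) (norm_nonneg _)
      ((norm_nonneg _).trans hu))

lemma intervalIntegrable_greenNormal (hu : NeumannField κ ε c u) (hg : TestField κ g) (a b : ℝ) :
    IntervalIntegrable (fun t => greenNormal ε c u g !₂[t, 0]) volume a b := by
  simp_rw [greenNormal_boundary]
  exact ((intervalIntegrable_apertureData ε c a b).continuousOn_mul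
    (continuous_trace hg.continuousOn).continuousOn).sub
    (((continuous_trace hu.continuousOn).mul
      ((continuous_trace hg.continuousOn_fderiv).clm_apply
        continuous_const)).intervalIntegrable a b)

lemma continuousAt_normalDeriv (hu : NeumannField κ ε c u) {x : Plane} (hx : 0 ≤ x 1)
    (hx0 : x 0 ≠ 0) (hxε : x 0 ≠ ε) : ContinuousAt (normalDeriv ε c u) x := by
  rcases hx.eq_or_lt with hbdry | hpos
  · have hx_eq : !₂[x 0, 0] = x := by rw [hbdry, plane_eta]
    have hval : normalDeriv ε c u x = apertureData ε c (x 0) := if_neg hbdry.not_lt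
    rw [ContinuousAt, hval]
    refine Tendsto.if (p := fun y : Plane => 0 < y 1) ?_ (Tendsto.mono_left ?_ inf_le_left)
    · have hlim := hu.neumann (x 0) hx0 hxε
      rwa [hx_eq] at hlim
    · have hfst : ContinuousAt (fun y : Plane => y 0) x := by fun_prop
      exact tendsto_const_nhds.congr'
        ((hfst.eventually (apertureData_eventuallyEq c hx0 hxε)).mono fun y hy => hy.symm)
  · have hderiv : ContinuousAt (fun y => fderiv ℝ u y !₂[0, 1]) x :=
      (contDiffAt_fderiv (hu.contDiffAt x hpos)).continuousAt.clm_apply continuousAt_const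
    refine hderiv.congr ?_
    filter_upwards [isOpen_upperHalf.mem_nhds hpos] with y hy using (if_pos hy).symm

/-- The normal component is regular near a boundary segment `[s, s']` that avoids the ends of the
aperture; clamping makes this a global statement. -/
lemma continuous_greenNormal_clamp (hu : NeumannField κ ε c u) (hg : TestField κ g) {s s' : ℝ}
    (hle : s ≤ s') (hs : ∀ t ∈ Set.Icc s s', t ≠ 0 ∧ t ≠ ε) :
    Continuous fun z : ℝ × ℝ => greenNormal ε c u g !₂[max s (min z.2 s'), max z.1 0] := by
  have hcont : ContinuousOn (greenNormal ε c u g)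
      (closedUpperHalf ∩ {x | x 0 ≠ 0 ∧ x 0 ≠ ε}) := by
    refine ContinuousOn.sub (ContinuousOn.mul (hg.continuousOn.mono Set.inter_subset_left) ?_)
      ((hu.continuousOn.mono Set.inter_subset_left).mul
        ((hg.continuousOn_fderiv.mono Set.inter_subset_left).clm_apply continuousOn_const))
    exact fun x hx => (continuousAt_normalDeriv hu hx.1 hx.2.1 hx.2.2).continuousWithinAt
  exact hcont.comp_continuous
    (f := fun z : ℝ × ℝ => (!₂[max s (min z.2 s'), max z.1 0] : Plane)) (by fun_prop)
    fun z => ⟨mem_closedUpperHalf.2 (le_max_right _ _),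
      hs _ ⟨le_max_left _ _, max_le hle (min_le_right _ _)⟩⟩

lemma clamp_eq {s s' t : ℝ} (ht : t ∈ Set.Icc s s') : max s (min t s') = t := by
  rw [min_eq_left ht.2, max_eq_right ht.1]

lemma eventually_norm_greenForm_lt (hu : NeumannField κ ε c u) (hg : TestField κ g) {s s' : ℝ}
    (hle : s ≤ s') (hs : ∀ t ∈ Set.Icc s s', t ≠ 0 ∧ t ≠ ε) {B : ℝ}
    (hB : ∀ t ∈ Set.Icc s s', ‖greenNormal ε c u g !₂[t, 0]‖ < B) :
    ∀ᶠ η in 𝓝[>] (0 : ℝ), ∀ t ∈ Set.Icc s s', ‖greenForm u g !₂[t, η] !₂[0, 1]‖ < B := by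
  have hclamp : ∀ᶠ η in 𝓝 (0 : ℝ), ∀ t ∈ Set.Icc s s',
      ‖greenNormal ε c u g !₂[max s (min t s'), max η 0]‖ < B := by
    refine isCompact_Icc.eventually_forall_of_forall_eventually fun t ht => ?_
    refine (continuous_greenNormal_clamp hu hg hle hs).norm.continuousAt.eventually
      (p := fun y => y < B) (gt_mem_nhds ?_)
    simp only [max_self, clamp_eq ht]
    exact hB t ht
  filter_upwards [self_mem_nhdsWithin, nhdsWithin_le_nhds hclamp] with η (hη : 0 < η) hη' t ht
  have hlt := hη' t ht
  rwa [clamp_eq ht, max_eq_left hη.le, greenNormal_eq_greenForm hη] at hlt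

end BoundaryValues

section Flux

variable {κ ε : ℝ} {c : ℂ} {u g Ψ : Plane → ℂ}

lemma IsStreamFunction.tendsto_sub (hΨ : IsStreamFunction u g Ψ) (hu : NeumannField κ ε c u)
    (hg : TestField κ g) {s s' : ℝ} (hs : ∀ t ∈ Set.Icc s s', t ≠ 0 ∧ t ≠ ε) {a b₀ : ℝ}
    (ha : a ∈ Set.Icc s s') (hb₀ : b₀ ∈ Set.Icc s s') {ι : Type*} {l : Filter ι} {η b : ι → ℝ}
    (hη : Tendsto η l (𝓝[>] 0)) (hb : Tendsto b l (𝓝 b₀)) (hbs : ∀ᶠ i in l, b i ∈ Set.Icc s s') :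
    Tendsto (fun i => Ψ !₂[b i, η i] - Ψ !₂[a, η i]) l
      (𝓝 (-∫ t in a..b₀, greenNormal ε c u g !₂[t, 0])) := by
  have hcont : Continuous fun z : ℝ × ℝ => ∫ t in a..z.2,
      greenNormal ε c u g !₂[max s (min t s'), max z.1 0] :=
    intervalIntegral.continuous_parametric_intervalIntegral_of_continuous
      (f := fun (z : ℝ × ℝ) t => greenNormal ε c u g !₂[max s (min t s'), max z.1 0])
      ((continuous_greenNormal_clamp hu hg (ha.1.trans ha.2) hs).comp
        (f := fun w : (ℝ × ℝ) × ℝ => (w.1.1, w.2)) (by fun_prop)) continuous_snd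
  have hunclamp : ∀ {b y : ℝ}, b ∈ Set.Icc s s' → 0 ≤ y →
      ∫ t in a..b, greenNormal ε c u g !₂[max s (min t s'), max y 0] =
        ∫ t in a..b, greenNormal ε c u g !₂[t, y] := by
    intro b y hb hy
    refine intervalIntegral.integral_congr fun t ht => ?_
    simp only [clamp_eq (Set.uIcc_subset_Icc ha hb ht), max_eq_left hy]
  have hlim := ((hcont.tendsto (0, b₀)).comp
    ((tendsto_nhdsWithin_iff.1 hη).1.prodMk_nhds hb)).neg
  rw [hunclamp hb₀ le_rfl] at hlim
  refine hlim.congr' ?_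
  filter_upwards [hbs, (tendsto_nhdsWithin_iff.1 hη).2] with i hbi (hηi : 0 < η i)
  rw [Function.comp_apply, hunclamp hbi hηi.le,
    hΨ.sub_horizontal hu.contDiffAt hg.contDiffAt_upperHalf hηi]
  congr 1
  exact intervalIntegral.integral_congr fun t _ => greenNormal_eq_greenForm hηi

lemma hasDerivAt_ray {z e : Plane} {ρ : ℝ} (u₀ : ℂ) (hu : ContDiffAt ℝ 2 u (z + ρ • e))
    (hg : ContDiffAt ℝ 2 g (z + ρ • e)) :
    HasDerivAt (fun ρ : ℝ => ρ * (g (z + ρ • e) * (u (z + ρ • e) - u₀)))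
      (ρ * greenForm u g (z + ρ • e) e + rayRemainder u g u₀ z e ρ) ρ := by
  have hray : HasDerivAt (fun ρ : ℝ => z + ρ • e) e ρ := by
    simpa using ((hasDerivAt_id ρ).smul_const e).const_add z
  have hu' := (hu.differentiableAt (by norm_num)).hasFDerivAt.comp_hasDerivAt ρ hray
  have hg' := (hg.differentiableAt (by norm_num)).hasFDerivAt.comp_hasDerivAt ρ hray
  refine ((Complex.ofRealCLM.hasDerivAt (x := ρ)).mul
    (hg'.mul (hu'.sub_const u₀))).congr_deriv ?_
  simp only [rayRemainder, greenForm_apply, Complex.ofRealCLM_apply, Function.comp_apply,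
    Complex.ofReal_one, Pi.mul_apply]
  ring

lemma continuousAt_rayRemainder {z e : Plane} {ρ : ℝ} (u₀ : ℂ)
    (hu : ContDiffAt ℝ 2 u (z + ρ • e)) (hg : ContDiffAt ℝ 2 g (z + ρ • e)) :
    ContinuousAt (rayRemainder u g u₀ z e) ρ := by
  have hray : ContinuousAt (fun ρ : ℝ => z + ρ • e) ρ := by fun_prop
  have hu' := ContinuousAt.comp (f := fun ρ : ℝ => z + ρ • e) hu.continuousAt hray
  have hg' := ContinuousAt.comp (f := fun ρ : ℝ => z + ρ • e) hg.continuousAt hray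
  have hdg := (ContinuousAt.comp (f := fun ρ : ℝ => z + ρ • e)
    (contDiffAt_fderiv hg).continuousAt hray).clm_apply (continuousAt_const (y := e))
  exact (hg'.mul (hu'.sub continuousAt_const)).add (ContinuousAt.mul (by fun_prop)
    (((hu'.sub continuousAt_const).add hu').mul hdg))

lemma norm_rayRemainder_le {z e : Plane} {u₀ : ℂ} {ρ C M τ : ℝ} (hρ : 0 ≤ ρ) (he : ‖e‖ = 1)
    (hg : ‖g (z + ρ • e)‖ ≤ C) (hg' : ‖fderiv ℝ g (z + ρ • e)‖ ≤ C)
    (hM : ‖u (z + ρ • e)‖ ≤ M) (hτ : ‖u (z + ρ • e) - u₀‖ ≤ τ) :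
    ‖rayRemainder u g u₀ z e ρ‖ ≤ C * τ + ρ * ((τ + M) * C) := by
  refine (norm_add_le _ _).trans ?_
  rw [norm_mul, norm_mul, norm_mul, Complex.norm_of_nonneg hρ]
  have hC : 0 ≤ C := (norm_nonneg _).trans hg
  have hsum := (norm_add_le _ _).trans (add_le_add hτ hM)
  have hderiv := norm_apply_le_of_norm_eq_one hg' he
  gcongr
  exact (norm_nonneg _).trans hsum

lemma integral_ray {z e : Plane} (u₀ : ℂ) {a b : ℝ}
    (hu : ∀ ρ ∈ Set.uIcc a b, ContDiffAt ℝ 2 u (z + ρ • e))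
    (hg : ∀ ρ ∈ Set.uIcc a b, ContDiffAt ℝ 2 g (z + ρ • e)) :
    ∫ ρ in a..b, ρ * greenForm u g (z + ρ • e) e =
      b * (g (z + b • e) * (u (z + b • e) - u₀)) - a * (g (z + a • e) * (u (z + a • e) - u₀)) -
        ∫ ρ in a..b, rayRemainder u g u₀ z e ρ := by
  have hflux : IntervalIntegrable (fun ρ : ℝ => ρ * greenForm u g (z + ρ • e) e) volume a b :=
    ContinuousOn.intervalIntegrable fun ρ hρ =>
      (ContinuousAt.mul (by fun_prop) (continuousAt_greenForm_comp (γ := fun ρ : ℝ => z + ρ • e)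
        (hu ρ hρ) (hg ρ hρ) (by fun_prop) continuousAt_const)).continuousWithinAt
  have hrem : IntervalIntegrable (rayRemainder u g u₀ z e) volume a b :=
    ContinuousOn.intervalIntegrable fun ρ hρ =>
      (continuousAt_rayRemainder u₀ (hu ρ hρ) (hg ρ hρ)).continuousWithinAt
  rw [eq_sub_iff_add_eq, ← intervalIntegral.integral_add hflux hrem]
  exact intervalIntegral.integral_eq_sub_of_hasDerivAt
    (fun ρ hρ => hasDerivAt_ray u₀ (hu ρ hρ) (hg ρ hρ)) (hflux.add hrem)

/-- A flux through arcs, averaged over the radius, is controlled by the oscillation of `u` alone: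
integrating by parts along the rays removes the gradient of `u`. -/
lemma norm_integral_ray_le {S : Set Plane} (hu : ∀ x ∈ S, ContDiffAt ℝ 2 u x)
    (hg : ∀ x ∈ S, ContDiffAt ℝ 2 g x) {u₀ : ℂ} {C M τ : ℝ} (hgC : ∀ x ∈ S, ‖g x‖ ≤ C)
    (hgC' : ∀ x ∈ S, ‖fderiv ℝ g x‖ ≤ C) (huM : ∀ x ∈ S, ‖u x‖ ≤ M)
    (huτ : ∀ x ∈ S, ‖u x - u₀‖ ≤ τ) {z e : Plane} (he : ‖e‖ = 1) {ρ₀ : ℝ} (hρ₀ : 0 < ρ₀)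
    (hρ₀' : 2 * ρ₀ ≤ 1) (hS : ∀ ρ ∈ Set.Icc ρ₀ (2 * ρ₀), z + ρ • e ∈ S) :
    ‖∫ ρ in ρ₀..2 * ρ₀, ρ * greenForm u g (z + ρ • e) e‖ ≤ ρ₀ * (C * (5 * τ + 2 * ρ₀ * M)) := by
  have hle : ρ₀ ≤ 2 * ρ₀ := by linarith
  rw [← Set.uIcc_of_le hle] at hS
  set P : ℝ → ℂ := fun ρ => ρ * (g (z + ρ • e) * (u (z + ρ • e) - u₀))
  have hP : ∀ ρ ∈ Set.uIcc ρ₀ (2 * ρ₀), 0 ≤ ρ → ‖P ρ‖ ≤ ρ * (C * τ) := fun ρ hρ hρ0 => by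
    rw [norm_mul, norm_mul, Complex.norm_of_nonneg hρ0]
    have hC := hgC _ (hS ρ hρ)
    exact mul_le_mul_of_nonneg_left (mul_le_mul hC (huτ _ (hS ρ hρ)) (norm_nonneg _)
      ((norm_nonneg _).trans hC)) hρ0
  have hC0 := (norm_nonneg _).trans (hgC _ (hS _ Set.left_mem_uIcc))
  have hτ0 := (norm_nonneg _).trans (huτ _ (hS _ Set.left_mem_uIcc))
  have hM0 := (norm_nonneg _).trans (huM _ (hS _ Set.left_mem_uIcc))
  have hR := intervalIntegral.norm_integral_le_of_norm_le_const
    (C := C * τ + 2 * ρ₀ * ((τ + M) * C)) (fun ρ hρ => by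
      have hmem := hS ρ (Set.uIoc_subset_uIcc hρ)
      rw [Set.uIoc_of_le hle] at hρ
      refine (norm_rayRemainder_le (hρ₀.le.trans hρ.1.le) he (hgC _ hmem) (hgC' _ hmem)
        (huM _ hmem) (huτ _ hmem)).trans ?_
      gcongr
      exact hρ.2)
  rw [abs_of_nonneg (sub_nonneg.2 hle)] at hR
  rw [integral_ray u₀ (fun ρ hρ => hu _ (hS ρ hρ)) fun ρ hρ => hg _ (hS ρ hρ)]
  calc ‖P (2 * ρ₀) - P ρ₀ - ∫ ρ in ρ₀..2 * ρ₀, rayRemainder u g u₀ z e ρ‖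
      ≤ 2 * ρ₀ * (C * τ) + ρ₀ * (C * τ) +
          (C * τ + 2 * ρ₀ * ((τ + M) * C)) * (2 * ρ₀ - ρ₀) :=
        (norm_sub_le _ _).trans (add_le_add ((norm_sub_le _ _).trans (add_le_add
          (hP _ Set.right_mem_uIcc (by linarith)) (hP _ Set.left_mem_uIcc hρ₀.le))) hR)
    _ = ρ₀ * (C * (4 * τ + 2 * ρ₀ * τ + 2 * ρ₀ * M)) := by ring
    _ ≤ ρ₀ * (C * (4 * τ + 1 * τ + 2 * ρ₀ * M)) := by gcongr
    _ = ρ₀ * (C * (5 * τ + 2 * ρ₀ * M)) := by ring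

lemma norm_integral_flux_le {z : Plane} (hz : z ∈ upperHalf) {ρ₀ : ℝ} (hρ₀ : 0 < ρ₀)
    (hρ₀' : 2 * ρ₀ ≤ 1) (hu : ∀ x ∈ upperHalf, ContDiffAt ℝ 2 u x)
    (hg : ∀ x ∈ upperHalf, ContDiffAt ℝ 2 g x) {u₀ : ℂ} {C M τ : ℝ}
    (hgC : ∀ x ∈ upperHalf, ‖x - z‖ ≤ 2 * ρ₀ → ‖g x‖ ≤ C)
    (hgC' : ∀ x ∈ upperHalf, ‖x - z‖ ≤ 2 * ρ₀ → ‖fderiv ℝ g x‖ ≤ C)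
    (huM : ∀ x ∈ upperHalf, ‖x - z‖ ≤ 2 * ρ₀ → ‖u x‖ ≤ M)
    (huτ : ∀ x ∈ upperHalf, ‖x - z‖ ≤ 2 * ρ₀ → ‖u x - u₀‖ ≤ τ) :
    ‖∫ ρ in ρ₀..2 * ρ₀, ∫ φ in (0 : ℝ)..π, ρ * greenForm u g (z + ρ • unitVec φ) (unitVec φ)‖ ≤
      ρ₀ * (C * (5 * τ + 2 * ρ₀ * M)) * π := by
  have hle : ρ₀ ≤ 2 * ρ₀ := by linarith
  have hmem : ∀ ρ ∈ Set.Icc ρ₀ (2 * ρ₀), ∀ φ ∈ Set.Icc 0 π, z + ρ • unitVec φ ∈ upperHalf :=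
    fun ρ hρ φ hφ => add_smul_unitVec_mem_upperHalf hz (hρ₀.le.trans hρ.1) hφ
  have hcont : ContinuousOn (Function.uncurry fun ρ φ : ℝ =>
      ρ * greenForm u g (z + ρ • unitVec φ) (unitVec φ))
      (Set.Icc ρ₀ (2 * ρ₀) ×ˢ Set.Icc 0 π) := fun w hw =>
    (continuousAt_flux_density (hu _ (hmem _ hw.1 _ hw.2))
      (hg _ (hmem _ hw.1 _ hw.2))).continuousWithinAt
  rw [intervalIntegral_intervalIntegral_swap]
  · refine (intervalIntegral.norm_integral_le_of_norm_le_const fun φ hφ => ?_).trans_eq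
      (by rw [sub_zero, abs_of_pos pi_pos])
    rw [Set.uIoc_of_le pi_pos.le] at hφ
    refine norm_integral_ray_le (S := upperHalf ∩ {x | ‖x - z‖ ≤ 2 * ρ₀})
      (fun x hx => hu x hx.1) (fun x hx => hg x hx.1) (fun x hx => hgC x hx.1 hx.2)
      (fun x hx => hgC' x hx.1 hx.2) (fun x hx => huM x hx.1 hx.2) (fun x hx => huτ x hx.1 hx.2)
      (norm_unitVec φ) hρ₀ hρ₀' fun ρ hρ => ⟨hmem ρ hρ φ (Set.Ioc_subset_Icc_self hφ), ?_⟩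
    rw [Set.mem_ofPred, add_sub_cancel_left, norm_smul_unitVec (hρ₀.le.trans hρ.1)]
    exact hρ.2
  · rw [Set.uIoc_of_le hle, Set.uIoc_of_le pi_pos.le]
    exact (hcont.integrableOn_compact (isCompact_Icc.prod isCompact_Icc)).mono_set
      (Set.prod_mono Set.Ioc_subset_Icc_self Set.Ioc_subset_Icc_self)

end Flux

section AcrossEnds

variable {κ ε : ℝ} {c : ℂ} {u g Ψ : Plane → ℂ}

lemma norm_le_of_norm_integral_le {E : Type*} [NormedAddCommGroup E] [NormedSpace ℝ E]
    [CompleteSpace E] {f : ℝ → E} {z : E} {a b A K : ℝ} (hab : a < b)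
    (hf : IntervalIntegrable f volume a b) (hA : ‖∫ t in a..b, f t‖ ≤ (b - a) * A)
    (hK : ∀ t ∈ Set.Ioc a b, ‖f t - z‖ ≤ K) : ‖z‖ ≤ A + K := by
  have hba : 0 < b - a := sub_pos.2 hab
  have hsplit : (b - a) • z = (∫ t in a..b, f t) - ∫ t in a..b, (f t - z) := by
    rw [intervalIntegral.integral_sub hf intervalIntegrable_const,
      intervalIntegral.integral_const, sub_sub_cancel]
  have hosc := intervalIntegral.norm_integral_le_of_norm_le_const fun t ht =>
    hK t (Set.uIoc_of_le hab.le ▸ ht)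
  refine le_of_mul_le_mul_left ?_ hba
  calc (b - a) * ‖z‖ = ‖(b - a) • z‖ := by rw [norm_smul, Real.norm_of_nonneg hba.le]
    _ ≤ (b - a) * A + K * |b - a| := by
      rw [hsplit]; exact (norm_sub_le _ _).trans (add_le_add hA hosc)
    _ = (b - a) * (A + K) := by rw [abs_of_pos hba]; ring

lemma eventually_ne_of_le_abs_sub (p q : ℝ) :
    ∀ᶠ ρ in 𝓝[>] (0 : ℝ), ∀ t, ρ ≤ |t - p| → |t - p| ≤ 2 * ρ → t ≠ q := by
  rcases eq_or_ne q p with rfl | hq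
  · filter_upwards [self_mem_nhdsWithin] with ρ (hρ : 0 < ρ) t ht _ rfl
    simp only [sub_self, abs_zero] at ht
    exact hρ.not_ge ht
  · filter_upwards [nhdsWithin_le_nhds (gt_mem_nhds (half_pos (abs_pos.2 (sub_ne_zero.2 hq))))]
      with ρ hρ t _ ht rfl
    linarith

lemma eventually_forall_norm_greenForm_lt (hu : NeumannField κ ε c u) (hg : TestField κ g)
    {p r B : ℝ} (hr : 0 < r) (hB : ∀ t, |t - p| ≤ r → ‖greenNormal ε c u g !₂[t, 0]‖ < B) :
    ∀ᶠ ρ in 𝓝[>] (0 : ℝ), ∀ᶠ η in 𝓝[>] (0 : ℝ),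
      (∀ t ∈ Set.Icc (p + ρ) (p + 2 * ρ), ‖greenForm u g !₂[t, η] !₂[0, 1]‖ < B) ∧
        ∀ t ∈ Set.Icc (p - 2 * ρ) (p - ρ), ‖greenForm u g !₂[t, η] !₂[0, 1]‖ < B := by
  filter_upwards [self_mem_nhdsWithin, nhdsWithin_le_nhds (gt_mem_nhds (half_pos hr)),
    eventually_ne_of_le_abs_sub p 0, eventually_ne_of_le_abs_sub p ε]
    with ρ (hρ : 0 < ρ) hρr hne0 hneε
  have hside : ∀ s s', s ≤ s' → (∀ t ∈ Set.Icc s s', ρ ≤ |t - p| ∧ |t - p| ≤ 2 * ρ) →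
      ∀ᶠ η in 𝓝[>] (0 : ℝ), ∀ t ∈ Set.Icc s s', ‖greenForm u g !₂[t, η] !₂[0, 1]‖ < B :=
    fun s s' hs ht => eventually_norm_greenForm_lt hu hg hs
      (fun t hts => ⟨hne0 t (ht t hts).1 (ht t hts).2, hneε t (ht t hts).1 (ht t hts).2⟩)
      fun t hts => hB t ((ht t hts).2.trans (by linarith))
  exact (hside (p + ρ) (p + 2 * ρ) (by linarith) fun t ht => by
      rw [abs_of_nonneg (by linarith [ht.1])]; constructor <;> linarith [ht.1, ht.2]).and
    (hside (p - 2 * ρ) (p - ρ) (by linarith) fun t ht => by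
      rw [abs_of_nonpos (by linarith [ht.2])]; constructor <;> linarith [ht.1, ht.2])

lemma tendsto_integral_shrinking {E : Type*} [NormedAddCommGroup E] [NormedSpace ℝ E]
    {f : ℝ → E} (hf : ∀ a b, IntervalIntegrable f volume a b) (p : ℝ) :
    Tendsto (fun ρ => ∫ t in p - ρ..p + ρ, f t) (𝓝 0) (𝓝 0) := by
  have hcont : Continuous fun ρ : ℝ => (∫ t in p..p + ρ, f t) - ∫ t in p..p - ρ, f t :=
    ((intervalIntegral.continuous_primitive hf p).comp (continuous_const_add p)).sub
      ((intervalIntegral.continuous_primitive hf p).comp (continuous_const.sub continuous_id))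
  simp_rw [intervalIntegral.integral_interval_sub_left (hf _ _) (hf _ _)] at hcont
  exact hcont.tendsto' 0 0 (by simp)

namespace IsStreamFunction

lemma continuous_horizontal (hΨ : IsStreamFunction u g Ψ) {η : ℝ} (hη : 0 < η) :
    Continuous fun t => Ψ !₂[t, η] :=
  continuous_iff_continuousAt.2 fun t =>
    ContinuousAt.comp (f := fun t : ℝ => (!₂[t, η] : Plane))
      (hΨ _ (mem_upperHalf.2 hη)).continuousAt (by fun_prop)

lemma norm_sub_horizontal_le (hΨ : IsStreamFunction u g Ψ)
    (hu : ∀ x ∈ upperHalf, ContDiffAt ℝ 2 u x) (hg : ∀ x ∈ upperHalf, ContDiffAt ℝ 2 g x)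
    {η : ℝ} (hη : 0 < η) {s s' B : ℝ} (hs : s ≤ s')
    (hB : ∀ t ∈ Set.Icc s s', ‖greenForm u g !₂[t, η] !₂[0, 1]‖ ≤ B) :
    ‖Ψ !₂[s', η] - Ψ !₂[s, η]‖ ≤ B * (s' - s) := by
  rw [hΨ.sub_horizontal hu hg hη, norm_neg, ← abs_of_nonneg (sub_nonneg.2 hs)]
  exact intervalIntegral.norm_integral_le_of_norm_le_const fun t ht =>
    hB t (Set.Ioc_subset_Icc_self (Set.uIoc_of_le hs ▸ ht))

lemma sub_semicircle (hΨ : IsStreamFunction u g Ψ) (hu : ∀ x ∈ upperHalf, ContDiffAt ℝ 2 u x)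
    (hg : ∀ x ∈ upperHalf, ContDiffAt ℝ 2 g x) {p η ρ : ℝ} (hη : 0 < η) (hρ : 0 ≤ ρ) :
    Ψ !₂[p + ρ, η] - Ψ !₂[p - ρ, η] =
      -∫ φ in (0 : ℝ)..π, ρ * greenForm u g (!₂[p, η] + ρ • unitVec φ) (unitVec φ) := by
  have hleft : (!₂[p, η] + ρ • unitVec π : Plane) = !₂[p - ρ, η] := by
    ext i; fin_cases i <;> simp [unitVec, sub_eq_add_neg]
  have hright : (!₂[p, η] + ρ • unitVec 0 : Plane) = !₂[p + ρ, η] := by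
    ext i; fin_cases i <;> simp [unitVec]
  rw [← hΨ.sub_arc hu hg fun φ hφ => add_smul_unitVec_mem_upperHalf (mem_upperHalf.2 hη) hρ
    (Set.uIcc_of_le pi_pos.le ▸ hφ), hleft, hright, neg_sub]

lemma norm_integral_sub_le (hΨ : IsStreamFunction u g Ψ)
    (hu : ∀ x ∈ upperHalf, ContDiffAt ℝ 2 u x) (hg : ∀ x ∈ upperHalf, ContDiffAt ℝ 2 g x)
    {p η ρ₀ : ℝ} (hη : 0 < η) (hηρ : η ≤ ρ₀) (hρ₀ : 2 * ρ₀ ≤ 1) {u₀ : ℂ} {C M τ : ℝ}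
    (hgC : ∀ x ∈ upperHalf, ‖x - !₂[p, 0]‖ ≤ 3 * ρ₀ → ‖g x‖ ≤ C ∧ ‖fderiv ℝ g x‖ ≤ C)
    (huM : ∀ x ∈ upperHalf, ‖x - !₂[p, 0]‖ ≤ 3 * ρ₀ → ‖u x‖ ≤ M)
    (huτ : ∀ x ∈ upperHalf, ‖x - !₂[p, 0]‖ ≤ 3 * ρ₀ → ‖u x - u₀‖ ≤ τ) :
    ‖∫ ρ in ρ₀..2 * ρ₀, (Ψ !₂[p + ρ, η] - Ψ !₂[p - ρ, η])‖ ≤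
      ρ₀ * (C * (5 * τ + 2 * ρ₀ * M)) * π := by
  have hρ₀' : 0 < ρ₀ := hη.trans_le hηρ
  have hball : ∀ x : Plane, ‖x - !₂[p, η]‖ ≤ 2 * ρ₀ → ‖x - !₂[p, 0]‖ ≤ 3 * ρ₀ := by
    intro x hx
    have hvert : ‖(!₂[p, η] : Plane) - !₂[p, 0]‖ = η := by
      have hsub : (!₂[p, η] : Plane) - !₂[p, 0] = !₂[0, η] := by ext i; fin_cases i <;> simp
      simp [hsub, norm_plane, Real.sqrt_sq hη.le]
    linarith [norm_sub_le_norm_sub_add_norm_sub x !₂[p, η] !₂[p, 0]]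
  rw [intervalIntegral.integral_congr fun ρ hρ => hΨ.sub_semicircle hu hg hη
    (hρ₀'.le.trans (Set.uIcc_of_le (a := ρ₀) (b := 2 * ρ₀) (by linarith) ▸ hρ).1),
    intervalIntegral.integral_neg, norm_neg]
  exact norm_integral_flux_le (mem_upperHalf.2 hη) hρ₀' hρ₀ hu hg
    (fun x hx hxr => (hgC x hx (hball x hxr)).1) (fun x hx hxr => (hgC x hx (hball x hxr)).2)
    (fun x hx hxr => huM x hx (hball x hxr)) (fun x hx hxr => huτ x hx (hball x hxr))

lemma norm_sub_across_le (hΨ : IsStreamFunction u g Ψ)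
    (hu : ∀ x ∈ upperHalf, ContDiffAt ℝ 2 u x) (hg : ∀ x ∈ upperHalf, ContDiffAt ℝ 2 g x)
    {p η ρ₀ A B : ℝ} (hη : 0 < η) (hρ₀ : 0 < ρ₀)
    (hA : ‖∫ ρ in ρ₀..2 * ρ₀, (Ψ !₂[p + ρ, η] - Ψ !₂[p - ρ, η])‖ ≤ ρ₀ * A)
    (hright : ∀ t ∈ Set.Icc (p + ρ₀) (p + 2 * ρ₀), ‖greenForm u g !₂[t, η] !₂[0, 1]‖ ≤ B)
    (hleft : ∀ t ∈ Set.Icc (p - 2 * ρ₀) (p - ρ₀), ‖greenForm u g !₂[t, η] !₂[0, 1]‖ ≤ B) :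
    ‖Ψ !₂[p + ρ₀, η] - Ψ !₂[p - ρ₀, η]‖ ≤ A + 2 * (B * ρ₀) := by
  have hB : 0 ≤ B := (norm_nonneg _).trans (hright _ ⟨le_rfl, by linarith⟩)
  have hcont := hΨ.continuous_horizontal hη
  refine norm_le_of_norm_integral_le (f := fun ρ => Ψ !₂[p + ρ, η] - Ψ !₂[p - ρ, η])
    (a := ρ₀) (b := 2 * ρ₀) (by linarith) (((hcont.comp (continuous_const_add p)).sub
      (hcont.comp (continuous_const.sub continuous_id))).intervalIntegrable _ _)
    (by rwa [two_mul, add_sub_cancel_right, ← two_mul]) fun ρ hρ => ?_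
  have hr := hΨ.norm_sub_horizontal_le hu hg hη (s := p + ρ₀) (s' := p + ρ)
    (by linarith [hρ.1]) fun t ht => hright t ⟨ht.1, ht.2.trans (by linarith [hρ.2])⟩
  have hl := hΨ.norm_sub_horizontal_le hu hg hη (s := p - ρ) (s' := p - ρ₀)
    (by linarith [hρ.1]) fun t ht => hleft t ⟨by linarith [ht.1, hρ.2], ht.2⟩
  calc ‖Ψ !₂[p + ρ, η] - Ψ !₂[p - ρ, η] - (Ψ !₂[p + ρ₀, η] - Ψ !₂[p - ρ₀, η])‖
      = ‖(Ψ !₂[p + ρ, η] - Ψ !₂[p + ρ₀, η]) + (Ψ !₂[p - ρ₀, η] - Ψ !₂[p - ρ, η])‖ := by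
        congr 1; ring
    _ ≤ B * (p + ρ - (p + ρ₀)) + B * (p - ρ₀ - (p - ρ)) :=
        (norm_add_le _ _).trans (add_le_add hr hl)
    _ = 2 * (B * (ρ - ρ₀)) := by ring
    _ ≤ 2 * (B * ρ₀) := by gcongr; linarith [hρ.2]

lemma eventually_norm_sub_le (hΨ : IsStreamFunction u g Ψ) (hu : NeumannField κ ε c u)
    (hg : TestField κ g) (p : ℝ) {δ : ℝ} (hδ : 0 < δ) :
    ∀ᶠ ρ in 𝓝[>] (0 : ℝ), ∀ᶠ η in 𝓝[>] (0 : ℝ), ‖Ψ !₂[p + ρ, η] - Ψ !₂[p - ρ, η]‖ ≤ δ := by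
  obtain ⟨M, _, hM⟩ := exists_bound_of_continuousOn hu.continuousOn !₂[p, 0] 2
  obtain ⟨C, hC0, hC⟩ := hg.exists_bound !₂[p, 0] 2
  set B : ℝ := C * ‖c‖ + M * C + 1
  have hB : ∀ t, |t - p| ≤ 2 → ‖greenNormal ε c u g !₂[t, 0]‖ < B := fun t ht => by
    have hmem : (!₂[t, 0] : Plane) ∈ closedUpperHalf := mem_closedUpperHalf.2 le_rfl
    rw [← norm_horizontal_sub] at ht
    linarith [norm_greenNormal_boundary_le (ε := ε) (c := c) (hC _ hmem ht).1 (hC _ hmem ht).2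
      (hM _ hmem ht)]
  obtain ⟨τ, hτ, hτδ⟩ : ∃ τ > 0, C * (5 * τ) * π ≤ δ / 2 := by
    refine ⟨δ / (2 * (C * 5 * π + 1)), by positivity, ?_⟩
    rw [← mul_assoc, mul_right_comm, mul_div_assoc', div_le_div_iff₀ (by positivity) two_pos]
    nlinarith [pi_pos]
  obtain ⟨r, hr, hosc⟩ := Metric.continuousWithinAt_iff.1
    (hu.continuousOn _ (mem_closedUpperHalf.2 (le_refl (0 : ℝ)) : !₂[p, 0] ∈ closedUpperHalf)) τ hτ
  have hsmall : ∀ᶠ ρ in 𝓝[>] (0 : ℝ), 3 * ρ < min 1 r ∧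
      ρ * (C * (2 * M) * π + 2 * B) < δ / 2 :=
    nhdsWithin_le_nhds (((by fun_prop : Continuous fun ρ : ℝ => 3 * ρ).continuousAt.eventually_lt
      continuousAt_const (by simp [hr])).and
      ((by fun_prop : Continuous fun ρ : ℝ => ρ * (C * (2 * M) * π + 2 * B)).continuousAt
        |>.eventually_lt continuousAt_const (by simp [hδ])))
  filter_upwards [self_mem_nhdsWithin, hsmall, eventually_forall_norm_greenForm_lt hu hg two_pos hB]
    with ρ (hρ : 0 < ρ) ⟨hρr, hρδ⟩ hsides
  rw [lt_min_iff] at hρr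
  filter_upwards [self_mem_nhdsWithin, nhdsWithin_le_nhds (gt_mem_nhds hρ), hsides]
    with η (hη : 0 < η) hηρ ⟨hright, hleft⟩
  have havg := hΨ.norm_integral_sub_le hu.contDiffAt hg.contDiffAt_upperHalf (p := p)
    (u₀ := u !₂[p, 0]) (τ := τ) hη hηρ.le (by linarith)
    (fun x hx hxr => hC x (upperHalf_subset_closedUpperHalf hx) (by linarith))
    (fun x hx hxr => hM x (upperHalf_subset_closedUpperHalf hx) (by linarith))
    fun x hx hxr => (dist_eq_norm (u x) _ ▸ hosc (upperHalf_subset_closedUpperHalf hx)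
      (by rw [dist_eq_norm]; linarith)).le
  rw [mul_assoc] at havg
  refine (hΨ.norm_sub_across_le hu.contDiffAt hg.contDiffAt_upperHalf hη hρ havg
    (fun t ht => (hright t ht).le) fun t ht => (hleft t ht).le).trans ?_
  linarith

lemma tendsto_sub_across (hΨ : IsStreamFunction u g Ψ) (hu : NeumannField κ ε c u)
    (hg : TestField κ g) {s p s' : ℝ} (hsp : s < p) (hps : p < s')
    (hs : ∀ t ∈ Set.Icc s s', t ≠ p → t ≠ 0 ∧ t ≠ ε) :
    Tendsto (fun η => Ψ !₂[s', η] - Ψ !₂[s, η]) (𝓝[>] 0)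
      (𝓝 (-∫ t in s..s', greenNormal ε c u g !₂[t, 0])) := by
  have hN := intervalIntegrable_greenNormal hu hg (ε := ε) (c := c)
  set N : ℝ → ℂ := fun t => greenNormal ε c u g !₂[t, 0]
  refine Metric.tendsto_nhds.2 fun δ hδ => ?_
  have hgap : ∀ᶠ ρ in 𝓝[>] (0 : ℝ), ‖∫ t in p - ρ..p + ρ, N t‖ < δ / 3 :=
    nhdsWithin_le_nhds ((tendsto_integral_shrinking hN p).norm.eventually_lt_const
      (by simp [hδ]))
  have hsmall : ∀ᶠ ρ in 𝓝[>] (0 : ℝ), ρ < min (p - s) (s' - p) :=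
    nhdsWithin_le_nhds (gt_mem_nhds (lt_min (sub_pos.2 hsp) (sub_pos.2 hps)))
  obtain ⟨ρ, ⟨⟨(hρ : 0 < ρ), hρs⟩, hjump⟩, hgapρ⟩ := (((eventually_mem_nhdsWithin.and
    hsmall).and (hΨ.eventually_norm_sub_le hu hg p (by positivity : 0 < δ / 3))).and hgap).exists
  rw [lt_min_iff] at hρs
  have hleft := hΨ.tendsto_sub hu hg (s := s) (s' := p - ρ) (b := fun _ => p - ρ)
    (fun t ht => hs t ⟨ht.1, by linarith [ht.2]⟩ (by linarith [ht.2] : t < p).ne)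
    (Set.left_mem_Icc.2 (by linarith)) (Set.right_mem_Icc.2 (by linarith)) tendsto_id
    tendsto_const_nhds (.of_forall fun _ => Set.right_mem_Icc.2 (by linarith))
  have hright := hΨ.tendsto_sub hu hg (s := p + ρ) (s' := s') (b := fun _ => s')
    (fun t ht => hs t ⟨by linarith [ht.1], ht.2⟩ (by linarith [ht.1] : p < t).ne')
    (Set.left_mem_Icc.2 (by linarith)) (Set.right_mem_Icc.2 (by linarith)) tendsto_id
    tendsto_const_nhds (.of_forall fun _ => Set.right_mem_Icc.2 (by linarith))
  filter_upwards [hjump, Metric.tendsto_nhds.1 (hleft.add hright) (δ / 3) (by positivity)]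
    with η hjumpη hlim
  have hN_split : ∫ t in s..s', N t =
      (∫ t in s..p - ρ, N t) + (∫ t in p - ρ..p + ρ, N t) + ∫ t in p + ρ..s', N t := by
    rw [intervalIntegral.integral_add_adjacent_intervals (hN _ _) (hN _ _),
      intervalIntegral.integral_add_adjacent_intervals (hN _ _) (hN _ _)]
  rw [dist_eq_norm] at hlim ⊢
  calc ‖Ψ !₂[s', η] - Ψ !₂[s, η] - -∫ t in s..s', N t‖
      = ‖Ψ !₂[p - ρ, η] - Ψ !₂[s, η] + (Ψ !₂[s', η] - Ψ !₂[p + ρ, η]) -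
          ((-∫ t in s..p - ρ, N t) + -∫ t in p + ρ..s', N t) +
          (Ψ !₂[p + ρ, η] - Ψ !₂[p - ρ, η]) + ∫ t in p - ρ..p + ρ, N t‖ := by
        rw [hN_split]; congr 1; ring
    _ < δ / 3 + δ / 3 + δ / 3 := by
        refine (norm_add_le _ _).trans_lt (add_lt_add ?_ hgapρ)
        exact (norm_add_le _ _).trans_lt (add_lt_add_of_lt_of_le hlim hjumpη)
    _ = δ := by ring

end IsStreamFunction

end AcrossEnds

section HalfDisc

variable {κ ε : ℝ} {c : ℂ} {u g Ψ : Plane → ℂ}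

lemma tendsto_integral_inner {E : Type*} [NormedAddCommGroup E] [NormedSpace ℝ E] {F : ℝ → E}
    {a b : ℝ} (hab : a < b) (hF : IntervalIntegrable F volume a b) :
    Tendsto (fun α => ∫ t in a + α..b - α, F t) (𝓝[>] 0) (𝓝 (∫ t in a..b, F t)) := by
  have hG : Integrable ((Set.Ioc a b).indicator F) volume :=
    (integrable_indicator_iff measurableSet_Ioc).2 hF.1
  have hcont : Continuous fun α : ℝ => (∫ t in a..b - α, (Set.Ioc a b).indicator F t) -
      ∫ t in a..a + α, (Set.Ioc a b).indicator F t :=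
    ((hG.continuous_primitive a).comp (continuous_const.sub continuous_id)).sub
      ((hG.continuous_primitive a).comp (continuous_const_add a))
  simp_rw [intervalIntegral.integral_interval_sub_left hG.intervalIntegrable
    hG.intervalIntegrable] at hcont
  have hcongr : ∀ s t, a ≤ s → s ≤ t → t ≤ b →
      ∫ x in s..t, (Set.Ioc a b).indicator F x = ∫ x in s..t, F x := fun s t hs hst ht =>
    intervalIntegral.integral_congr_ae (.of_forall fun x hx =>
      Set.indicator_of_mem (Set.Ioc_subset_Ioc hs ht (Set.uIoc_of_le hst ▸ hx)) F)
  refine ((hcont.tendsto' 0 _ ?_).mono_left nhdsWithin_le_nhds).congr' ?_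
  · simpa only [add_zero, sub_zero] using hcongr a b le_rfl hab.le le_rfl
  · filter_upwards [self_mem_nhdsWithin,
      nhdsWithin_le_nhds (gt_mem_nhds (half_pos (sub_pos.2 hab)))] with α (hα : 0 < α) hα'
    exact hcongr _ _ (by linarith) (by linarith) (by linarith)

lemma norm_greenForm_le {B C M : ℝ} {x e : Plane} (he : ‖e‖ = 1) (hu : ‖u x‖ ≤ M)
    (hu' : ‖fderiv ℝ u x e‖ ≤ B) (hg : ‖g x‖ ≤ C) (hg' : ‖fderiv ℝ g x‖ ≤ C) :
    ‖greenForm u g x e‖ ≤ C * B + M * C := by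
  rw [greenForm_apply]
  refine (norm_sub_le _ _).trans ?_
  rw [norm_mul, norm_mul]
  exact add_le_add (mul_le_mul hg hu' (norm_nonneg _) ((norm_nonneg _).trans hg))
    (mul_le_mul hu (norm_apply_le_of_norm_eq_one hg' he) (norm_nonneg _)
      ((norm_nonneg _).trans hu))

lemma intervalIntegrable_flux (hu : NeumannField κ ε c u) (hg : TestField κ g) {R : ℝ}
    (hR : 0 < R) {B : ℝ}
    (hB : ∀ φ ∈ Set.Ioo 0 π, ‖fderiv ℝ u (R • unitVec φ) (unitVec φ)‖ ≤ B) :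
    IntervalIntegrable (fun φ : ℝ => R * greenForm u g (R • unitVec φ) (unitVec φ))
      volume 0 π := by
  obtain ⟨M, _, hM⟩ := exists_bound_of_continuousOn hu.continuousOn 0 R
  obtain ⟨C, _, hC⟩ := hg.exists_bound 0 R
  have hmem : ∀ φ ∈ Set.Ioo 0 π, R • unitVec φ ∈ upperHalf := fun φ hφ =>
    smul_unitVec_mem_upperHalf hR hφ
  have hcont : ContinuousOn (fun φ : ℝ => R * greenForm u g (R • unitVec φ) (unitVec φ))
      (Set.Ioo 0 π) := fun φ hφ => (ContinuousAt.mul continuousAt_const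
    (continuousAt_greenForm_comp (γ := fun φ => R • unitVec φ) (hu.contDiffAt _ (hmem φ hφ))
      (hg.contDiffAt_upperHalf _ (hmem φ hφ)) (by fun_prop) (by fun_prop))).continuousWithinAt
  rw [intervalIntegrable_iff_integrableOn_Ioo_of_le pi_pos.le]
  refine Integrable.of_bound (hcont.aestronglyMeasurable measurableSet_Ioo)
    (R * (C * B + M * C)) ?_
  refine (ae_restrict_iff' measurableSet_Ioo).2 (.of_forall fun φ hφ => ?_)
  have hnorm : ‖R • unitVec φ - 0‖ ≤ R := by rw [sub_zero, norm_smul_unitVec hR.le]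
  obtain ⟨hg₀, hg₁⟩ := hC _ (upperHalf_subset_closedUpperHalf (hmem φ hφ)) hnorm
  rw [norm_mul, Complex.norm_of_nonneg hR.le]
  exact mul_le_mul_of_nonneg_left (norm_greenForm_le (norm_unitVec φ)
    (hM _ (upperHalf_subset_closedUpperHalf (hmem φ hφ)) hnorm) (hB φ hφ) hg₀ hg₁) hR.le

lemma tendsto_mul_sin_nhdsGT {R : ℝ} (hR : 0 < R) :
    Tendsto (fun α => R * sin α) (𝓝[>] 0) (𝓝[>] 0) := by
  refine tendsto_nhdsWithin_iff.2 ⟨?_, ?_⟩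
  · exact ((by fun_prop : Continuous fun α => R * sin α).tendsto' 0 0 (by simp)).mono_left
      nhdsWithin_le_nhds
  · filter_upwards [self_mem_nhdsWithin, nhdsWithin_le_nhds (gt_mem_nhds pi_pos)] with α hα hαπ
    exact mul_pos hR (sin_pos_of_pos_of_lt_pi hα hαπ)

lemma tendsto_mul_cos_nhdsGT (R : ℝ) : Tendsto (fun α => R * cos α) (𝓝[>] 0) (𝓝 R) :=
  ((by fun_prop : Continuous fun α => R * cos α).tendsto' 0 R (by simp)).mono_left
    nhdsWithin_le_nhds

/-- The boundary segment is cut into four pieces: the outer two move with the end points of the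
arc, the inner two each cross one end of the aperture. -/
lemma IsStreamFunction.tendsto_sub_halfDisc (hΨ : IsStreamFunction u g Ψ)
    (hu : NeumannField κ ε c u) (hg : TestField κ g) (hε : 0 < ε) {R : ℝ} (hR : ε < R) :
    Tendsto (fun α => Ψ !₂[R * cos α, R * sin α] - Ψ !₂[-(R * cos α), R * sin α]) (𝓝[>] 0)
      (𝓝 (-∫ t in -R..R, greenNormal ε c u g !₂[t, 0])) := by
  have hN := intervalIntegrable_greenNormal hu hg (ε := ε) (c := c)
  have hη := tendsto_mul_sin_nhdsGT (hε.trans hR)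
  have hcos := tendsto_mul_cos_nhdsGT R
  have hcosR : ∀ α, R * cos α ≤ R := fun α => mul_le_of_le_one_right (by linarith) (cos_le_one α)
  have hright := hΨ.tendsto_sub hu hg (s := (ε + R) / 2) (s' := R) (a := (ε + R) / 2)
    (fun t ht => ⟨by linarith [ht.1], by linarith [ht.1]⟩) (Set.left_mem_Icc.2 (by linarith))
    (Set.right_mem_Icc.2 (by linarith)) hη hcos
    ((hcos.eventually_const_lt (by linarith)).mono fun α hα => ⟨hα.le, hcosR α⟩)
  have hleft := hΨ.tendsto_sub hu hg (s := -R) (s' := -(R / 2)) (a := -(R / 2))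
    (fun t ht => ⟨by linarith [ht.2], by linarith [ht.2]⟩) (Set.right_mem_Icc.2 (by linarith))
    (Set.left_mem_Icc.2 (by linarith)) hη hcos.neg
    ((hcos.eventually_const_lt (by linarith : R / 2 < R)).mono fun α hα =>
      ⟨neg_le_neg (hcosR α), neg_le_neg hα.le⟩)
  have hzero := (hΨ.tendsto_sub_across hu hg (s := -(R / 2)) (p := 0) (s' := ε / 2)
    (by linarith) (by linarith) fun t ht ht0 => ⟨ht0, by linarith [ht.2]⟩).comp hη
  have hwidth := (hΨ.tendsto_sub_across hu hg (s := ε / 2) (p := ε) (s' := (ε + R) / 2)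
    (by linarith) (by linarith) fun t ht htε => ⟨by linarith [ht.1], htε⟩).comp hη
  have hsplit : -∫ t in -R..R, greenNormal ε c u g !₂[t, 0] =
      -(∫ t in (ε + R) / 2..R, greenNormal ε c u g !₂[t, 0]) +
        -(∫ t in ε / 2..(ε + R) / 2, greenNormal ε c u g !₂[t, 0]) +
        -(∫ t in -(R / 2)..ε / 2, greenNormal ε c u g !₂[t, 0]) -
        -∫ t in -(R / 2)..-R, greenNormal ε c u g !₂[t, 0] := by
    rw [intervalIntegral.integral_symm (-R), ← intervalIntegral.integral_add_adjacent_intervals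
      (hN (-R) (-(R / 2))) (hN _ R), ← intervalIntegral.integral_add_adjacent_intervals
      (hN (-(R / 2)) (ε / 2)) (hN _ R), ← intervalIntegral.integral_add_adjacent_intervals
      (hN (ε / 2) ((ε + R) / 2)) (hN _ R)]
    ring
  rw [hsplit]
  refine (((hright.add hwidth).add hzero).sub hleft).congr fun α => ?_
  simp only [Function.comp_apply]
  ring

lemma green_halfDisc (hu : NeumannField κ ε c u) (hg : TestField κ g) (hε : 0 < ε) {R : ℝ}
    (hR : ε < R) {B : ℝ}
    (hB : ∀ φ ∈ Set.Ioo 0 π, ‖fderiv ℝ u (R • unitVec φ) (unitVec φ)‖ ≤ B) :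
    ∫ φ in (0 : ℝ)..π, R * greenForm u g (R • unitVec φ) (unitVec φ) =
      ∫ t in -R..R, greenNormal ε c u g !₂[t, 0] := by
  obtain ⟨Ψ, hΨ⟩ := exists_isStreamFunction hu.contDiffAt hg.contDiffAt_upperHalf hu.helmholtz
    hg.helmholtz
  have harc := tendsto_integral_inner pi_pos (intervalIntegrable_flux hu hg (hε.trans hR) hB)
  refine tendsto_nhds_unique harc ?_
  have hboundary := (hΨ.tendsto_sub_halfDisc hu hg hε hR).neg
  rw [neg_neg] at hboundary
  refine hboundary.congr' ?_
  filter_upwards [self_mem_nhdsWithin, nhdsWithin_le_nhds (gt_mem_nhds pi_div_two_pos)]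
    with α (hα : 0 < α) hα'
  have hright : R • unitVec (0 + α) = !₂[R * cos α, R * sin α] := by
    ext i; fin_cases i <;> simp [unitVec]
  have hleft : R • unitVec (π - α) = !₂[-(R * cos α), R * sin α] := by
    ext i; fin_cases i <;> simp [unitVec]
  have hsub := hΨ.sub_arc hu.contDiffAt hg.contDiffAt_upperHalf (p := 0) (ρ := R) (α := 0 + α)
    (β := π - α) fun φ hφ => by
      rw [Set.uIcc_of_le (by linarith)] at hφ
      rw [zero_add]
      exact smul_unitVec_mem_upperHalf (hε.trans hR) ⟨by linarith [hφ.1], by linarith [hφ.2]⟩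
  simp only [zero_add (_ : Plane)] at hsub
  rw [← hsub, hright, hleft, neg_sub]

end HalfDisc

section RadialFunctions

variable {E : Type*} [NormedAddCommGroup E] [InnerProductSpace ℝ E] {x z : E}

/-- The inner product of a real inner product space with values in `ℂ`, so that gradients of
complex-valued radial functions are scalar multiples of it. -/
def innerForm : E →L[ℝ] E →L[ℝ] ℂ :=
  (ContinuousLinearMap.compL ℝ E ℝ ℂ Complex.ofRealCLM).comp (innerSL ℝ)

lemma innerForm_apply (x e : E) : innerForm x e = (inner ℝ x e : ℝ) := rfl

lemma hasFDerivAt_norm_sub (hx : x ≠ z) :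
    HasFDerivAt (fun x => ‖x - z‖) (‖x - z‖⁻¹ • innerSL ℝ (x - z)) x := by
  have hsq := ((hasFDerivAt_id x).sub_const z).norm_sq.sqrt
    (pow_ne_zero 2 (norm_ne_zero_iff.2 (sub_ne_zero.2 hx)))
  simp only [id_eq, Real.sqrt_sq (norm_nonneg _)] at hsq
  refine hsq.congr_fderiv (ContinuousLinearMap.ext fun e => ?_)
  simp only [smul_apply, ContinuousLinearMap.comp_id, smul_eq_mul, nsmul_eq_mul, Nat.cast_ofNat]
  ring

lemma hasFDerivAt_radial {f : ℝ → ℂ} {f' : ℂ} (hx : x ≠ z) (hf : HasDerivAt f f' ‖x - z‖) :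
    HasFDerivAt (fun x => f ‖x - z‖) ((f' / ‖x - z‖) • innerForm (x - z)) x := by
  refine (hf.hasFDerivAt.comp x (hasFDerivAt_norm_sub hx)).congr_fderiv
    (ContinuousLinearMap.ext fun e => ?_)
  simp only [ContinuousLinearMap.comp_apply, smul_apply, innerSL_apply_apply, smul_eq_mul,
    innerForm_apply, ContinuousLinearMap.toSpanSingleton_apply, Complex.real_smul]
  push_cast
  ring

lemma hasFDerivAt_fderiv_radial {f f' : ℝ → ℂ} {f'' : ℂ} (hx : x ≠ z)
    (hf : ∀ r, 0 < r → HasDerivAt f (f' r) r) (hf' : HasDerivAt f' f'' ‖x - z‖) :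
    HasFDerivAt (fderiv ℝ fun x => f ‖x - z‖)
      ((f' ‖x - z‖ / ‖x - z‖) • innerForm +
        (((f'' * ‖x - z‖ - f' ‖x - z‖) / (‖x - z‖ : ℂ) ^ 2 / ‖x - z‖) •
          innerForm (x - z)).smulRight (innerForm (x - z))) x := by
  have hr : (‖x - z‖ : ℂ) ≠ 0 := mod_cast norm_ne_zero_iff.2 (sub_ne_zero.2 hx)
  have hquot : HasDerivAt (fun r : ℝ => f' r / r)
      ((f'' * ‖x - z‖ - f' ‖x - z‖) / (‖x - z‖ : ℂ) ^ 2) ‖x - z‖ := by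
    simpa using hf'.fun_div (hasDerivAt_id ‖x - z‖).ofReal_comp hr
  have hinner : HasFDerivAt (fun x : E => innerForm (x - z)) innerForm x :=
    innerForm.hasFDerivAt.comp x ((hasFDerivAt_id x).sub_const z)
  refine ((hasFDerivAt_radial hx hquot).smul hinner).congr_of_eventuallyEq ?_
  filter_upwards [isOpen_ne.mem_nhds hx] with w hw
  exact (hasFDerivAt_radial hw (hf _ (norm_pos_iff.2 (sub_ne_zero.2 hw)))).fderiv

lemma laplacian_radial {f f' : ℝ → ℂ} {f'' : ℂ} {x z : Plane} (hx : x ≠ z)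
    (hf : ∀ r, 0 < r → HasDerivAt f (f' r) r) (hf' : HasDerivAt f' f'' ‖x - z‖) :
    Δ (fun x => f ‖x - z‖) x = f'' + f' ‖x - z‖ / ‖x - z‖ := by
  have hr : (‖x - z‖ : ℂ) ≠ 0 := mod_cast norm_ne_zero_iff.2 (sub_ne_zero.2 hx)
  have hsq : ((x 0 - z 0 : ℝ) : ℂ) ^ 2 + ((x 1 - z 1 : ℝ) : ℂ) ^ 2 = (‖x - z‖ : ℂ) ^ 2 := by
    have : (x 0 - z 0) ^ 2 + (x 1 - z 1) ^ 2 = ‖x - z‖ ^ 2 := by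
      simp [EuclideanSpace.norm_sq_eq]
    exact_mod_cast this
  rw [laplacian_plane, (hasFDerivAt_fderiv_radial hx hf hf').fderiv]
  simp only [add_apply, smul_apply, ContinuousLinearMap.smulRight_apply, innerForm_apply,
    smul_eq_mul, PiLp.inner_apply, Fin.sum_univ_two, PiLp.sub_apply, RCLike.inner_apply,
    conj_trivial, Matrix.cons_val_zero, Matrix.cons_val_one, mul_one, mul_zero, zero_mul,
    one_mul, add_zero, zero_add, Complex.ofReal_one]
  field_simp
  linear_combination (f'' * ‖x - z‖ - f' ‖x - z‖) * hsq

end RadialFunctions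

section PointSource

variable {κ : ℝ} {x z : Plane}

/-- The outgoing field of a point source at `z`, unnormalised. -/
def pointSource (κ : ℝ) (z x : Plane) : ℂ := hankel 0 (κ * ‖x - z‖)

lemma pointSource_eq_comp_sub (κ : ℝ) (z : Plane) :
    pointSource κ z = fun x => pointSource κ 0 (x - z) := by
  funext x
  simp only [pointSource, sub_zero]

lemma hasDerivAt_hankel_mul (n : ℕ) (hκ : 0 < κ) {r : ℝ} (hr : 0 < r) :
    HasDerivAt (fun r => hankel n (κ * r)) (κ * hankel (n + 1) (κ * r)) r := by
  simpa [Function.comp_def] using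
    (hasDerivAt_hankel n (mul_pos hκ hr)).scomp r ((hasDerivAt_id r).const_mul κ)

lemma fderiv_pointSource (hκ : 0 < κ) (hx : x ≠ z) (e : Plane) :
    fderiv ℝ (pointSource κ z) x e =
      κ * hankel 1 (κ * ‖x - z‖) / ‖x - z‖ * (inner ℝ (x - z) e : ℝ) := by
  have h := hasFDerivAt_radial hx (hasDerivAt_hankel_mul 0 hκ (norm_pos_iff.2 (sub_ne_zero.2 hx)))
  exact DFunLike.congr_fun h.fderiv e

lemma contDiffAt_pointSource (hκ : 0 < κ) (hx : x ≠ z) : ContDiffAt ℝ 2 (pointSource κ z) x :=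
  ((contDiffOn_hankel 2 0).contDiffAt
    (Ioi_mem_nhds (mul_pos hκ (norm_pos_iff.2 (sub_ne_zero.2 hx))))).comp x
    (contDiffAt_const.mul ((contDiffAt_id.sub contDiffAt_const).norm ℝ (sub_ne_zero.2 hx)))

lemma helmholtz_pointSource (hκ : 0 < κ) (hx : x ≠ z) :
    Δ (pointSource κ z) x + (κ : ℂ) ^ 2 * pointSource κ z x = 0 := by
  have hr : 0 < ‖x - z‖ := norm_pos_iff.2 (sub_ne_zero.2 hx)
  have hr' : (‖x - z‖ : ℂ) ≠ 0 := mod_cast hr.ne'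
  have hlap := laplacian_radial hx (fun r hr => hasDerivAt_hankel_mul 0 hκ hr)
    ((hasDerivAt_hankel_mul 1 hκ hr).const_mul (κ : ℂ))
  have hbessel := hankel_bessel (mul_pos hκ hr)
  push_cast at hbessel
  rw [show pointSource κ z = fun x => hankel 0 (κ * ‖x - z‖) from rfl, hlap]
  field_simp
  linear_combination (κ : ℂ) * hbessel

lemma fderiv_pointSource_eq_comp_sub (κ : ℝ) (z x : Plane) :
    fderiv ℝ (pointSource κ z) x = fderiv ℝ (pointSource κ 0) (x - z) := by
  rw [pointSource_eq_comp_sub κ z, fderiv_comp_sub]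

lemma exists_bound_pointSource (hκ : 0 < κ) {a : ℝ} (ha : 0 < a) (b : ℝ) :
    ∃ C, ∀ x z : Plane, a ≤ ‖x - z‖ → ‖x - z‖ ≤ b →
      ‖pointSource κ z x‖ ≤ C ∧ ‖fderiv ℝ (pointSource κ z) x‖ ≤ C := by
  have hK : IsCompact {w : Plane | a ≤ ‖w‖ ∧ ‖w‖ ≤ b} := by
    refine (isCompact_closedBall (0 : Plane) b).of_isClosed_subset
      ((isClosed_le continuous_const continuous_norm).inter
        (isClosed_le continuous_norm continuous_const)) fun w hw => ?_
    simpa using hw.2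
  have hsmooth : ∀ w ∈ {w : Plane | a ≤ ‖w‖ ∧ ‖w‖ ≤ b}, ContDiffAt ℝ 2 (pointSource κ 0) w :=
    fun w hw => contDiffAt_pointSource hκ (norm_pos_iff.1 (ha.trans_le hw.1))
  obtain ⟨C, hC⟩ := hK.exists_bound_of_continuousOn fun w hw =>
    (hsmooth w hw).continuousAt.continuousWithinAt
  obtain ⟨C', hC'⟩ := hK.exists_bound_of_continuousOn fun w hw =>
    (contDiffAt_fderiv (hsmooth w hw)).continuousAt.continuousWithinAt
  refine ⟨max C C', fun x z hl hu => ?_⟩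
  rw [fderiv_pointSource_eq_comp_sub, pointSource_eq_comp_sub]
  exact ⟨(hC _ ⟨hl, hu⟩).trans (le_max_left _ _), (hC' _ ⟨hl, hu⟩).trans (le_max_right _ _)⟩

lemma continuousAt_greenForm_pointSource (hκ : 0 < κ) (u : Plane → ℂ) (hx : x ≠ z) (e : Plane) :
    ContinuousAt (fun z => greenForm u (pointSource κ z) x e) z := by
  have hsmooth := contDiffAt_pointSource hκ (z := 0) (sub_ne_zero.2 hx)
  have heq : (fun z => greenForm u (pointSource κ z) x e) = fun z =>
      pointSource κ 0 (x - z) * fderiv ℝ u x e - u x * fderiv ℝ (pointSource κ 0) (x - z) e :=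
    funext fun z => by
      rw [greenForm_apply, fderiv_pointSource_eq_comp_sub, pointSource_eq_comp_sub κ z]
  rw [heq]
  have hsub : ContinuousAt (fun z => x - z) z := by fun_prop
  exact ((hsmooth.continuousAt.comp (f := fun z => x - z) hsub).mul continuousAt_const).sub
    (continuousAt_const.mul
      (((contDiffAt_fderiv hsmooth).continuousAt.comp (f := fun z => x - z) hsub).clm_apply
        continuousAt_const))

end PointSource

section BoundarySource

variable {κ τ y : ℝ} {x : Plane}

lemma ne_source (hτ : 0 < τ) (hx : x ∈ closedUpperHalf) : x ≠ !₂[y, -τ] := by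
  rintro rfl
  exact absurd (mem_closedUpperHalf.1 hx) (by linarith)

lemma testField_pointSource (hκ : 0 < κ) (hτ : 0 < τ) :
    TestField κ (pointSource κ !₂[y, -τ]) where
  contDiffAt _ hx := contDiffAt_pointSource hκ (ne_source hτ hx)
  helmholtz _ hx := helmholtz_pointSource hκ
    (ne_source hτ (upperHalf_subset_closedUpperHalf hx))

lemma norm_sub_source (a b y τ : ℝ) :
    ‖(!₂[a, b] : Plane) - !₂[y, -τ]‖ = √((a - y) ^ 2 + (b + τ) ^ 2) := by
  rw [← norm_plane]
  congr 1
  ext i; fin_cases i <;> simp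

lemma pointSource_boundary (t : ℝ) :
    pointSource κ !₂[y, -τ] !₂[t, 0] = hankel 0 (κ * √((t - y) ^ 2 + τ ^ 2)) := by
  rw [pointSource, norm_sub_source, zero_add]

/-! ### The single layer potential on the boundary -/

lemma intervalIntegrable_abs_rpow {p : ℝ} (hp : -1 < p) (a b : ℝ) :
    IntervalIntegrable (fun t : ℝ => |t| ^ p) volume a b := by
  refine intervalIntegrable_of_even (fun t => by rw [abs_neg]) fun b hb => ?_
  refine (intervalIntegral.intervalIntegrable_rpow' hp).congr fun t ht => ?_
  rw [Set.uIoc_of_le hb.le] at ht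
  simp only [abs_of_pos ht.1]

lemma intervalIntegrable_one_div_mul_abs_sub_rpow (hκ : 0 < κ) (y a b : ℝ) :
    IntervalIntegrable (fun t : ℝ => (1 / (κ * |t - y|)) ^ (1 / 2 : ℝ)) volume a b := by
  have h := ((intervalIntegrable_abs_rpow (p := -(1 / 2)) (by norm_num) (a - y)
    (b - y)).comp_sub_right y).const_mul ((1 / κ) ^ (1 / 2 : ℝ))
  simp only [sub_add_cancel] at h
  refine h.congr fun t _ => ?_
  rw [rpow_neg (abs_nonneg _), ← inv_rpow (abs_nonneg _),
    ← mul_rpow (by positivity) (by positivity), one_div_mul_eq_div, inv_eq_one_div, div_div,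
    ← mul_comm]

lemma tendsto_integral_pointSource (hκ : 0 < κ) {q : ℝ → ℂ} {a b C : ℝ}
    (hq : IntervalIntegrable q volume a b) (hC : ∀ t, ‖q t‖ ≤ C) :
    Tendsto (fun τ : ℝ => ∫ t in a..b, pointSource κ !₂[y, -τ] !₂[t, 0] * q t)
      (𝓝[>] 0) (𝓝 (∫ t in a..b, hankel 0 (κ * |t - y|) * q t)) := by
  have hne : ∀ᵐ t : ℝ, 0 < |t - y| := by
    simp [abs_pos, sub_eq_zero, ae_iff, measure_singleton]
  refine intervalIntegral.tendsto_integral_filter_of_dominated_convergence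
    (fun t => (1 / (κ * |t - y|)) ^ (1 / 2 : ℝ) * Real.Gamma (1 / 2) * C) ?_ ?_
    (((intervalIntegrable_one_div_mul_abs_sub_rpow hκ y a b).mul_const _).mul_const _) ?_
  · filter_upwards [self_mem_nhdsWithin] with τ hτ
    exact (hq.continuousOn_mul (continuous_trace
      (testField_pointSource hκ hτ).continuousOn).continuousOn).def'.aestronglyMeasurable
  · refine .of_forall fun τ => hne.mono fun t ht _ => ?_
    have hle : |t - y| ≤ √((t - y) ^ 2 + τ ^ 2) :=
      Real.abs_le_sqrt (by linarith [sq_nonneg τ])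
    have hhankel := norm_hankel_zero_le (mul_pos hκ (ht.trans_le hle))
    rw [norm_mul, pointSource_boundary]
    refine mul_le_mul (hhankel.trans ?_) (hC t) (norm_nonneg _) (by positivity)
    gcongr
  · refine hne.mono fun t ht _ => (Tendsto.mono_left ?_ nhdsWithin_le_nhds).mul_const _
    simp_rw [pointSource_boundary]
    refine (continuousAt_hankel 0 (mul_pos hκ ht)).tendsto.comp ?_
    exact (by fun_prop : Continuous fun τ : ℝ => κ * √((t - y) ^ 2 + τ ^ 2)).tendsto' 0 _
      (by simp [Real.sqrt_sq_eq_abs])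

/-! ### The double layer potential on the boundary -/

lemma tendsto_mul_hankel_one :
    Tendsto (fun r : ℝ => r * hankel 1 r) (𝓝[>] 0) (𝓝 (-1)) := by
  rw [tendsto_iff_norm_sub_tendsto_zero]
  have hbound : Tendsto (fun r => 2 * Real.Gamma (1 / 2) * √r + r) (𝓝[>] 0) (𝓝 0) :=
    ((by fun_prop : Continuous fun r => 2 * Real.Gamma (1 / 2) * √r + r).tendsto' 0 0
      (by simp)).mono_left nhdsWithin_le_nhds
  refine squeeze_zero' (.of_forall fun _ => norm_nonneg _) ?_ hbound
  filter_upwards [self_mem_nhdsWithin] with r hr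
  rw [sub_neg_eq_add]
  exact norm_mul_hankel_one_add_one_le hr

lemma norm_mul_hankel_one_le {r A : ℝ} (hr : 0 < r) (hA : r ≤ A) :
    ‖r * hankel 1 r‖ ≤ 2 * Real.Gamma (1 / 2) * √A + A + 1 := by
  have htri := norm_sub_le (r * hankel 1 r + 1) 1
  rw [add_sub_cancel_right, norm_one] at htri
  have : 0 < Real.Gamma (1 / 2) := Real.Gamma_pos_of_pos (by norm_num)
  calc ‖r * hankel 1 r‖ ≤ 2 * Real.Gamma (1 / 2) * √r + r + 1 := by
        linarith [norm_mul_hankel_one_add_one_le hr]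
    _ ≤ _ := by gcongr

/-- `r H₁(r)` evaluated at `r = κ |x - z|`, for the point `x = (t, 0)` of the boundary and the
source `z = (y, -τ)` below it. -/
def boundaryFlux (κ y τ t : ℝ) : ℂ :=
  (κ * √((t - y) ^ 2 + τ ^ 2) : ℝ) * hankel 1 (κ * √((t - y) ^ 2 + τ ^ 2))

lemma fderiv_pointSource_boundary (hκ : 0 < κ) (hτ : 0 < τ) (t : ℝ) :
    fderiv ℝ (pointSource κ !₂[y, -τ]) !₂[t, 0] !₂[0, 1] =
      boundaryFlux κ y τ t * (τ / ((t - y) ^ 2 + τ ^ 2) : ℝ) := by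
  have hr : 0 < √((t - y) ^ 2 + τ ^ 2) := Real.sqrt_pos.2 (by positivity)
  have hr' : (√((t - y) ^ 2 + τ ^ 2) : ℂ) ≠ 0 := mod_cast hr.ne'
  have hsq : (((t - y) ^ 2 + τ ^ 2 : ℝ) : ℂ) = (√((t - y) ^ 2 + τ ^ 2) : ℂ) ^ 2 := by
    rw [← Complex.ofReal_pow, Real.sq_sqrt (by positivity)]
  have hinner : inner ℝ ((!₂[t, 0] : Plane) - !₂[y, -τ]) !₂[0, 1] = τ := by
    simp [PiLp.inner_apply, Fin.sum_univ_two]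
  rw [fderiv_pointSource hκ (ne_source hτ (mem_closedUpperHalf.2 le_rfl)), norm_sub_source,
    zero_add, hinner, Complex.ofReal_div, hsq, boundaryFlux]
  push_cast
  field_simp

lemma continuous_boundaryFlux (hκ : 0 < κ) (hτ : 0 < τ) : Continuous (boundaryFlux κ y τ) := by
  refine continuous_iff_continuousAt.2 fun t => ContinuousAt.mul (by fun_prop) ?_
  exact (continuousAt_hankel 1 (by positivity)).comp (f := fun t => κ * √((t - y) ^ 2 + τ ^ 2))
    (by fun_prop)

lemma norm_boundaryFlux_le (hκ : 0 < κ) {a b t : ℝ} (hy : y ∈ Set.Icc a b) (ht : t ∈ Set.Icc a b)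
    (hτ : 0 < τ) (hτ' : τ ≤ 1) :
    ‖boundaryFlux κ y τ t‖ ≤
      2 * Real.Gamma (1 / 2) * √(κ * (b - a + 1)) + κ * (b - a + 1) + 1 := by
  refine norm_mul_hankel_one_le (by positivity) (mul_le_mul_of_nonneg_left ?_ hκ.le)
  have hab : 0 ≤ b - a := by linarith [hy.1, hy.2]
  have habs : (t - y) ^ 2 ≤ (b - a) ^ 2 :=
    sq_le_sq' (by linarith [hy.2, ht.1]) (by linarith [hy.1, ht.2])
  exact Real.sqrt_le_iff.2 ⟨by linarith, by nlinarith⟩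

lemma tendsto_boundaryFlux (hκ : 0 < κ) (s : ℝ) :
    Tendsto (fun τ => boundaryFlux κ y τ (τ * s + y)) (𝓝[>] 0) (𝓝 (-1)) := by
  refine tendsto_mul_hankel_one.comp (tendsto_nhdsWithin_iff.2 ⟨?_, ?_⟩)
  · exact ((by fun_prop : Continuous fun τ => κ * √((τ * s + y - y) ^ 2 + τ ^ 2)).tendsto' 0 0
      (by simp)).mono_left nhdsWithin_le_nhds
  · filter_upwards [self_mem_nhdsWithin] with τ (hτ : 0 < τ)
    exact Set.mem_Ioi.2 (by positivity)

lemma integral_mul_poissonKernel (hτ : 0 < τ) (F : ℝ → ℂ) (y : ℝ) :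
    ∫ t, F t * (τ / ((t - y) ^ 2 + τ ^ 2) : ℝ) = ∫ s, F (τ * s + y) * ((1 + s ^ 2)⁻¹ : ℝ) := by
  have hscale := Measure.integral_comp_mul_left
    (fun t => F (t + y) * (τ / ((t + y - y) ^ 2 + τ ^ 2) : ℝ)) τ
  rw [integral_add_right_eq_self (fun t => F t * (τ / ((t - y) ^ 2 + τ ^ 2) : ℝ)) y,
    abs_of_pos (inv_pos.2 hτ), eq_inv_smul_iff₀ hτ.ne', ← integral_smul] at hscale
  rw [← hscale]
  refine integral_congr_ae (.of_forall fun s => ?_)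
  have hτ' : (τ : ℂ) ≠ 0 := mod_cast hτ.ne'
  have hs : (1 + (s : ℂ) ^ 2) ≠ 0 := mod_cast (by positivity : (1 + s ^ 2) ≠ 0)
  have hs' : ((τ : ℂ) * s + y - y) ^ 2 + (τ : ℂ) ^ 2 = τ ^ 2 * (1 + (s : ℂ) ^ 2) := by ring
  simp only [Complex.real_smul]
  push_cast
  rw [hs']
  field_simp

lemma tendsto_integral_mul_poissonKernel {F : ℝ → ℝ → ℂ} {C : ℝ} {L : ℂ}
    (hF : ∀ᶠ τ in 𝓝[>] 0, Measurable (F τ)) (hC : ∀ᶠ τ in 𝓝[>] 0, ∀ t, ‖F τ t‖ ≤ C)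
    (hL : ∀ s, Tendsto (fun τ => F τ (τ * s + y)) (𝓝[>] 0) (𝓝 L)) :
    Tendsto (fun τ => ∫ t, F τ t * (τ / ((t - y) ^ 2 + τ ^ 2) : ℝ)) (𝓝[>] 0) (𝓝 (π * L)) := by
  have hval : ∫ s : ℝ, L * ((1 + s ^ 2)⁻¹ : ℝ) = π * L := by
    rw [integral_const_mul, integral_complex_ofReal, integral_univ_inv_one_add_sq, mul_comm]
  rw [← hval]
  refine Tendsto.congr' (f₁ := fun τ => ∫ s, F τ (τ * s + y) * ((1 + s ^ 2)⁻¹ : ℝ)) ?_ ?_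
  · filter_upwards [self_mem_nhdsWithin] with τ hτ
    exact (integral_mul_poissonKernel hτ (F τ) y).symm
  refine tendsto_integral_filter_of_dominated_convergence (fun s => C * (1 + s ^ 2)⁻¹) ?_ ?_
    (integrable_inv_one_add_sq.const_mul _) (.of_forall fun s => (hL s).mul_const _)
  · filter_upwards [hF] with τ hτF
    exact ((hτF.comp (by fun_prop)).mul (by fun_prop)).aestronglyMeasurable
  · filter_upwards [hC] with τ hτC
    refine .of_forall fun s => ?_
    rw [norm_mul, Complex.norm_of_nonneg (by positivity)]
    gcongr
    exact hτC _

lemma tendsto_intervalIntegral_mul_poissonKernel {F : ℝ → ℝ → ℂ} {a b C : ℝ} {L : ℂ}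
    (hy : y ∈ Set.Ioo a b) (hF : ∀ᶠ τ in 𝓝[>] 0, Measurable (F τ))
    (hC : ∀ᶠ τ in 𝓝[>] 0, ∀ t ∈ Set.Ioc a b, ‖F τ t‖ ≤ C)
    (hL : ∀ s, Tendsto (fun τ => F τ (τ * s + y)) (𝓝[>] 0) (𝓝 L)) :
    Tendsto (fun τ => ∫ t in a..b, F τ t * (τ / ((t - y) ^ 2 + τ ^ 2) : ℝ)) (𝓝[>] 0)
      (𝓝 (π * L)) := by
  have hab : a < b := hy.1.trans hy.2
  have hFind := hF.mono fun τ hτ => hτ.indicator (measurableSet_Ioc (a := a) (b := b))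
  refine (tendsto_integral_mul_poissonKernel (y := y) (C := C) hFind ?_
    fun s => ?_).congr fun τ => ?_
  · filter_upwards [hC] with τ hτ t
    by_cases ht : t ∈ Set.Ioc a b
    · rw [Set.indicator_of_mem ht]
      exact hτ t ht
    · rw [Set.indicator_of_notMem ht, norm_zero]
      exact (norm_nonneg _).trans (hτ b (Set.right_mem_Ioc.2 hab))
  · have hpoint : Tendsto (fun τ => τ * s + y) (𝓝[>] 0) (𝓝 y) :=
      ((by fun_prop : Continuous fun τ => τ * s + y).tendsto' 0 y (by simp)).mono_left
        nhdsWithin_le_nhds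
    refine (hL s).congr' ?_
    filter_upwards [hpoint.eventually (Ioo_mem_nhds hy.1 hy.2)] with τ hτ
    exact (Set.indicator_of_mem (Set.Ioo_subset_Ioc_self hτ) _).symm
  · rw [intervalIntegral.integral_of_le hab.le, ← integral_indicator measurableSet_Ioc]
    simp only [Set.indicator_mul_left]

/-- The normal derivative of the source is `boundaryFlux` times the Poisson kernel of the half
plane, an approximate identity of mass `π`, and `boundaryFlux → -1` at the source. -/
lemma tendsto_integral_fderiv_pointSource (hκ : 0 < κ) {f : ℝ → ℂ} (hf : Continuous f) {a b : ℝ}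
    (hy : y ∈ Set.Ioo a b) :
    Tendsto (fun τ : ℝ => ∫ t in a..b,
      f t * fderiv ℝ (pointSource κ !₂[y, -τ]) !₂[t, 0] !₂[0, 1]) (𝓝[>] 0) (𝓝 (-π * f y)) := by
  obtain ⟨M, hM⟩ := isCompact_Icc.exists_bound_of_continuousOn (s := Set.Icc a b) hf.continuousOn
  have hyab := Set.Ioo_subset_Icc_self hy
  have hmain := tendsto_intervalIntegral_mul_poissonKernel (L := f y * -1)
    (C := M * (2 * Real.Gamma (1 / 2) * √(κ * (b - a + 1)) + κ * (b - a + 1) + 1))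
    (F := fun τ t => f t * boundaryFlux κ y τ t) hy ?_ ?_ fun s => ?_
  · rw [show π * (f y * -1) = -π * f y by ring] at hmain
    refine hmain.congr' (eventually_mem_nhdsWithin.mono fun τ hτ => ?_)
    simp only [fderiv_pointSource_boundary hκ hτ, mul_assoc]
  · filter_upwards [self_mem_nhdsWithin] with τ hτ
    exact (hf.mul (continuous_boundaryFlux hκ hτ)).measurable
  · filter_upwards [Ioc_mem_nhdsGT one_pos] with τ hτ t ht
    have htab := Set.Ioc_subset_Icc_self ht
    rw [norm_mul]
    exact mul_le_mul (hM t htab) (norm_boundaryFlux_le hκ hyab htab hτ.1 hτ.2) (norm_nonneg _)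
      ((norm_nonneg _).trans (hM y hyab))
  · exact ((by fun_prop : Continuous fun τ => f (τ * s + y)).tendsto' 0 _ (by simp)).mono_left
      nhdsWithin_le_nhds |>.mul (tendsto_boundaryFlux hκ s)

end BoundarySource

section TraceRepresentation

variable {κ ε y : ℝ} {c : ℂ} {u : Plane → ℂ}

/-! ### The radiation condition and the representation of the trace -/

lemma tendsto_integral_arc (hκ : 0 < κ) (hu : NeumannField κ ε c u) {R : ℝ} (hy : |y| < R)
    {B : ℝ} (hB : ∀ φ ∈ Set.Ioo 0 π, ‖fderiv ℝ u (R • unitVec φ) (unitVec φ)‖ ≤ B) :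
    Tendsto (fun τ : ℝ => ∫ φ in (0 : ℝ)..π,
        R * greenForm u (pointSource κ !₂[y, -τ]) (R • unitVec φ) (unitVec φ)) (𝓝[>] 0)
      (𝓝 (∫ φ in (0 : ℝ)..π,
        R * greenForm u (pointSource κ !₂[y, 0]) (R • unitVec φ) (unitVec φ))) := by
  have hR : 0 < R := (abs_nonneg y).trans_lt hy
  have hnorm : ‖(!₂[y, 0] : Plane)‖ = |y| := by rw [norm_plane]; simp [sqrt_sq_eq_abs]
  have hsource : Tendsto (fun τ : ℝ => (!₂[y, -τ] : Plane)) (𝓝[>] 0) (𝓝 !₂[y, 0]) :=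
    ((by fun_prop : Continuous fun τ : ℝ => (!₂[y, -τ] : Plane)).tendsto' 0 _ (by simp)).mono_left
      nhdsWithin_le_nhds
  obtain ⟨a, hya, haR⟩ := exists_between hy
  obtain ⟨C, hC⟩ := exists_bound_pointSource hκ (sub_pos.2 haR) (R + a)
  obtain ⟨M, -, hM⟩ := exists_bound_of_continuousOn hu.continuousOn 0 R
  have hmem : ∀ φ ∈ Set.Ioo 0 π, R • unitVec φ ∈ upperHalf := fun φ hφ =>
    smul_unitVec_mem_upperHalf hR hφ
  simp only [intervalIntegral.integral_of_le pi_pos.le, integral_Ioc_eq_integral_Ioo]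
  refine tendsto_integral_filter_of_dominated_convergence (fun _ => R * (C * B + M * C)) ?_ ?_
    (integrable_const _) ?_
  · filter_upwards [self_mem_nhdsWithin] with τ hτ
    exact ((intervalIntegrable_iff_integrableOn_Ioo_of_le pi_pos.le).1 (intervalIntegrable_flux
      hu (testField_pointSource hκ hτ) hR hB)).aestronglyMeasurable
  · filter_upwards [hsource.norm.eventually_lt_const (hnorm ▸ hya)] with τ hτ
    refine (ae_restrict_iff' measurableSet_Ioo).2 (.of_forall fun φ hφ => ?_)
    have hlow := norm_sub_norm_le (R • unitVec φ) !₂[y, -τ]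
    have hupp := norm_sub_le (R • unitVec φ) !₂[y, -τ]
    rw [norm_smul_unitVec hR.le] at hlow hupp
    obtain ⟨hg, hg'⟩ := hC (R • unitVec φ) !₂[y, -τ] (by linarith) (by linarith)
    rw [norm_mul, Complex.norm_of_nonneg hR.le]
    exact mul_le_mul_of_nonneg_left (norm_greenForm_le (norm_unitVec φ)
      (hM _ (upperHalf_subset_closedUpperHalf (hmem φ hφ))
        (by rw [sub_zero, norm_smul_unitVec hR.le])) (hB φ hφ) hg hg') hR.le
  · refine .of_forall fun φ => ((continuousAt_greenForm_pointSource hκ u (fun h => ?_)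
      (unitVec φ)).tendsto.comp hsource).const_mul _
    rw [← norm_smul_unitVec hR.le φ, h, hnorm] at hy
    exact hy.false

lemma integral_mul_apertureData (f : ℝ → ℂ) (c : ℂ) {R : ℝ} (hε : 0 ≤ ε) (hR : ε ≤ R) :
    ∫ t in -R..R, f t * apertureData ε c t = c * ∫ t in (0 : ℝ)..ε, f t := by
  rw [← intervalIntegral.integral_const_mul, intervalIntegral.integral_of_le (by linarith),
    intervalIntegral.integral_of_le hε, integral_Ioc_eq_integral_Ioo (x := 0)]
  have hsub : Set.Ioo 0 ε ⊆ Set.Ioc (-R) R := fun t ht =>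
    ⟨by linarith [ht.1], ht.2.le.trans hR⟩
  rw [setIntegral_eq_of_subset_of_forall_sdiff_eq_zero measurableSet_Ioc hsub fun t ht => by
    rw [apertureData, if_neg (show ¬(0 < t ∧ t < ε) from ht.2), mul_zero]]
  refine setIntegral_congr_fun measurableSet_Ioo fun t ht => ?_
  simp only [apertureData, if_pos (show 0 < t ∧ t < ε from ht), mul_comm]

lemma trace_representation_arc (hκ : 0 < κ) (hu : NeumannField κ ε c u) (hy : y ∈ Set.Ioo 0 ε)
    {R : ℝ} (hR : ε < R) {B : ℝ}
    (hB : ∀ φ ∈ Set.Ioo 0 π, ‖fderiv ℝ u (R • unitVec φ) (unitVec φ)‖ ≤ B) :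
    π * u !₂[y, 0] + c * ∫ t in (0 : ℝ)..ε, hankel 0 (κ * |t - y|) =
      ∫ φ in (0 : ℝ)..π, R * greenForm u (pointSource κ !₂[y, 0]) (R • unitVec φ) (unitVec φ) := by
  have hε : 0 < ε := hy.1.trans hy.2
  have hyR : y ∈ Set.Ioo (-R) R := ⟨by linarith [hy.1], hy.2.trans hR⟩
  have hlayers := (tendsto_integral_pointSource (y := y) hκ
    (intervalIntegrable_apertureData ε c (-R) R) (norm_apertureData_le ε c)).sub
    (tendsto_integral_fderiv_pointSource hκ (continuous_trace hu.continuousOn) hyR)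
  rw [integral_mul_apertureData _ c hε.le hR.le, neg_mul, sub_neg_eq_add, add_comm] at hlayers
  refine tendsto_nhds_unique (hlayers.congr' ?_) (tendsto_integral_arc hκ hu (abs_lt.2 hyR) hB)
  filter_upwards [self_mem_nhdsWithin] with τ hτ
  have hg := testField_pointSource (y := y) hκ hτ
  rw [green_halfDisc hu hg hε hR hB]
  simp_rw [greenNormal_boundary]
  rw [intervalIntegral.integral_sub]
  · exact (intervalIntegrable_apertureData ε c (-R) R).continuousOn_mul
      (continuous_trace hg.continuousOn).continuousOn
  · exact ((continuous_trace hu.continuousOn).mul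
      ((continuous_trace hg.continuousOn_fderiv).clm_apply
        continuous_const)).intervalIntegrable _ _

lemma Radiating.eventually_norm_sub_le (h : Radiating κ u) {δ : ℝ} (hδ : 0 < δ) :
    ∀ᶠ R in atTop, ∀ φ ∈ Set.Ioo 0 π,
      ‖fderiv ℝ u (R • unitVec φ) (unitVec φ) - I * κ * u (R • unitVec φ)‖ ≤ δ / √R := by
  have hnear := Metric.tendsto_nhds.1 h δ hδ
  rw [eventually_inf_principal] at hnear
  obtain ⟨r, -, hr⟩ := (Filter.hasBasis_cobounded_norm.eventually_iff).1 hnear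
  filter_upwards [eventually_ge_atTop r, eventually_gt_atTop 0] with R hRr hR φ hφ
  have hdist := hr (x := R • unitVec φ)
    (by rw [Set.mem_ofPred, norm_smul_unitVec hR.le]; exact hRr) (smul_unitVec_mem_upperHalf hR hφ)
  rw [dist_zero_right, norm_mul, norm_smul_unitVec hR.le, inv_smul_smul₀ hR.ne',
    Complex.norm_of_nonneg (Real.sqrt_nonneg R)] at hdist
  rw [le_div_iff₀ (Real.sqrt_pos.2 hR), mul_comm]
  exact hdist.le

lemma hasDerivAt_cexp_mul_comp_ray (κ : ℝ) {e : Plane} {s : ℝ}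
    (hu : DifferentiableAt ℝ u (s • e)) :
    HasDerivAt (fun s : ℝ => Complex.exp (-(I * κ) * s) * u (s • e))
      (Complex.exp (-(I * κ) * s) * (fderiv ℝ u (s • e) e - I * κ * u (s • e))) s := by
  have hexp := ((Complex.ofRealCLM.hasDerivAt (x := s)).const_mul (-(I * κ))).cexp
  have hray := hu.hasFDerivAt.comp_hasDerivAt s ((hasDerivAt_id s).smul_const e)
  refine (hexp.mul hray).congr_deriv ?_
  simp only [Complex.ofRealCLM_apply, Complex.ofReal_one, Function.comp_apply, one_smul, id_eq]
  ring

/-- Along a ray, `e^{-iκs} u` has a derivative that is `o(s^{-1/2})`. -/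
lemma Radiating.eventually_norm_le (h : Radiating κ u) (hc : ContinuousOn u closedUpperHalf)
    (hd : ∀ x ∈ upperHalf, DifferentiableAt ℝ u x) {δ : ℝ} (hδ : 0 < δ) :
    ∀ᶠ R in atTop, ∀ φ ∈ Set.Ioo 0 π, ‖u (R • unitVec φ)‖ ≤ δ * √R := by
  obtain ⟨R₀, hR₀, hrad⟩ := ((eventually_gt_atTop 0).and (eventually_forall_ge_atTop.2
    (h.eventually_norm_sub_le (by positivity : 0 < δ / 4)))).exists
  obtain ⟨M, -, hM⟩ := exists_bound_of_continuousOn hc 0 R₀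
  filter_upwards [eventually_ge_atTop R₀,
    (tendsto_sqrt_atTop.const_mul_atTop (half_pos hδ)).eventually_ge_atTop M] with R hR hMR φ hφ
  have hnorm : ∀ s : ℝ, ‖Complex.exp (-(I * κ) * s)‖ = 1 := fun s => by
    rw [Complex.norm_exp]; simp
  have hpos : ∀ s ∈ Set.Icc R₀ R, 0 < s := fun s hs => hR₀.trans_le hs.1
  have hderiv : ∀ s ∈ Set.Icc R₀ R, HasDerivAt _ _ s := fun s hs => hasDerivAt_cexp_mul_comp_ray κ
    (hd _ (smul_unitVec_mem_upperHalf (hpos s hs) hφ))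
  have hfence : ∀ s ∈ Set.Icc R₀ R, HasDerivAt (fun s => M + δ / 2 * √s) (δ / 4 / √s) s :=
    fun s hs => (((Real.hasDerivAt_sqrt (hpos s hs).ne').const_mul (δ / 2)).const_add M).congr_deriv
      (by have := Real.sqrt_pos.2 (hpos s hs); field_simp; norm_num)
  have hle := image_norm_le_of_norm_deriv_right_le_deriv_boundary'
    (fun s hs => (hderiv s hs).continuousAt.continuousWithinAt)
    (fun s hs => (hderiv s (Set.Ico_subset_Icc_self hs)).hasDerivWithinAt) ?_
    (fun s hs => (hfence s hs).continuousAt.continuousWithinAt)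
    (fun s hs => (hfence s (Set.Ico_subset_Icc_self hs)).hasDerivWithinAt) ?_
    (Set.right_mem_Icc.2 hR)
  · rw [norm_mul, hnorm, one_mul] at hle
    linarith
  · rw [norm_mul, hnorm, one_mul]
    refine (hM _ (upperHalf_subset_closedUpperHalf (smul_unitVec_mem_upperHalf hR₀ hφ))
      (by rw [sub_zero, norm_smul_unitVec hR₀.le])).trans (le_add_of_nonneg_right (by positivity))
  · intro s hs
    rw [norm_mul, hnorm, one_mul]
    exact hrad s hs.1 φ hφ

lemma exists_norm_hankel_far (hκ : 0 < κ) :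
    ∃ C, 0 ≤ C ∧ ∀ R r : ℝ, 0 < R → R / 2 ≤ r → ‖hankel 0 (κ * r)‖ ≤ C / √R ∧
      ‖hankel 1 (κ * r) - I * hankel 0 (κ * r)‖ ≤ C / (R * √R) := by
  set A : ℝ := (2 / κ) ^ (1 / 2 : ℝ) * Real.Gamma (1 / 2) with hA
  set B : ℝ := (2 / κ) ^ (3 / 2 : ℝ) * Real.Gamma (3 / 2) with hB
  have hA0 : 0 ≤ A := mul_nonneg (by positivity) (Real.Gamma_nonneg_of_nonneg (by norm_num))
  have hB0 : 0 ≤ B := mul_nonneg (by positivity) (Real.Gamma_nonneg_of_nonneg (by norm_num))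
  refine ⟨A + B, add_nonneg hA0 hB0, fun R r hR hr => ?_⟩
  have hr0 : 0 < r := (half_pos hR).trans_le hr
  have hinv : 1 / (κ * r) ≤ 2 / κ * R⁻¹ := by
    rw [← div_eq_mul_inv, div_div, div_le_div_iff₀ (by positivity) (by positivity)]
    nlinarith
  have hpow : ∀ p : ℝ, 0 ≤ p → (1 / (κ * r)) ^ p ≤ (2 / κ) ^ p * R⁻¹ ^ p := fun p hp =>
    (Real.rpow_le_rpow (by positivity) hinv hp).trans_eq
      (Real.mul_rpow (by positivity) (by positivity))
  have hhalf : R⁻¹ ^ (1 / 2 : ℝ) = (√R)⁻¹ := by rw [← Real.sqrt_eq_rpow, Real.sqrt_inv]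
  have hthree : R⁻¹ ^ (3 / 2 : ℝ) = (R * √R)⁻¹ := by
    rw [show (3 / 2 : ℝ) = 1 + 1 / 2 by norm_num, rpow_add (by positivity), rpow_one, hhalf,
      mul_inv]
  constructor
  · calc ‖hankel 0 (κ * r)‖ ≤ (2 / κ) ^ (1 / 2 : ℝ) * R⁻¹ ^ (1 / 2 : ℝ) * Real.Gamma (1 / 2) :=
        (norm_hankel_zero_le (mul_pos hκ hr0)).trans (by gcongr; exact hpow _ (by norm_num))
      _ = A / √R := by rw [hhalf, hA]; ring
      _ ≤ (A + B) / √R := by gcongr; linarith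
  · calc ‖hankel 1 (κ * r) - I * hankel 0 (κ * r)‖
        ≤ (2 / κ) ^ (3 / 2 : ℝ) * R⁻¹ ^ (3 / 2 : ℝ) * Real.Gamma (3 / 2) :=
        (norm_hankel_one_sub_le (mul_pos hκ hr0)).trans (by gcongr; exact hpow _ (by norm_num))
      _ = B / (R * √R) := by rw [hthree, hB]; ring
      _ ≤ (A + B) / (R * √R) := by gcongr; linarith

lemma abs_inner_div_norm_le_one {x e : Plane} (he : ‖e‖ = 1) : |inner ℝ x e / ‖x‖| ≤ 1 := by
  simpa [he] using abs_real_inner_div_norm_mul_norm_le_one x e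

lemma abs_inner_div_norm_sub_one_le {z e : Plane} {R : ℝ} (he : ‖e‖ = 1) (hR : 0 < R)
    (hz : 2 * ‖z‖ ≤ R) : |inner ℝ (R • e - z) e / ‖R • e - z‖ - 1| ≤ 4 * ‖z‖ / R := by
  have hRe : ‖R • e‖ = R := by rw [norm_smul, he, mul_one, Real.norm_of_nonneg hR.le]
  have hlow := norm_sub_norm_le (R • e) z
  have hupp := norm_sub_le (R • e) z
  rw [hRe] at hlow hupp
  have hr : 0 < ‖R • e - z‖ := by linarith
  have hinner : inner ℝ (R • e - z) e = R - inner ℝ z e := by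
    rw [inner_sub_left, real_inner_smul_left, real_inner_self_eq_norm_sq, he]
    ring
  have hze := abs_le.1 ((abs_real_inner_le_norm z e).trans_eq (by rw [he, mul_one]))
  rw [hinner, div_sub_one hr.ne', abs_div, abs_of_pos hr, div_le_div_iff₀ hr hR]
  have hnum : |R - inner ℝ z e - ‖R • e - z‖| ≤ 2 * ‖z‖ :=
    abs_le.2 ⟨by linarith, by linarith⟩
  nlinarith [norm_nonneg z]

/-- Uniform Sommerfeld condition for the point source: both summands of
`∂ₑG - iκG = κ (H₁ - iH₀) β + iκH₀ (β - 1)` are `O(R^{-3/2})`, where `β` is the cosine of the angle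
between `e` and `R • e - z`. -/
lemma exists_pointSource_far (hκ : 0 < κ) (z : Plane) :
    ∃ C, 0 ≤ C ∧ ∀ (R : ℝ) (e : Plane), 0 < R → 2 * ‖z‖ ≤ R → ‖e‖ = 1 →
      ‖pointSource κ z (R • e)‖ ≤ C / √R ∧
      ‖fderiv ℝ (pointSource κ z) (R • e) e - I * κ * pointSource κ z (R • e)‖ ≤
        C / (R * √R) := by
  obtain ⟨C, hC0, hC⟩ := exists_norm_hankel_far hκ
  refine ⟨C + (κ * C + κ * C * (4 * ‖z‖)), by positivity, fun R e hR hz he => ?_⟩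
  have hlow := norm_sub_norm_le (R • e) z
  rw [norm_smul, he, mul_one, Real.norm_of_nonneg hR.le] at hlow
  set r : ℝ := ‖R • e - z‖ with hr
  have hr0 : 0 < r := by linarith
  obtain ⟨hH₀, hH₁⟩ := hC R r hR (by linarith)
  refine ⟨hH₀.trans (by gcongr ?_ / _; exact le_add_of_nonneg_right (by positivity)), ?_⟩
  set β : ℝ := inner ℝ (R • e - z) e / r with hβ
  have hsplit : fderiv ℝ (pointSource κ z) (R • e) e - I * κ * pointSource κ z (R • e) =
      κ * (hankel 1 (κ * r) - I * hankel 0 (κ * r)) * β +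
        I * κ * hankel 0 (κ * r) * (β - 1 : ℝ) := by
    rw [fderiv_pointSource hκ (sub_ne_zero.1 (norm_pos_iff.1 hr0)), pointSource, ← hr, hβ]
    push_cast
    ring
  have hfirst : ‖κ * (hankel 1 (κ * r) - I * hankel 0 (κ * r)) * β‖ ≤ κ * (C / (R * √R)) * 1 := by
    rw [norm_mul, norm_mul, Complex.norm_of_nonneg hκ.le, Complex.norm_real]
    gcongr
    exact abs_inner_div_norm_le_one he
  have hsecond : ‖I * κ * hankel 0 (κ * r) * (β - 1 : ℝ)‖ ≤ κ * (C / √R) * (4 * ‖z‖ / R) := by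
    rw [norm_mul, norm_mul, norm_mul, Complex.norm_I, one_mul, Complex.norm_of_nonneg hκ.le,
      Complex.norm_real]
    gcongr
    exact abs_inner_div_norm_sub_one_le he hR hz
  calc _ ≤ κ * (C / (R * √R)) * 1 + κ * (C / √R) * (4 * ‖z‖ / R) := by
        rw [hsplit]; exact norm_add_le_of_le hfirst hsecond
    _ = (κ * C + κ * C * (4 * ‖z‖)) / (R * √R) := by field_simp
    _ ≤ _ := by gcongr ?_ / _; exact le_add_of_nonneg_left hC0

/-- The `iκ` terms cancel, `G ∂u - u ∂G = G (∂u - iκu) - u (∂G - iκG)`. -/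
lemma norm_mul_greenForm_le {g : Plane → ℂ} {x e : Plane} {R C δ : ℝ} (hR : 0 < R) (hC : 0 ≤ C)
    (hu : ‖u x‖ ≤ δ * √R) (hu' : ‖fderiv ℝ u x e - I * κ * u x‖ ≤ δ / √R)
    (hg : ‖g x‖ ≤ C / √R) (hg' : ‖fderiv ℝ g x e - I * κ * g x‖ ≤ C / (R * √R)) :
    ‖R * greenForm u g x e‖ ≤ 2 * C * δ := by
  have hsplit : greenForm u g x e = g x * (fderiv ℝ u x e - I * κ * u x) -
      u x * (fderiv ℝ g x e - I * κ * g x) := by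
    rw [greenForm_apply]; ring
  have hbound : ‖greenForm u g x e‖ ≤ C / √R * (δ / √R) + δ * √R * (C / (R * √R)) := by
    rw [hsplit]
    refine (norm_sub_le _ _).trans ?_
    rw [norm_mul, norm_mul]
    gcongr
    exact (norm_nonneg _).trans hu
  rw [norm_mul, Complex.norm_of_nonneg hR.le]
  refine (mul_le_mul_of_nonneg_left hbound hR.le).trans_eq ?_
  rw [div_mul_div_comm, Real.mul_self_sqrt hR.le]
  field_simp
  ring

lemma NeumannField.eventually_norm_fderiv_le (hu : NeumannField κ ε c u) (h : Radiating κ u) :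
    ∀ᶠ R : ℝ in atTop, ∃ B, ∀ φ ∈ Set.Ioo 0 π,
      ‖fderiv ℝ u (R • unitVec φ) (unitVec φ)‖ ≤ B := by
  filter_upwards [h.eventually_norm_sub_le one_pos, eventually_gt_atTop 0] with R hrad hR
  obtain ⟨M, -, hM⟩ := exists_bound_of_continuousOn hu.continuousOn 0 R
  refine ⟨1 / √R + ‖I * κ‖ * M, fun φ hφ => ?_⟩
  rw [← sub_add_cancel (fderiv ℝ u (R • unitVec φ) (unitVec φ)) (I * κ * u (R • unitVec φ))]
  refine norm_add_le_of_le (hrad φ hφ) ?_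
  rw [norm_mul]
  gcongr
  exact hM _ (upperHalf_subset_closedUpperHalf (smul_unitVec_mem_upperHalf hR hφ))
    (by rw [sub_zero, norm_smul_unitVec hR.le])

lemma Radiating.tendsto_integral_greenForm (h : Radiating κ u) (hc : ContinuousOn u closedUpperHalf)
    (hd : ∀ x ∈ upperHalf, DifferentiableAt ℝ u x) (hκ : 0 < κ) (z : Plane) :
    Tendsto (fun R : ℝ => ∫ φ in (0 : ℝ)..π,
      R * greenForm u (pointSource κ z) (R • unitVec φ) (unitVec φ)) atTop (𝓝 0) := by
  obtain ⟨C, hC0, hC⟩ := exists_pointSource_far hκ z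
  have := pi_pos
  refine Metric.tendsto_nhds.2 fun η hη => ?_
  have hδ : 0 < η / (π * (2 * C + 1)) := by positivity
  filter_upwards [h.eventually_norm_sub_le hδ, h.eventually_norm_le hc hd hδ,
    eventually_gt_atTop 0, eventually_ge_atTop (2 * ‖z‖)] with R hrad hgrow hR hzR
  have hle : ‖∫ φ in (0 : ℝ)..π, R * greenForm u (pointSource κ z) (R • unitVec φ) (unitVec φ)‖ ≤
      2 * C * (η / (π * (2 * C + 1))) * |π - 0| := by
    refine intervalIntegral.norm_integral_le_of_norm_le_const_ae ?_
    filter_upwards [Measure.ae_ne volume π] with φ hφπ hφ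
    rw [Set.uIoc_of_le pi_pos.le] at hφ
    have hφ' : φ ∈ Set.Ioo 0 π := ⟨hφ.1, hφ.2.lt_of_ne hφπ⟩
    obtain ⟨hg, hg'⟩ := hC R (unitVec φ) hR hzR (norm_unitVec φ)
    exact norm_mul_greenForm_le hR hC0 (hgrow φ hφ') (hrad φ hφ') hg hg'
  rw [dist_zero_right]
  refine hle.trans_lt ?_
  rw [sub_zero, abs_of_pos pi_pos, mul_div_assoc', div_mul_eq_mul_div,
    div_lt_iff₀ (by positivity)]
  nlinarith [mul_pos hη pi_pos]

lemma trace_representation (hκ : 0 < κ) (hu : NeumannField κ ε c u) (h : Radiating κ u)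
    (hy : y ∈ Set.Ioo 0 ε) :
    π * u !₂[y, 0] + c * ∫ t in (0 : ℝ)..ε, hankel 0 (κ * |t - y|) = 0 := by
  refine tendsto_nhds_unique (tendsto_const_nhds.congr' ?_)
    (h.tendsto_integral_greenForm hu.continuousOn
      (fun x hx => (hu.contDiffAt x hx).differentiableAt two_ne_zero) hκ !₂[y, 0])
  filter_upwards [hu.eventually_norm_fderiv_le h, eventually_gt_atTop ε] with R ⟨B, hB⟩ hR
  exact trace_representation_arc hκ hu hy hR hB

end TraceRepresentation

/-! ### The incident and reflected waves -/

section Background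

variable {κ θ ε d : ℝ} {v : Plane → ℂ}

lemma inner_plane (x y : Plane) : inner ℝ x y = x 0 * y 0 + x 1 * y 1 := by
  simp [PiLp.inner_apply, Fin.sum_univ_two, mul_comm]

/-- The plane wave with wave vector `p`. -/
def planeWave (p x : Plane) : ℂ := Complex.exp (I * innerForm p x)

lemma hasFDerivAt_planeWave (p x : Plane) :
    HasFDerivAt (planeWave p) ((planeWave p x * I) • innerForm p) x := by
  refine (((innerForm p).hasFDerivAt (x := x)).const_mul I).cexp.congr_fderiv ?_
  rw [smul_smul]
  rfl

lemma contDiff_planeWave (p : Plane) : ContDiff ℝ 2 (planeWave p) :=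
  (contDiff_const.mul (innerForm p).contDiff).cexp

lemma laplacian_planeWave (p x : Plane) :
    Δ (planeWave p) x = -((‖p‖ ^ 2 : ℝ) : ℂ) * planeWave p x := by
  have hfderiv : fderiv ℝ (planeWave p) = fun x => (planeWave p x * I) • innerForm p :=
    funext fun x => (hasFDerivAt_planeWave p x).fderiv
  have hsecond := ((hasFDerivAt_planeWave p x).mul_const I).smul_const (innerForm p)
  have hcoord : innerForm p !₂[1, 0] = p 0 ∧ innerForm p !₂[0, 1] = p 1 := by
    simp [innerForm_apply, inner_plane]
  rw [laplacian_plane, hfderiv, hsecond.fderiv, EuclideanSpace.real_norm_sq_eq, Fin.sum_univ_two]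
  simp only [ContinuousLinearMap.smulRight_apply, smul_apply, hcoord, smul_eq_mul]
  push_cast
  linear_combination (((p 0 : ℂ)) ^ 2 + (p 1 : ℂ) ^ 2) * planeWave p x * Complex.I_sq

lemma uInc_eq_planeWave (κ θ : ℝ) : uInc κ θ = planeWave (κ • !₂[sin θ, -cos θ]) := by
  ext x
  rw [uInc, planeWave, innerForm_apply]
  congr 3
  simp [inner_smul_left, inner_plane, sub_eq_add_neg, mul_comm]

lemma uRef_eq_planeWave (κ θ : ℝ) : uRef κ θ = planeWave (κ • !₂[sin θ, cos θ]) := by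
  ext x
  rw [uRef, planeWave, innerForm_apply]
  congr 3
  simp [inner_smul_left, inner_plane, mul_comm]

lemma contDiff_background (κ θ : ℝ) : ContDiff ℝ 2 (uInc κ θ + uRef κ θ) := by
  rw [uInc_eq_planeWave, uRef_eq_planeWave]
  exact (contDiff_planeWave _).add (contDiff_planeWave _)

lemma helmholtz_background (κ θ : ℝ) (x : Plane) :
    Δ (uInc κ θ + uRef κ θ) x + (κ : ℂ) ^ 2 * (uInc κ θ + uRef κ θ) x = 0 := by
  have hnorm (s : ℝ) (hs : s ^ 2 = cos θ ^ 2) : ‖κ • (!₂[sin θ, s] : Plane)‖ ^ 2 = κ ^ 2 := by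
    rw [norm_smul, mul_pow, EuclideanSpace.real_norm_sq_eq, Fin.sum_univ_two]
    simp [hs]
  rw [uInc_eq_planeWave, uRef_eq_planeWave, (contDiff_planeWave _).contDiffAt.laplacian_add
    (contDiff_planeWave _).contDiffAt, laplacian_planeWave, laplacian_planeWave,
    hnorm _ (neg_sq _), hnorm _ rfl, Pi.add_apply]
  push_cast
  ring

lemma fderiv_background (κ θ : ℝ) (x : Plane) :
    fderiv ℝ (uInc κ θ + uRef κ θ) x !₂[0, 1] =
      I * (κ * cos θ) * (uRef κ θ x - uInc κ θ x) := by
  rw [uInc_eq_planeWave, uRef_eq_planeWave,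
    ((hasFDerivAt_planeWave _ x).add (hasFDerivAt_planeWave _ x)).fderiv]
  simp only [add_apply, smul_apply, innerForm_apply, smul_eq_mul, inner_smul_left,
    inner_plane]
  simp
  ring

lemma tendsto_fderiv_background (κ θ a : ℝ) :
    Tendsto (fun x : Plane => fderiv ℝ (uInc κ θ + uRef κ θ) x !₂[0, 1])
      (𝓝[upperHalf] !₂[a, 0]) (𝓝 0) := by
  have hcont : Continuous fun x : Plane => I * (κ * cos θ) * (uRef κ θ x - uInc κ θ x) := by
    unfold uRef uInc
    fun_prop
  simp_rw [fderiv_background]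
  exact (hcont.tendsto' !₂[a, 0] 0 (by simp [uInc, uRef])).mono_left nhdsWithin_le_nhds

lemma background_trace (κ θ t : ℝ) :
    uInc κ θ !₂[t, 0] + uRef κ θ !₂[t, 0] = 2 * Complex.exp ((κ * (t * sin θ) : ℝ) * I) := by
  simp [uInc, uRef, mul_comm I, two_mul]

/-- A solution of the approximate problem with only continuity up to the boundary in place of
finite energy. -/
structure IsContinuousSolution (κ θ ε d : ℝ) (v : Plane → ℂ) : Prop where
  contDiffOn : ContDiffOn ℝ 2 v upperHalf
  continuousOn : ContinuousOn v closedUpperHalf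
  helmholtz : ∀ x ∈ upperHalf, Δ v x + (κ : ℂ) ^ 2 * v x = 0
  neumann : ∀ a : ℝ, (a < 0 ∨ ε < a) →
    Tendsto (fun x : Plane => fderiv ℝ v x !₂[0, 1]) (𝓝[upperHalf] !₂[a, 0]) (𝓝 0)
  aperture : ∀ a : ℝ, 0 < a → a < ε →
    Tendsto (fun x : Plane => fderiv ℝ v x !₂[0, 1]) (𝓝[upperHalf] !₂[a, 0])
      (𝓝 (dtn0 κ ε d v a))
  radiating : Radiating κ (scattered κ θ v)
  bottom_eq_zero : ∀ x ∈ bottom ε d, v x = 0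
  cavity_eq : ∀ x ∈ cavity ε d,
    v x = (alphaPlus κ d (modeCoeff ε v 0) (modeCoeff ε v (-d)) *
          Complex.exp (-I * κ * x 1)
        + alphaMinus κ d (modeCoeff ε v 0) (modeCoeff ε v (-d)) *
          Complex.exp (I * κ * (x 1 + d))) * phi0 ε (x 0)

lemma IsApproxSolution.isContinuousSolution (hv : IsApproxSolution κ θ ε d v) :
    IsContinuousSolution κ θ ε d v := { hv with }

namespace IsContinuousSolution

lemma tendsto_fderiv (hv : IsContinuousSolution κ θ ε d v) {a : ℝ} (h0 : a ≠ 0) (hε : a ≠ ε) :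
    Tendsto (fun x : Plane => fderiv ℝ v x !₂[0, 1]) (𝓝[upperHalf] !₂[a, 0])
      (𝓝 (apertureData ε (dtn0 κ ε d v 0) a)) := by
  rw [apertureData]
  split_ifs with ha
  · exact hv.aperture a ha.1 ha.2
  · refine hv.neumann a (h0.lt_or_gt.imp_right fun hpos => ?_)
    exact (not_lt.1 fun hlt => ha ⟨hpos, hlt⟩).lt_of_ne hε.symm

lemma neumannField (hv : IsContinuousSolution κ θ ε d v) :
    NeumannField κ ε (dtn0 κ ε d v 0) (scattered κ θ v) := by
  have hs : scattered κ θ v = v - (uInc κ θ + uRef κ θ) := rfl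
  have hv2 (x) (hx : x ∈ upperHalf) : ContDiffAt ℝ 2 v x :=
    hv.contDiffOn.contDiffAt (isOpen_upperHalf.mem_nhds hx)
  have hb2 := contDiff_background κ θ
  rw [hs]
  refine ⟨fun x hx => (hv2 x hx).sub hb2.contDiffAt,
    hv.continuousOn.sub hb2.continuous.continuousOn, fun x hx => ?_, fun a h0 hε => ?_⟩
  · rw [(hv2 x hx).laplacian_sub hb2.contDiffAt, Pi.sub_apply]
    linear_combination hv.helmholtz x hx - helmholtz_background κ θ x
  · rw [← sub_zero (apertureData ε _ a)]
    refine ((hv.tendsto_fderiv h0 hε).sub (tendsto_fderiv_background κ θ a)).congr' ?_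
    filter_upwards [self_mem_nhdsWithin] with x hx
    rw [fderiv_sub ((hv2 x hx).differentiableAt two_ne_zero)
      (hb2.differentiable two_ne_zero).differentiableAt, sub_apply]

end IsContinuousSolution

end Background

/-! ### The field in the cavity -/

section CavityField

variable {κ θ ε d C : ℝ} {v : Plane → ℂ}

/-- The mean value over the aperture of the trace of `v` on `x₂ = 0`. -/
def apertureMean (ε : ℝ) (v : Plane → ℂ) : ℂ := (∫ t in (0 : ℝ)..ε, v !₂[t, 0]) / ε

lemma modeCoeff_mul_phi0 (hε : 0 ≤ ε) (v : Plane → ℂ) (a : ℝ) :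
    modeCoeff ε v 0 * phi0 ε a = apertureMean ε v := by
  have hphi : phi0 ε a * phi0 ε a = (ε : ℂ)⁻¹ := by
    rw [phi0, ← Complex.ofReal_mul, one_div, ← mul_inv, mul_self_sqrt hε, Complex.ofReal_inv]
  have hcoeff : modeCoeff ε v 0 = (∫ t in (0 : ℝ)..ε, v !₂[t, 0]) * phi0 ε a :=
    intervalIntegral.integral_mul_const _ _
  rw [hcoeff, mul_assoc, hphi, apertureMean, div_eq_mul_inv]

lemma dtn0_eq_cot (hε : 0 ≤ ε) (κ d : ℝ) (v : Plane → ℂ) (a : ℝ) :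
    dtn0 κ ε d v a = (κ * cot (κ * d) : ℝ) * apertureMean ε v := by
  have hcot : ((cot (κ * d) : ℝ) : ℂ) = I * ((Complex.exp (2 * I * κ * d) + 1) /
      (Complex.exp (2 * I * κ * d) - 1)) := by
    rw [Complex.ofReal_cot, Complex.cot_eq_exp_ratio, Complex.ofReal_mul, ← mul_assoc,
      ← neg_sub, mul_neg, div_neg, div_mul_eq_div_div_swap, Complex.div_I]
    ring
  rw [dtn0, mul_assoc, modeCoeff_mul_phi0 hε, Complex.ofReal_mul, hcot]
  ring

lemma cexp_sub_cexp_div_cexp_sub_one (a b : ℂ) :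
    (Complex.exp (I * b) * Complex.exp (I * a) - Complex.exp (I * (b - a))) /
      (Complex.exp (2 * I * b) - 1) = Complex.sin a / Complex.sin b := by
  have hsin (z : ℂ) : 2 * I * Complex.sin z = Complex.exp (I * z) - Complex.exp (-(I * z)) := by
    rw [Complex.sin, mul_comm z I, neg_mul, mul_comm z I]
    linear_combination (Complex.exp (-(I * z)) - Complex.exp (I * z)) * Complex.I_sq
  have hnum : Complex.exp (I * b) * Complex.exp (I * a) - Complex.exp (I * (b - a)) =
      Complex.exp (I * b) * (2 * I) * Complex.sin a := by
    rw [mul_assoc, hsin, mul_sub I, sub_eq_add_neg (I * b), Complex.exp_add, mul_sub]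
  have hden : Complex.exp (2 * I * b) - 1 = Complex.exp (I * b) * (2 * I) * Complex.sin b := by
    rw [mul_assoc _ (2 * I), hsin, mul_sub, ← Complex.exp_add, ← Complex.exp_add, add_neg_cancel,
      Complex.exp_zero, ← two_mul, mul_assoc]
  rw [hnum, hden, mul_div_mul_left _ _
    (mul_ne_zero (Complex.exp_ne_zero _) (mul_ne_zero two_ne_zero Complex.I_ne_zero))]

lemma IsContinuousSolution.modeCoeff_bottom (hε : 0 ≤ ε) (hv : IsContinuousSolution κ θ ε d v) :
    modeCoeff ε v (-d) = 0 := by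
  rw [modeCoeff, intervalIntegral.integral_of_le hε, integral_Ioc_eq_integral_Ioo]
  refine setIntegral_eq_zero_of_forall_eq_zero fun t ht => ?_
  rw [hv.bottom_eq_zero _ ⟨ht.1, ht.2, rfl⟩, zero_mul]

lemma IsContinuousSolution.eq_apertureMean_mul (hε : 0 ≤ ε) (hv : IsContinuousSolution κ θ ε d v)
    {x : Plane} (hx : x ∈ cavity ε d) :
    v x = apertureMean ε v * (sin (κ * (x 1 + d)) / sin (κ * d) : ℝ) := by
  have hratio := cexp_sub_cexp_div_cexp_sub_one ((κ * (x 1 + d) : ℝ) : ℂ) ((κ * d : ℝ) : ℂ)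
  have hback : I * (((κ * d : ℝ) : ℂ) - ((κ * (x 1 + d) : ℝ) : ℂ)) = -I * κ * x 1 := by
    push_cast; ring
  rw [hback] at hratio
  push_cast [← mul_assoc] at hratio ⊢
  rw [hv.cavity_eq x hx, hv.modeCoeff_bottom hε, alphaPlus, alphaMinus, ← hratio,
    ← modeCoeff_mul_phi0 hε v (x 0)]
  ring

lemma volume_cavity (hε : 0 ≤ ε) (d : ℝ) : volume (cavity ε d) = ENNReal.ofReal (ε * d) := by
  have hpre : cavity ε d = (MeasurableEquiv.toLp 2 (Fin 2 → ℝ)).symm ⁻¹'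
      (Set.pi Set.univ ![Set.Ioo 0 ε, Set.Ioo (-d) 0]) := by
    ext x
    simp [cavity, Fin.forall_fin_two, and_assoc]
  rw [hpre, (EuclideanSpace.volume_preserving_symm_measurableEquiv_toLp
    (Fin 2)).measure_preimage_equiv, volume_pi_pi, Fin.prod_univ_two]
  simp [ENNReal.ofReal_mul hε]

lemma measurableSet_cavity (ε d : ℝ) : MeasurableSet (cavity ε d) := by
  unfold cavity
  measurability

lemma cavity_half_subset (ε : ℝ) (hd : 0 ≤ d) : cavity ε (d / 2) ⊆ cavity ε d :=
  fun _ hx => ⟨hx.1, hx.2.1, by linarith [hx.2.2.1], hx.2.2.2⟩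

lemma eLpNorm_const_cavity (hε : 0 ≤ ε) (hd : 0 ≤ d) (hC : 0 ≤ C) :
    eLpNorm (fun _ : Plane => C) 2 (volume.restrict (cavity ε d)) =
      ENNReal.ofReal (C * √(ε * d)) := by
  rw [eLpNorm_const' C two_ne_zero ENNReal.ofNat_ne_top, Measure.restrict_apply_univ,
    volume_cavity hε, ENNReal.ofReal_rpow_of_nonneg (by positivity) (by positivity),
    ENNReal.ofReal_mul hC, Real.enorm_of_nonneg hC, sqrt_eq_rpow, ENNReal.toReal_ofNat]

lemma eLpNorm_cavity_le_of_norm_le (hε : 0 ≤ ε) (hd : 0 ≤ d) (hC : 0 ≤ C)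
    (h : ∀ x ∈ cavity ε d, ‖v x‖ ≤ C) :
    eLpNorm v 2 (volume.restrict (cavity ε d)) ≤ ENNReal.ofReal (C * √(ε * d)) := by
  rw [← eLpNorm_const_cavity hε hd hC]
  exact eLpNorm_mono_ae_real (ae_restrict_of_forall_mem (measurableSet_cavity ε d) h)

lemma le_eLpNorm_cavity_of_le_norm (hε : 0 ≤ ε) (hd : 0 ≤ d) (hC : 0 ≤ C)
    (h : ∀ x ∈ cavity ε d, C ≤ ‖v x‖) :
    ENNReal.ofReal (C * √(ε * d)) ≤ eLpNorm v 2 (volume.restrict (cavity ε d)) := by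
  rw [← eLpNorm_const_cavity hε hd hC]
  refine eLpNorm_mono_ae (ae_restrict_of_forall_mem (measurableSet_cavity ε d) fun x hx => ?_)
  rw [Real.norm_of_nonneg hC]
  exact h x hx

lemma sin_div_sin_mem_Icc {a b : ℝ} (hb : 0 < b) (hb' : b ≤ π / 2) (ha : 0 ≤ a) (hab : a ≤ b) :
    sin a / sin b ∈ Set.Icc 0 1 := by
  have hsin : 0 < sin b := sin_pos_of_pos_of_lt_pi hb (by linarith [pi_pos])
  exact ⟨div_nonneg (sin_nonneg_of_nonneg_of_le_pi ha (by linarith [pi_pos])) hsin.le,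
    (div_le_one hsin).2 (sin_le_sin_of_le_of_le_pi_div_two (by linarith) hb' hab)⟩

lemma half_le_sin_div_sin {a b : ℝ} (hb : 0 < b) (hb' : b ≤ π / 2) (hba : b / 2 ≤ a)
    (hab : a ≤ b) : 1 / 2 ≤ sin a / sin b := by
  have hhalf : 0 < sin (b / 2) := sin_pos_of_pos_of_lt_pi (by positivity) (by linarith [pi_pos])
  have hmono : sin (b / 2) ≤ sin a :=
    sin_le_sin_of_le_of_le_pi_div_two (by linarith) (by linarith) hba
  have hdouble : sin b = 2 * sin (b / 2) * cos (b / 2) := by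
    rw [← sin_two_mul, mul_div_cancel₀ b two_ne_zero]
  rw [le_div_iff₀ (sin_pos_of_pos_of_lt_pi hb (by linarith [pi_pos])), hdouble]
  nlinarith [cos_le_one (b / 2)]

lemma IsContinuousSolution.norm_le (hε : 0 ≤ ε) (hκ : 0 < κ) (hd : 0 < d) (hκd : κ * d ≤ π / 2)
    (hv : IsContinuousSolution κ θ ε d v) {x : Plane} (hx : x ∈ cavity ε d) :
    ‖v x‖ ≤ ‖apertureMean ε v‖ := by
  have hratio := sin_div_sin_mem_Icc (mul_pos hκ hd) hκd (a := κ * (x 1 + d))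
    (mul_nonneg hκ.le (by linarith [hx.2.2.1])) (by gcongr; linarith [hx.2.2.2])
  rw [hv.eq_apertureMean_mul hε hx, norm_mul, Complex.norm_of_nonneg hratio.1]
  exact mul_le_of_le_one_right (norm_nonneg _) hratio.2

lemma IsContinuousSolution.half_norm_apertureMean_le (hε : 0 ≤ ε) (hκ : 0 < κ) (hd : 0 < d)
    (hκd : κ * d ≤ π / 2) (hv : IsContinuousSolution κ θ ε d v) {x : Plane}
    (hx : x ∈ cavity ε (d / 2)) : ‖apertureMean ε v‖ / 2 ≤ ‖v x‖ := by
  have hratio := half_le_sin_div_sin (mul_pos hκ hd) hκd (a := κ * (x 1 + d))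
    (by rw [mul_div_assoc]; gcongr; linarith [hx.2.2.1]) (by gcongr; linarith [hx.2.2.2])
  rw [hv.eq_apertureMean_mul hε (cavity_half_subset ε hd.le hx), norm_mul,
    Complex.norm_of_nonneg (by linarith), div_eq_mul_one_div]
  gcongr

lemma IsContinuousSolution.eLpNorm_cavity_le (hε : 0 ≤ ε) (hκ : 0 < κ) (hd : 0 < d)
    (hκd : κ * d ≤ π / 2) (hv : IsContinuousSolution κ θ ε d v) :
    eLpNorm v 2 (volume.restrict (cavity ε d)) ≤
      ENNReal.ofReal (‖apertureMean ε v‖ * √(ε * d)) :=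
  eLpNorm_cavity_le_of_norm_le hε hd.le (norm_nonneg _) fun _ hx => hv.norm_le hε hκ hd hκd hx

lemma IsContinuousSolution.le_eLpNorm_cavity (hε : 0 ≤ ε) (hκ : 0 < κ) (hd : 0 < d)
    (hκd : κ * d ≤ π / 2) (hv : IsContinuousSolution κ θ ε d v) :
    ENNReal.ofReal (‖apertureMean ε v‖ / 4 * √(ε * d)) ≤
      eLpNorm v 2 (volume.restrict (cavity ε d)) := by
  have hsqrt : √(ε * d) / 2 ≤ √(ε * (d / 2)) := by
    refine Real.le_sqrt_of_sq_le ?_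
    rw [div_pow, Real.sq_sqrt (by positivity)]
    nlinarith [mul_nonneg hε hd.le]
  calc ENNReal.ofReal (‖apertureMean ε v‖ / 4 * √(ε * d))
      = ENNReal.ofReal (‖apertureMean ε v‖ / 2 * (√(ε * d) / 2)) := by congr 1; ring
    _ ≤ ENNReal.ofReal (‖apertureMean ε v‖ / 2 * √(ε * (d / 2))) := by gcongr
    _ ≤ eLpNorm v 2 (volume.restrict (cavity ε (d / 2))) :=
      le_eLpNorm_cavity_of_le_norm hε (by positivity) (by positivity)
        fun _ hx => hv.half_norm_apertureMean_le hε hκ hd hκd hx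
    _ ≤ eLpNorm v 2 (volume.restrict (cavity ε d)) :=
      eLpNorm_mono_measure v (Measure.restrict_mono (cavity_half_subset ε hd.le) le_rfl)

end CavityField

/-! ### The averaged equation on the aperture -/

section Aperture

variable {κ θ ε d : ℝ} {v : Plane → ℂ}

/-- The single layer potential at the point `(y, 0)` of the unit density on the aperture. -/
def aperturePotential (κ ε y : ℝ) : ℂ := ∫ t in (0 : ℝ)..ε, hankel 0 (κ * |t - y|)

/-- The mean value over the aperture of the potential of the unit density on it. -/
def selfPotential (κ ε : ℝ) : ℂ := (∫ y in (0 : ℝ)..ε, aperturePotential κ ε y) / ε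

lemma IsContinuousSolution.apertureMean_mul_one_add (hκ : 0 < κ) (hε : 0 < ε)
    (hv : IsContinuousSolution κ θ ε d v) :
    apertureMean ε v * (1 + (κ * cot (κ * d) / π : ℝ) * selfPotential κ ε) =
      apertureMean ε (uInc κ θ + uRef κ θ) := by
  set c := dtn0 κ ε d v 0 with hc
  set b : ℝ → ℂ := fun t => (uInc κ θ + uRef κ θ) !₂[t, 0] with hb
  have hbc : Continuous b := continuous_trace (contDiff_background κ θ).continuous.continuousOn
  have hvc : Continuous fun t : ℝ => v !₂[t, 0] := continuous_trace hv.continuousOn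
  have hpoint : ∀ y ∈ Set.Ioo 0 ε, c * aperturePotential κ ε y = -π * (v !₂[y, 0] - b y) :=
    fun y hy => by
      have hrep := trace_representation hκ hv.neumannField hv.radiating hy
      simp only [scattered] at hrep
      simp only [hb, Pi.add_apply, aperturePotential]
      linear_combination hrep
  have hint : c * ∫ y in (0 : ℝ)..ε, aperturePotential κ ε y =
      -π * ((∫ t in (0 : ℝ)..ε, v !₂[t, 0]) - ∫ t in (0 : ℝ)..ε, b t) := by
    rw [← intervalIntegral.integral_sub (hvc.intervalIntegrable _ _) (hbc.intervalIntegrable _ _),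
      ← intervalIntegral.integral_const_mul, ← intervalIntegral.integral_const_mul]
    exact intervalIntegral.integral_congr_Ioo_of_le hε.le hpoint
  have hmean : c * selfPotential κ ε =
      -π * (apertureMean ε v - apertureMean ε (uInc κ θ + uRef κ θ)) := by
    rw [selfPotential, apertureMean, apertureMean, ← sub_div, mul_div_assoc', hint, mul_div_assoc]
  rw [hc, dtn0_eq_cot hε.le] at hmean
  have hπ : (π : ℂ) ≠ 0 := mod_cast pi_ne_zero
  rw [Complex.ofReal_div]
  field_simp
  linear_combination hmean

lemma norm_apertureMean_background_sub_two_le (hκ : 0 ≤ κ) (hε : 0 < ε) (θ : ℝ) :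
    ‖apertureMean ε (uInc κ θ + uRef κ θ) - 2‖ ≤ 2 * (κ * ε) := by
  have hc : Continuous fun t : ℝ => (uInc κ θ + uRef κ θ) !₂[t, 0] :=
    continuous_trace (contDiff_background κ θ).continuous.continuousOn
  have hpoint (t : ℝ) (ht : t ∈ Set.uIoc 0 ε) :
      ‖(uInc κ θ + uRef κ θ) !₂[t, 0] - 2‖ ≤ 2 * (κ * ε) := by
    rw [Set.uIoc_of_le hε.le] at ht
    have hphase : |κ * (t * sin θ)| ≤ κ * ε := by
      rw [abs_mul, abs_mul, abs_of_nonneg hκ, abs_of_pos ht.1]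
      gcongr
      exact (mul_le_of_le_one_right ht.1.le (abs_sin_le_one θ)).trans ht.2
    rw [Pi.add_apply, background_trace, ← mul_sub_one, norm_mul, Complex.norm_two, mul_comm _ I]
    gcongr
    exact Real.norm_exp_I_mul_ofReal_sub_one_le.trans hphase
  have hint := intervalIntegral.norm_integral_le_of_norm_le_const hpoint
  rw [intervalIntegral.integral_sub (hc.intervalIntegrable _ _) intervalIntegrable_const,
    intervalIntegral.integral_const, sub_zero, abs_of_pos hε] at hint
  have hε' : (ε : ℂ) ≠ 0 := mod_cast hε.ne'
  rw [apertureMean, div_sub' hε', norm_div, Complex.norm_of_nonneg hε.le, div_le_iff₀ hε]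
  rwa [Complex.real_smul] at hint

lemma re_setIntegral_nonneg {α : Type*} [MeasurableSpace α] {μ : Measure α} {s : Set α}
    (hs : MeasurableSet s) {f : α → ℂ} (hf : ∀ᵐ x ∂μ, x ∈ s → 0 ≤ (f x).re) :
    0 ≤ (∫ x in s, f x ∂μ).re := by
  by_cases hi : IntegrableOn f s μ
  · exact (integral_nonneg_of_ae ((ae_restrict_iff' hs).2 hf)).trans_eq (integral_re hi)
  · rw [integral_undef hi, Complex.zero_re]

lemma abs_sub_mem_Ioc {t y : ℝ} (ht : t ∈ Set.Ioc 0 ε) (hy : y ∈ Set.Ioo 0 ε) (hne : t ≠ y) :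
    |t - y| ∈ Set.Ioc 0 ε :=
  ⟨abs_pos.2 (sub_ne_zero.2 hne), abs_le.2 ⟨by linarith [ht.1, hy.2], by linarith [ht.2, hy.1]⟩⟩

lemma aperturePotential_re_nonneg {y : ℝ} (hκ : 0 < κ) (hκε : κ * ε ≤ π / 4)
    (hy : y ∈ Set.Ioo 0 ε) : 0 ≤ (aperturePotential κ ε y).re := by
  rw [aperturePotential, intervalIntegral.integral_of_le (hy.1.trans hy.2).le]
  refine re_setIntegral_nonneg measurableSet_Ioc ?_
  filter_upwards [Measure.ae_ne volume y] with t hne ht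
  obtain ⟨hpos, hle⟩ := abs_sub_mem_Ioc ht hy hne
  exact hankel_zero_re_nonneg (mul_pos hκ hpos)
    ((mul_le_mul_of_nonneg_left hle hκ.le).trans hκε)

lemma selfPotential_re_nonneg (hκ : 0 < κ) (hε : 0 ≤ ε) (hκε : κ * ε ≤ π / 4) :
    0 ≤ (selfPotential κ ε).re := by
  rw [selfPotential, Complex.div_ofReal_re, intervalIntegral.integral_of_le hε,
    integral_Ioc_eq_integral_Ioo]
  exact div_nonneg (re_setIntegral_nonneg measurableSet_Ioo
    (.of_forall fun _ => aperturePotential_re_nonneg hκ hκε)) hε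

lemma neg_mul_log_le {s : ℝ} (hε : 0 < ε) (hs : 0 < s) :
    -(s * Real.log s) ≤ -(s * Real.log ε) + (ε - s) := by
  have hlog := Real.log_le_sub_one_of_pos (div_pos hε hs)
  rw [Real.log_div hε.ne' hs.ne', le_sub_iff_add_le, le_div_iff₀ hs] at hlog
  linarith

lemma norm_aperturePotential_le {C y : ℝ}
    (hC : ∀ r : ℝ, 0 < r → r ≤ 1 → ‖hankel 0 r‖ ≤ C + Real.log (1 / r)) (hκ : 0 < κ)
    (hκε : κ * ε ≤ 1) (hy : y ∈ Set.Ioo 0 ε) :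
    ‖aperturePotential κ ε y‖ ≤ ε * (C + 2 + Real.log (1 / (κ * ε))) := by
  have hε : 0 < ε := hy.1.trans hy.2
  have hlog : IntervalIntegrable (fun t => Real.log (t - y)) volume 0 ε := by
    simpa using (intervalIntegral.intervalIntegrable_log'
      (a := 0 - y) (b := ε - y)).comp_sub_right y
  have hle : ‖aperturePotential κ ε y‖ ≤
      ∫ t in (0 : ℝ)..ε, (C - Real.log κ - Real.log (t - y)) := by
    refine intervalIntegral.norm_integral_le_of_norm_le hε.le ?_
      (intervalIntegrable_const.sub hlog)
    filter_upwards [Measure.ae_ne volume y] with t hne ht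
    obtain ⟨hpos, hle⟩ := abs_sub_mem_Ioc ht hy hne
    refine (hC _ (mul_pos hκ hpos) ((mul_le_mul_of_nonneg_left hle hκ.le).trans hκε)).trans_eq ?_
    rw [one_div, Real.log_inv, Real.log_mul hκ.ne' hpos.ne', Real.log_abs]
    ring
  refine hle.trans ?_
  rw [intervalIntegral.integral_sub intervalIntegrable_const hlog, intervalIntegral.integral_const,
    intervalIntegral.integral_comp_sub_right Real.log y, integral_log, one_div, Real.log_inv,
    Real.log_mul hκ.ne' hε.ne', smul_eq_mul, zero_sub, Real.log_neg_eq_log]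
  linarith [neg_mul_log_le hε hy.1, neg_mul_log_le hε (sub_pos.2 hy.2)]

lemma exists_norm_selfPotential_le : ∃ C, 0 ≤ C ∧ ∀ κ ε : ℝ, 0 < κ → 0 < ε → κ * ε ≤ 1 →
    ‖selfPotential κ ε‖ ≤ ε * (C + Real.log (1 / (κ * ε))) := by
  obtain ⟨C, hC0, hC⟩ := exists_norm_hankel_zero_le_log
  refine ⟨C + 2, by positivity, fun κ ε hκ hε hκε => ?_⟩
  have hint := norm_setIntegral_le_of_norm_le_const (μ := volume) (s := Set.Ioo 0 ε) (by simp)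
    fun y hy => norm_aperturePotential_le hC hκ hκε hy
  rw [Real.volume_real_Ioo_of_le hε.le, sub_zero] at hint
  rwa [selfPotential, norm_div, Complex.norm_of_nonneg hε.le, div_le_iff₀ hε,
    intervalIntegral.integral_of_le hε.le, integral_Ioc_eq_integral_Ioo]

lemma mul_cot_mem_Icc {x : ℝ} (hx : 0 < x) (hx' : x < π / 2) : x * cot x ∈ Set.Icc 0 1 := by
  have hsin : 0 < sin x := sin_pos_of_pos_of_lt_pi hx (by linarith [pi_pos])
  have hcos : 0 < cos x := cos_pos_of_mem_Ioo ⟨by linarith, hx'⟩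
  have htan := Real.le_tan hx.le hx'
  rw [Real.tan_eq_sin_div_cos, le_div_iff₀ hcos] at htan
  rw [Real.cot_eq_cos_div_sin, mul_div_assoc']
  exact ⟨by positivity, (div_le_one hsin).2 htan⟩

lemma mul_log_one_div_mul_le (hκ : 0 < κ) (hε : 0 < ε) (hd : 0 < d)
    (hlog : ε * Real.log (wavelength κ / d) ≤ d) : ε * Real.log (1 / (κ * ε)) ≤ 2 * d := by
  have := pi_pos
  have hw : 0 < wavelength κ := by unfold wavelength; positivity
  have hprod : 1 / (κ * ε) ≤ wavelength κ / d * (d / ε) := by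
    have heq : wavelength κ / d * (d / ε) = 2 * π / (κ * ε) := by unfold wavelength; field_simp
    rw [heq]
    gcongr
    linarith [pi_gt_three]
  have hsplit : Real.log (1 / (κ * ε)) ≤ Real.log (wavelength κ / d) + d / ε := by
    refine (Real.log_le_log (by positivity) hprod).trans ?_
    rw [Real.log_mul (by positivity) (by positivity)]
    gcongr
    exact Real.log_le_self (by positivity)
  calc ε * Real.log (1 / (κ * ε)) ≤ ε * (Real.log (wavelength κ / d) + d / ε) := by gcongr
    _ = ε * Real.log (wavelength κ / d) + d := by field_simp
    _ ≤ 2 * d := by linarith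

lemma norm_apertureMean_background_mem_Icc (hκ : 0 ≤ κ) (hε : 0 < ε) (hκε : κ * ε ≤ 1 / 2)
    (θ : ℝ) : ‖apertureMean ε (uInc κ θ + uRef κ θ)‖ ∈ Set.Icc 1 3 := by
  have hdist := (norm_apertureMean_background_sub_two_le hκ hε θ).trans (by linarith : _ ≤ (1 : ℝ))
  have habs := abs_le.1 ((abs_norm_sub_norm_le _ _).trans hdist)
  rw [Complex.norm_two] at habs
  constructor <;> linarith [habs.1, habs.2]

namespace IsContinuousSolution

lemma norm_apertureMean_le (hκ : 0 < κ) (hε : 0 < ε) (hεd : ε ≤ d) (hκd : κ * d ≤ 1 / 2)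
    (hv : IsContinuousSolution κ θ ε d v) : ‖apertureMean ε v‖ ≤ 3 := by
  have hκε : κ * ε ≤ 1 / 2 := (mul_le_mul_of_nonneg_left hεd hκ.le).trans hκd
  have hcot := (mul_cot_mem_Icc (mul_pos hκ (hε.trans_le hεd)) (by linarith [pi_gt_three])).1
  have hq : 0 ≤ κ * cot (κ * d) / π := by
    refine div_nonneg (nonneg_of_mul_nonneg_right ?_ (hε.trans_le hεd)) pi_pos.le
    linarith
  have hone : 1 ≤ ‖1 + (κ * cot (κ * d) / π : ℝ) * selfPotential κ ε‖ := by
    refine le_trans ?_ (Complex.re_le_norm _)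
    rw [Complex.add_re, Complex.one_re, Complex.re_ofReal_mul]
    exact le_add_of_nonneg_right
      (mul_nonneg hq (selfPotential_re_nonneg hκ hε.le (by linarith [pi_gt_three])))
  refine (le_mul_of_one_le_right (norm_nonneg _) hone).trans ?_
  rw [← norm_mul, hv.apertureMean_mul_one_add hκ hε]
  exact (norm_apertureMean_background_mem_Icc hκ.le hε hκε θ).2

end IsContinuousSolution

lemma exists_le_norm_apertureMean : ∃ C₀ : ℝ, 0 < C₀ ∧ ∀ (κ θ ε d : ℝ) (v : Plane → ℂ), 0 < κ →
    0 < ε → ε ≤ d → κ * d ≤ 1 / 2 → ε * Real.log (wavelength κ / d) ≤ d →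
      IsContinuousSolution κ θ ε d v → C₀ ≤ ‖apertureMean ε v‖ := by
  obtain ⟨C, hC0, hC⟩ := exists_norm_selfPotential_le
  refine ⟨1 / (C + 3), by positivity, fun κ θ ε d v hκ hε hεd hκd hlog hv => ?_⟩
  have hd : 0 < d := hε.trans_le hεd
  have hκε : κ * ε ≤ 1 / 2 := (mul_le_mul_of_nonneg_left hεd hκ.le).trans hκd
  obtain ⟨hcot, hcot'⟩ := mul_cot_mem_Icc (mul_pos hκ hd) (by linarith [pi_gt_three])
  have hpot : ‖selfPotential κ ε‖ ≤ (C + 2) * d := by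
    refine (hC κ ε hκ hε (by linarith)).trans ?_
    nlinarith [mul_log_one_div_mul_le hκ hε hd hlog]
  have hq : ‖((κ * cot (κ * d) / π : ℝ) : ℂ)‖ ≤ 1 / d := by
    have hle : κ * cot (κ * d) = κ * d * cot (κ * d) / d := by field_simp
    rw [Complex.norm_of_nonneg (by rw [hle]; positivity), hle]
    refine (div_le_self (by positivity) (by linarith [pi_gt_three])).trans ?_
    gcongr
  have hfactor : ‖1 + (κ * cot (κ * d) / π : ℝ) * selfPotential κ ε‖ ≤ C + 3 := by
    calc ‖1 + (κ * cot (κ * d) / π : ℝ) * selfPotential κ ε‖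
        ≤ 1 + 1 / d * ((C + 2) * d) := by
          refine norm_add_le_of_le norm_one.le ?_
          rw [norm_mul]
          gcongr
      _ = C + 3 := by field_simp; ring
  rw [div_le_iff₀ (by positivity)]
  calc 1 ≤ ‖apertureMean ε (uInc κ θ + uRef κ θ)‖ :=
        (norm_apertureMean_background_mem_Icc hκ.le hε hκε θ).1
    _ = ‖apertureMean ε v‖ * ‖1 + (κ * cot (κ * d) / π : ℝ) * selfPotential κ ε‖ := by
        rw [← norm_mul, hv.apertureMean_mul_one_add hκ hε]
    _ ≤ ‖apertureMean ε v‖ * (C + 3) := by gcongr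

lemma mul_le_half_of_le_wavelength (hκ : 0 < κ) (h : d ≤ 1 / 20 * wavelength κ) :
    κ * d ≤ 1 / 2 := by
  calc κ * d ≤ κ * (1 / 20 * wavelength κ) := by gcongr
    _ = π / 10 := by unfold wavelength; field_simp; norm_num
    _ ≤ 1 / 2 := by linarith [pi_lt_four]

end Aperture

end Cavity

end

theorem theorem2p2_general :
    ∃ C₃ C₄ : ℝ, 0 < C₃ ∧ 0 < C₄ ∧
      ∀ (κ θ ε d : ℝ) (v : Cavity.Plane → ℂ),
        0 < κ → 0 < ε → ε ≤ d → κ * d ≤ 1 / 2 → Cavity.IsContinuousSolution κ θ ε d v →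
          eLpNorm v 2 (volume.restrict (Cavity.cavity ε d)) ≤ ENNReal.ofReal (C₄ * √(ε * d)) ∧
          (ε * Real.log (Cavity.wavelength κ / d) ≤ d →
            ENNReal.ofReal (C₃ * √(ε * d)) ≤
              eLpNorm v 2 (volume.restrict (Cavity.cavity ε d))) := by
  obtain ⟨C₀, hC₀, hlower⟩ := Cavity.exists_le_norm_apertureMean
  refine ⟨C₀ / 4, 3, by positivity, by norm_num, fun κ θ ε d v hκ hε hεd hκd hv => ?_⟩
  have hd : 0 < d := hε.trans_le hεd
  have hκd' : κ * d ≤ π / 2 := by linarith [pi_gt_three]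
  refine ⟨(hv.eLpNorm_cavity_le hε.le hκ hd hκd').trans ?_,
    fun hlog => le_trans ?_ (hv.le_eLpNorm_cavity hε.le hκ hd hκd')⟩
  · gcongr
    exact hv.norm_apertureMean_le hκ hε hεd hκd
  · gcongr
    exact hlower κ θ ε d v hκ hε hεd hκd hlog hv

theorem theorem2p2 :
    ∃ δ C₃ C₄ : ℝ, 0 < δ ∧ 0 < C₃ ∧ 0 < C₄ ∧
      ∀ (κ θ ε d : ℝ) (v : Cavity.Plane → ℂ),
        0 < κ → -(π / 2) < θ → θ < π / 2 → 0 < ε → 0 < d →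
        ε ≤ δ * d → d ≤ δ * Cavity.wavelength κ →
        Cavity.IsApproxSolution κ θ ε d v →
          eLpNorm v 2 (volume.restrict (Cavity.cavity ε d)) ≤ ENNReal.ofReal (C₄ * √(ε * d)) ∧
          (ε * Real.log (Cavity.wavelength κ / d) ≤ d →
            ENNReal.ofReal (C₃ * √(ε * d)) ≤
              eLpNorm v 2 (volume.restrict (Cavity.cavity ε d))) := by
  obtain ⟨C₃, C₄, hC₃, hC₄, h⟩ := theorem2p2_general
  refine ⟨1 / 20, C₃, C₄, by norm_num, hC₃, hC₄, fun κ θ ε d v hκ _ _ hε _ hεd hdw hv => ?_⟩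
  exact h κ θ ε d v hκ hε (by linarith) (Cavity.mul_le_half_of_le_wavelength hκ hdw)
    hv.isContinuousSolution
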